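/- Let $H\in(1/2,1]$. Let $T=\bigcup_{n\ge 0}\{0,1\}^n$ be the set of finite binary words, and let $(\epsilon(w))_{w\in T}$ be independent random variables, each taking the value $1$ with probability $(1+2^{H-1})/2$ and the value $-1$ with probability $(1-2^{H-1})/2$. For $w=w_1\cdots w_p\in\{0,1\}^p$ put $\boldsymbol{\epsilon}(w)=\prod_{k=1}^p\epsilon(w_1\cdots w_k)$, $t_w=\sum_{k=1}^p w_k2^{-k}$ and $I_w=[t_w,t_w+2^{-p}]$. For $n\ge1$ let $B_n$ be the random continuous function on $[0,1]$ with $B_n(0)=0$ that is affine on each $I_w$, $w\in\{0,1\}^n$, with increment $2^{-nH}\boldsymbol{\epsilon}(w)$ over $I_w$; that is, $B_n(t)=2^{-nH}\int_0^t2^n\epsilon(u_1)\cdots\epsilon(u_1\cdots u_n)\,du$, where $u_1u_2\cdots$ are the binary digits of $u$. For $w\in T$ let $B_n(w)$ be the function built in the same way from the signs $(\epsilon(w\cdot v))_{v\in T}$, so that $B_n=B_n(\emptyset)$. Let $\mathcal{F}_n$ be the $\sigma$-algebra generated by the $\epsilon(w)$, $w\in\bigcup_{k=1}^n\{0,1\}^k$.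 Let $S_0(t)=t/2$ and $S_1(t)=(t+1)/2$, and let $\mathcal{C}([0,1])$ be the space of real continuous functions on $[0,1]$ with the uniform norm. Then $(B_n)_{n\ge1}$ is a $\mathcal{C}([0,1])$-valued martingale with respect to $(\mathcal{F}_n)_{n\ge1}$, and it converges almost surely, and in $L^q$ norm for every $q\in[1,\infty)$, to a limit $B$ whose expectation is $\mathrm{Id}_{[0,1]}$. Almost surely, $B_n(w)$ converges uniformly for every $w\in T$; its limit is denoted by $B(w)$. With probability $1$: 1. for all $p\ge1$, $w\in\{0,1\}^p$ and $t\in I_w$, $$B(t)-B(t_w)=\boldsymbol{\epsilon}(w)\,2^{-pH}\,B(w)\bigl(S_{w_p}^{-1}\circ\cdots\circ S_{w_1}^{-1}(t)\bigr);$$ 2. $B$ is $\alpha$-Hölder continuous for all $\alpha\in(0,H)$, and for all $t\in[0,1]$ $$\liminf_{s\to t,\ s\ne t}\frac{\log|B(s)-B(t)|}{\log|s-t|}=H,$$ where $\log0=-\infty$, so that the quotient is $+\infty$ when $B(s)=B(t)$ and $0<|s-t|<1$; 3. the Hausdorff dimension and the box dimension (lower and upper) of the graph $\{(t,B(t)):t\in[0,1]\}\subset\mathbb{R}^2$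 are equal to $2-H$. -/

import Mathlib

open MeasureTheory ProbabilityTheory Filter Topology
open scoped NNReal ENNReal unitInterval

namespace SignedCascade

/-! Nodes of the binary tree are finite words `w = w₁ ⋯ wₚ`, coded as `List Bool` (first letter
first, `false` for the digit `0` and `true` for the digit `1`). A sign field is a function
`e : List Bool → ℝ`. -/

/-- The product `e (w₁) * e (w₁ w₂) * ⋯ * e (w₁ ⋯ wₚ)` of the signs along the branch from the
root (excluded) to the node `w`. -/
def signProd (e : List Bool → ℝ) (w : List Bool) : ℝ :=
  ∏ k ∈ Finset.range w.length, e (w.take (k + 1))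

/-- The word of length `n` formed by the `n` binary digits of `k`, the most significant one first;
for `k < 2 ^ n` it is the word `w` of length `n` with `∑ wᵢ 2 ^ (-i) = k / 2 ^ n`. -/
def binaryWord (n k : ℕ) : List Bool :=
  List.ofFn fun i : Fin n => k.testBit (n - 1 - i)

/-- The `k`-th step of the correlated random walk of generation `n`. -/
def walkStep (e : List Bool → ℝ) (n k : ℕ) : ℝ :=
  signProd e (binaryWord n k)

/-- The correlated random walk of generation `n`: the sum of the first `r` steps. -/
def walk (e : List Bool → ℝ) (n r : ℕ) : ℝ :=
  ∑ k ∈ Finset.range r, walkStep e n k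

/-- The values of the `n`-th function of the signed cascade with weights `2 ^ (-H) * e w`: the
piecewise linear interpolation of the walk of generation `n`, normalized by `2 ^ (-n H)`. -/
noncomputable def cascadeFun (H : ℝ) (e : List Bool → ℝ) (n : ℕ) (t : ℝ) : ℝ :=
  (2 : ℝ) ^ (-((n : ℝ) * H)) *
    (walk e n ⌊2 ^ n * t⌋₊ + (2 ^ n * t - ⌊2 ^ n * t⌋₊) * walkStep e n ⌊2 ^ n * t⌋₊)

theorem interp_eq_sum_ramp (a : ℕ → ℝ) {x : ℝ} (hx : 0 ≤ x) {N : ℕ} (hN : ⌊x⌋₊ < N) :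
    (∑ k ∈ Finset.range ⌊x⌋₊, a k) + (x - ⌊x⌋₊) * a ⌊x⌋₊
      = ∑ k ∈ Finset.range N, a k * max 0 (min 1 (x - k)) := by
  have h1 : (⌊x⌋₊ : ℝ) ≤ x := Nat.floor_le hx
  have h2 : x < ⌊x⌋₊ + 1 := Nat.lt_floor_add_one x
  induction N, hN using Nat.le_induction with
  | base =>
    rw [Finset.sum_range_succ, min_eq_right (by linarith), max_eq_right (by linarith)]
    congr 1
    · refine Finset.sum_congr rfl fun k hk => ?_
      have hk' : ((k : ℝ) + 1) ≤ ⌊x⌋₊ := by exact_mod_cast Finset.mem_range.1 hk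
      rw [min_eq_left (by linarith), max_eq_right zero_le_one, mul_one]
    · ring
  | succ N hN ih =>
    have hN' : ((⌊x⌋₊ : ℝ) + 1) ≤ N := by exact_mod_cast hN
    rw [Finset.sum_range_succ, ← ih, min_eq_right (by linarith), max_eq_left (by linarith)]
    ring

theorem cascadeFun_eq_sum_ramp (H : ℝ) (e : List Bool → ℝ) (n : ℕ) (t : I) :
    cascadeFun H e n t = (2 : ℝ) ^ (-((n : ℝ) * H)) *
      ∑ k ∈ Finset.range (2 ^ n + 1), walkStep e n k * max 0 (min 1 (2 ^ n * (t : ℝ) - k)) := by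
  have h0 : (0 : ℝ) ≤ 2 ^ n * (t : ℝ) := mul_nonneg (by positivity) t.2.1
  have h1 : ⌊2 ^ n * (t : ℝ)⌋₊ < 2 ^ n + 1 := by
    rw [Nat.floor_lt h0]
    have h2 : (2 : ℝ) ^ n * (t : ℝ) ≤ 2 ^ n := mul_le_of_le_one_right (by positivity) t.2.2
    push_cast
    linarith
  rw [cascadeFun, walk, interp_eq_sum_ramp (walkStep e n) h0 h1]

theorem continuous_cascadeFun (H : ℝ) (e : List Bool → ℝ) (n : ℕ) :
    Continuous fun t : I => cascadeFun H e n t := by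
  simp_rw [cascadeFun_eq_sum_ramp]
  fun_prop

/-- The `n`-th function of the signed cascade, as an element of `C([0,1], ℝ)`. -/
noncomputable def cascade (H : ℝ) (e : List Bool → ℝ) (n : ℕ) : C(I, ℝ) :=
  ⟨fun t => cascadeFun H e n t, continuous_cascadeFun H e n⟩

/-- The sign field seen from the node `w`. -/
def shift (e : List Bool → ℝ) (w : List Bool) : List Bool → ℝ :=
  fun v => e (w ++ v)

/-- The dyadic point `t_w = ∑ wᵢ 2 ^ (-i)`. -/
noncomputable def leftEnd (w : List Bool) : ℝ :=
  ∑ i : Fin w.length, ((w.get i).toNat : ℝ) * (2 : ℝ)⁻¹ ^ ((i : ℕ) + 1)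

/-- The dyadic interval `I_w = [t_w, t_w + 2 ^ (-p)]`, where `p` is the length of `w`. -/
noncomputable def dyadicInterval (w : List Bool) : Set ℝ :=
  Set.Icc (leftEnd w) (leftEnd w + (2 : ℝ)⁻¹ ^ w.length)

/-- The inverse of the map `S_b`, where `S₀ t = t / 2` and `S₁ t = (t + 1) / 2`. -/
def branchInv (b : Bool) (t : ℝ) : ℝ :=
  2 * t - (b.toNat : ℝ)

/-- The map `S_{wₚ}⁻¹ ∘ ⋯ ∘ S_{w₁}⁻¹`, which sends `I_w` affinely onto `[0, 1]`. -/
def rescale (w : List Bool) (t : ℝ) : ℝ :=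
  w.foldl (fun x b => branchInv b x) t

theorem leftEnd_cons (b : Bool) (w : List Bool) :
    leftEnd (b :: w) = ((b.toNat : ℝ) + leftEnd w) / 2 := by
  have h : leftEnd (b :: w) = ((b.toNat : ℝ)) * (2 : ℝ)⁻¹ ^ (0 + 1) +
      ∑ i : Fin w.length, ((w.get i).toNat : ℝ) * (2 : ℝ)⁻¹ ^ ((i : ℕ) + 1 + 1) :=
    Fin.sum_univ_succ (n := w.length)
      (fun i => (((b :: w).get i).toNat : ℝ) * (2 : ℝ)⁻¹ ^ ((i : ℕ) + 1))
  rw [h, leftEnd, add_div, Finset.sum_div]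
  congr 1
  · ring
  · refine Finset.sum_congr rfl fun i _ => ?_
    ring

theorem rescale_mem {w : List Bool} : ∀ {t : ℝ}, t ∈ dyadicInterval w → rescale w t ∈ I := by
  induction w with
  | nil =>
    intro t ht
    simpa [dyadicInterval, leftEnd, rescale] using ht
  | cons b w ih =>
    intro t ht
    have h1 : leftEnd (b :: w) ≤ t := ht.1
    have h2 : t ≤ leftEnd (b :: w) + (2 : ℝ)⁻¹ ^ (w.length + 1) := ht.2
    rw [leftEnd_cons] at h1 h2
    rw [pow_succ] at h2
    exact ih (t := branchInv b t)
      ⟨by simp only [branchInv]; linarith, by simp only [branchInv]; linarith⟩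

theorem leftEnd_mem (w : List Bool) : leftEnd w ∈ I := by
  have h : 0 ≤ leftEnd w ∧ leftEnd w + (2 : ℝ)⁻¹ ^ w.length ≤ 1 := by
    induction w with
    | nil => simp [leftEnd]
    | cons b w ih =>
      rw [leftEnd_cons, List.length_cons, pow_succ]
      have hb : (0 : ℝ) ≤ (b.toNat : ℝ) ∧ (b.toNat : ℝ) ≤ 1 := by cases b <;> simp
      constructor <;> linarith [ih.1, ih.2, hb.1, hb.2]
  have h' : (0 : ℝ) < (2 : ℝ)⁻¹ ^ w.length := by positivity
  exact ⟨h.1, by linarith [h.2]⟩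

/-- The filtration whose `n`-th σ-algebra is generated by the signs attached to the nodes of
generations `1, …, n`. -/
def signFiltration {Ω : Type*} [m : MeasurableSpace Ω] (ε : List Bool → Ω → ℝ)
    (hε : ∀ w, Measurable (ε w)) : Filtration ℕ m where
  seq n := ⨆ (w : List Bool) (_ : 1 ≤ w.length ∧ w.length ≤ n),
    MeasurableSpace.comap (ε w) inferInstance
  mono' _ _ hij := iSup_mono fun _ => iSup_mono' fun h => ⟨⟨h.1, h.2.trans hij⟩, le_rfl⟩
  le' _ := iSup_le fun w => iSup_le fun _ => (hε w).comap_le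

/-- The identity function of `[0, 1]`, as an element of `C([0,1], ℝ)`. -/
def idFun : C(I, ℝ) := ⟨fun t => (t : ℝ), continuous_subtype_val⟩

/-- The pointwise Hölder exponent `liminf_{s → t, s ≠ t} log |f s - f t| / log |s - t|`, an extended
real number, where `log 0 = -∞` (so that the quotient is `+∞` at the points `s` close to `t` with
`f s = f t`). -/
noncomputable def pointwiseExponent (f : C(I, ℝ)) (t : I) : EReal :=
  liminf (fun s : I => ENNReal.log (ENNReal.ofReal |f s - f t|) /
    ((Real.log |(s : ℝ) - (t : ℝ)| : ℝ) : EReal)) (𝓝[≠] t)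

/-- The graph of `f`, a subset of the Euclidean plane. -/
def graph (f : C(I, ℝ)) : Set (EuclideanSpace ℝ (Fin 2)) :=
  Set.range fun t : I => !₂[(t : ℝ), f t]

/-- The quotient `log N_δ(A) / (-log δ)`, where `N_δ(A)` is the least number of closed balls of radius
`δ` that cover `A`. -/
noncomputable def boxRatio {X : Type*} [PseudoMetricSpace X] (A : Set X) (δ : ℝ≥0) : EReal :=
  ENNReal.log (Metric.externalCoveringNumber δ A : ℝ≥0∞) / ((-Real.log δ : ℝ) : EReal)

/-- The lower box dimension of `A`. -/
noncomputable def lowerBoxDim {X : Type*} [PseudoMetricSpace X] (A : Set X) : EReal :=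
  liminf (boxRatio A) (𝓝[>] 0)

/-- The upper box dimension of `A`. -/
noncomputable def upperBoxDim {X : Type*} [PseudoMetricSpace X] (A : Set X) : EReal :=
  limsup (boxRatio A) (𝓝[>] 0)

end SignedCascade

/-! The cascade satisfies a two-branch recursion (`cascadeFun_succ_left`, `cascadeFun_succ_right`):
on each half of `[0, 1]` the function of generation `n + 1` is, up to an additive constant, a sign
times `2 ^ (-H)` times the function of generation `n` of the corresponding branch, and the two
branches are independent copies of the whole. Almost everything below is an induction along this
recursion.

*Convergence.* The signs have mean `2 ^ (H - 1)`, which is the martingale condition for the weights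
`2 ^ (-H) * ε`. The increments `endValue (n + 1) - endValue n` of the terminal value are
sub-Gaussian with a variance proxy proportional to `2 ^ ((1 - 2 H) n)`
(`hasSubgaussianMGF_endValue_sub`), since the recursion multiplies it by `2 * 2 ^ (-2 H)`; this is
where `H > 1 / 2` enters. The uniform norm of an increment of the cascade is at most `2 ^ (-H)`
times the sum of the maximum of those of the two branches and of an increment of a terminal value.
In `L^q` with `q ≥ 2` the maximum costs a factor `2 ^ (1 / 2)`, so that the norms decay
geometrically (`eLpNorm_cascadeIncr_le`), which gives the convergence almost surely and in every
`L^q`.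

*Regularity.* Passing to the limit in the recursion gives the scaling relation `limit_sub_leftEnd`,
by which the regularity of `B` is governed by the sizes of the functions `B w` hanging below the
words `w`. By the moment bounds and the Borel–Cantelli lemma, `‖B w‖` grows subexponentially in the
length of `w` (`ae_eventually_norm_le`), hence the Hölder continuity with every exponent less than
`H`. In the other direction, a small oscillation of the cascade forces small oscillations in both
branches, so that its probability is squared at each generation (`prob_randCascade_oscLE_le`);
hence the oscillation of `B w` decays at most polynomially in the length of `w`
(`ae_eventually_osc`), and the pointwise exponent is at most `H` everywhere.

*Dimensions.* Hölder continuity bounds the upper box dimension of the graph by `2 - H`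
(`upperBoxDim_graph_le`), and the Hausdorff dimension is at most the lower box dimension. The lower
bound for the Hausdorff dimension comes from the mass distribution principle applied to the image
of Lebesgue measure on the graph (`le_dimH_graph_of_ae_tsum_ne_top`). It rests on the small ball
estimate `P (|B t - B s| ≤ r) ≤ C * r * |t - s| ^ (-H)` (`exists_prob_abs_sub_le`), valid for `H <
1`: the characteristic function of a terminal value leaves the real axis near the origin because
its mean is `1`, an independent nondegenerate sign shrinks its imaginary part and therefore brings
its modulus below `1`, and each further branching squares the resulting bound while multiplying the
argument by `2 ^ H`. For `H = 1` the signs are almost surely `1`, there is no such decay, and the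
trivial bound for the measure of an interval of length `2 r` is enough. -/

namespace SignedCascade

/-! ### Words and the two-branch recursion -/

theorem length_binaryWord (n k : ℕ) : (binaryWord n k).length = n := by
  simp [binaryWord]

theorem binaryWord_succ_left {n k : ℕ} (hk : k < 2 ^ n) :
    binaryWord (n + 1) k = false :: binaryWord n k := by
  rw [binaryWord, List.ofFn_succ, binaryWord]
  congr 1
  · simpa using Nat.testBit_lt_two_pow hk
  · congr 1
    funext i
    congr 1
    simp only [Fin.val_succ]
    omega

theorem binaryWord_succ_right {n k : ℕ} (hk : k < 2 ^ n) :
    binaryWord (n + 1) (2 ^ n + k) = true :: binaryWord n k := by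
  rw [binaryWord, List.ofFn_succ, binaryWord]
  congr 1
  · simp [Nat.testBit_two_pow_add_eq, Nat.testBit_lt_two_pow hk]
  · congr 1
    funext i
    have hi := i.2
    have h1 : n + 1 - 1 - (i.succ : ℕ) = n - 1 - i := by
      simp only [Fin.val_succ]
      omega
    rw [h1, Nat.testBit_two_pow_add_gt (by omega)]

theorem leftEnd_binaryWord (n : ℕ) :
    ∀ {k : ℕ}, k < 2 ^ n → leftEnd (binaryWord n k) = (k : ℝ) / 2 ^ n := by
  induction n with
  | zero =>
    intro k hk
    obtain rfl : k = 0 := by simpa using hk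
    have h : binaryWord 0 0 = [] := rfl
    rw [h]
    simp [leftEnd]
  | succ n ih =>
    intro k hk
    rcases lt_or_ge k (2 ^ n) with h | h
    · rw [binaryWord_succ_left h, leftEnd_cons, ih h, pow_succ]
      simp
      ring
    · obtain ⟨j, rfl⟩ := Nat.exists_eq_add_of_le h
      have hj : j < 2 ^ n := by rw [pow_succ] at hk; omega
      rw [binaryWord_succ_right hj, leftEnd_cons, ih hj, pow_succ]
      push_cast
      field_simp
      simp

theorem leftEnd_add_le_one (w : List Bool) : leftEnd w + (2 : ℝ)⁻¹ ^ w.length ≤ 1 := by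
  induction w with
  | nil => simp [leftEnd]
  | cons c w ih =>
    rw [leftEnd_cons, List.length_cons, pow_succ]
    have hb : (c.toNat : ℝ) ≤ 1 := by cases c <;> simp
    linarith

theorem rescale_eq (w : List Bool) :
    ∀ t : ℝ, rescale w t = (2 : ℝ) ^ w.length * (t - leftEnd w) := by
  induction w with
  | nil => intro t; simp [rescale, leftEnd]
  | cons b w ih =>
    intro t
    have h : rescale (b :: w) t = rescale w (branchInv b t) := rfl
    rw [h, ih, leftEnd_cons, branchInv, List.length_cons, pow_succ]
    ring

/-- Every point of `[0, 1]` is the image under `rescale w` of a point of the interval of `w`. -/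
theorem exists_rescale_eq (w : List Bool) {x : ℝ} (hx : x ∈ I) :
    ∃ t ∈ dyadicInterval w, rescale w t = x := by
  refine ⟨leftEnd w + (2 : ℝ)⁻¹ ^ w.length * x, ⟨?_, ?_⟩, ?_⟩
  · have : 0 ≤ (2 : ℝ)⁻¹ ^ w.length * x := mul_nonneg (by positivity) hx.1
    linarith
  · have : (2 : ℝ)⁻¹ ^ w.length * x ≤ (2 : ℝ)⁻¹ ^ w.length :=
      mul_le_of_le_one_right (by positivity) hx.2
    linarith
  · rw [rescale_eq, add_sub_cancel_left, ← mul_assoc, ← mul_pow]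
    simp

theorem dyadicInterval_subset (w : List Bool) : dyadicInterval w ⊆ I := fun _ ht =>
  ⟨(leftEnd_mem w).1.trans ht.1, ht.2.trans (leftEnd_add_le_one w)⟩

theorem abs_sub_le_of_mem_dyadicInterval {w : List Bool} {s t : ℝ} (hs : s ∈ dyadicInterval w)
    (ht : t ∈ dyadicInterval w) : |s - t| ≤ (2 : ℝ)⁻¹ ^ w.length := by
  rw [abs_le]
  constructor <;> linarith [hs.1, hs.2, ht.1, ht.2]

/-- The interval of the word with digits `k` and length `n` is `[k / 2 ^ n, (k + 1) / 2 ^ n]`. -/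
theorem mem_dyadicInterval_binaryWord {n k : ℕ} (hk : k < 2 ^ n) {t : ℝ}
    (h1 : (k : ℝ) ≤ 2 ^ n * t) (h2 : 2 ^ n * t ≤ k + 1) : t ∈ dyadicInterval (binaryWord n k) := by
  have hp : (0 : ℝ) < 2 ^ n := by positivity
  rw [dyadicInterval, length_binaryWord, leftEnd_binaryWord n hk, inv_pow]
  constructor
  · rw [div_le_iff₀ hp]; linarith
  · rw [← sub_nonneg] at h2 ⊢
    have : (k : ℝ) / 2 ^ n + (2 ^ n)⁻¹ - t = (k + 1 - 2 ^ n * t) / 2 ^ n := by field_simp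
    rw [this]
    positivity

theorem exists_mem_dyadicInterval (n : ℕ) {t : ℝ} (ht : t ∈ I) :
    ∃ w : List Bool, w.length = n ∧ t ∈ dyadicInterval w := by
  have hp : (0 : ℝ) < 2 ^ n := by positivity
  rcases eq_or_lt_of_le ht.2 with h | h
  · refine ⟨binaryWord n (2 ^ n - 1), length_binaryWord _ _, ?_⟩
    have h1 : ((2 ^ n - 1 : ℕ) : ℝ) = 2 ^ n - 1 := by
      rw [Nat.cast_sub Nat.one_le_two_pow]
      simp
    refine mem_dyadicInterval_binaryWord (Nat.sub_lt (by positivity) one_pos) ?_ ?_ <;>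
      rw [h1, h] <;> linarith
  · have h0 : 0 ≤ 2 ^ n * t := mul_nonneg hp.le ht.1
    refine ⟨binaryWord n ⌊2 ^ n * t⌋₊, length_binaryWord _ _,
      mem_dyadicInterval_binaryWord ?_ (Nat.floor_le h0) (Nat.lt_floor_add_one _).le⟩
    rw [Nat.floor_lt h0]
    push_cast
    nlinarith

/-- An interval of length `t - s` contains a dyadic interval of comparable length. -/
theorem exists_dyadicInterval_between {s t : ℝ} (hs : s ∈ I) (ht : t ∈ I)
    (hst : s < t) : ∃ w : List Bool, s ≤ leftEnd w ∧ leftEnd w + (2 : ℝ)⁻¹ ^ w.length ≤ t ∧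
      (2 : ℝ) ^ w.length ≤ 4 / (t - s) := by
  have hu0 : 0 < t - s := by linarith
  obtain ⟨q, h1, h2⟩ := exists_nat_pow_near_of_lt_one hu0 (show t - s ≤ 1 by linarith [hs.1, ht.2])
    (show (0 : ℝ) < 2⁻¹ by norm_num) (by norm_num)
  have hp : (0 : ℝ) < 2 ^ (q + 2) := by positivity
  have h1' : 1 < (t - s) * 2 ^ (q + 1) := by
    rw [inv_pow, inv_lt_iff_one_lt_mul₀ (by positivity)] at h1
    linarith
  have h3 : 2 ≤ (t - s) * 2 ^ (q + 2) := by
    rw [pow_succ]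
    linarith
  have hs0 : 0 ≤ 2 ^ (q + 2) * s := mul_nonneg hp.le hs.1
  set k := ⌈2 ^ (q + 2) * s⌉₊ with hk
  have hk1 : 2 ^ (q + 2) * s ≤ k := Nat.le_ceil _
  have hk2 : (k : ℝ) < 2 ^ (q + 2) * s + 1 := Nat.ceil_lt_add_one hs0
  have hkt : (k : ℝ) + 1 ≤ 2 ^ (q + 2) * t := by linarith
  have hkp : k < 2 ^ (q + 2) := by
    have h4 : (2 : ℝ) ^ (q + 2) * t ≤ 2 ^ (q + 2) := mul_le_of_le_one_right hp.le ht.2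
    have h5 : (k : ℝ) < (2 ^ (q + 2) : ℕ) := by push_cast; linarith
    exact_mod_cast h5
  refine ⟨binaryWord (q + 2) k, ?_, ?_, ?_⟩
  · rw [leftEnd_binaryWord _ hkp, le_div_iff₀ hp]
    linarith
  · rw [leftEnd_binaryWord _ hkp, length_binaryWord, inv_pow, ← one_div, ← add_div, div_le_iff₀ hp]
    linarith
  · rw [length_binaryWord, le_div_iff₀ hu0, pow_add]
    rw [inv_pow, le_inv_comm₀ hu0 (by positivity)] at h2
    have h6 : (2 : ℝ) ^ q * (t - s) ≤ (t - s)⁻¹ * (t - s) := by gcongr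
    rw [inv_mul_cancel₀ hu0.ne'] at h6
    linarith

theorem signProd_nil (e : List Bool → ℝ) : signProd e [] = 1 := by
  simp [signProd]

theorem signProd_cons (e : List Bool → ℝ) (b : Bool) (w : List Bool) :
    signProd e (b :: w) = e [b] * signProd (shift e [b]) w := by
  rw [signProd, List.length_cons, Finset.prod_range_succ', mul_comm]
  rfl

theorem abs_signProd {e : List Bool → ℝ} (he : ∀ w, |e w| = 1) (w : List Bool) :
    |signProd e w| = 1 := by
  simp [signProd, Finset.abs_prod, he]

/-- The `k`-th ramp of generation `n`, as a function on the line: it vanishes up to `k / 2 ^ n`, grows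
with slope `2 ^ n` on the interval of length `2 ^ (-n)` that follows, and is `1` afterwards. -/
noncomputable def rampFun (n k : ℕ) (t : ℝ) : ℝ :=
  max 0 (min 1 (2 ^ n * t - k))

theorem cascadeFun_eq_sum (H : ℝ) (e : List Bool → ℝ) (n : ℕ) {t : ℝ} (ht : t ∈ I) :
    cascadeFun H e n t = (2 : ℝ) ^ (-((n : ℝ) * H)) *
      ∑ k ∈ Finset.range (2 ^ n), walkStep e n k * rampFun n k t := by
  have h := cascadeFun_eq_sum_ramp H e n ⟨t, ht⟩
  have h0 : max 0 (min 1 ((2 : ℝ) ^ n * t - (2 ^ n : ℕ))) = 0 := by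
    have h2 : (2 : ℝ) ^ n * t ≤ 2 ^ n := mul_le_of_le_one_right (by positivity) ht.2
    apply max_eq_left
    push_cast
    exact (min_le_right _ _).trans (by linarith)
  rw [Finset.sum_range_succ] at h
  simp only [h0, mul_zero, add_zero] at h
  exact h

theorem rampFun_succ (n k : ℕ) (t : ℝ) : rampFun (n + 1) k t = rampFun n k (2 * t) := by
  rw [rampFun, rampFun, pow_succ, mul_assoc]

theorem rampFun_succ_add (n k : ℕ) (t : ℝ) :
    rampFun (n + 1) (2 ^ n + k) t = rampFun n k (2 * t - 1) := by
  rw [rampFun, rampFun, pow_succ]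
  push_cast
  congr 2
  ring

theorem rampFun_of_nonpos (n k : ℕ) {t : ℝ} (ht : t ≤ 0) : rampFun n k t = 0 := by
  have h : (2 : ℝ) ^ n * t ≤ 0 := mul_nonpos_of_nonneg_of_nonpos (by positivity) ht
  have hk : (0 : ℝ) ≤ k := k.cast_nonneg
  exact max_eq_left ((min_le_right _ _).trans (by linarith))

theorem rampFun_of_one_le {n k : ℕ} (hk : k < 2 ^ n) {t : ℝ} (ht : 1 ≤ t) : rampFun n k t = 1 := by
  have h : (2 : ℝ) ^ n ≤ 2 ^ n * t := le_mul_of_one_le_right (by positivity) ht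
  have hk : (k : ℝ) + 1 ≤ 2 ^ n := by exact_mod_cast hk
  rw [rampFun, min_eq_left (by linarith), max_eq_right zero_le_one]

theorem walkStep_succ_left (e : List Bool → ℝ) {n k : ℕ} (hk : k < 2 ^ n) :
    walkStep e (n + 1) k = e [false] * walkStep (shift e [false]) n k := by
  rw [walkStep, binaryWord_succ_left hk, signProd_cons, walkStep]

theorem walkStep_succ_right (e : List Bool → ℝ) {n k : ℕ} (hk : k < 2 ^ n) :
    walkStep e (n + 1) (2 ^ n + k) = e [true] * walkStep (shift e [true]) n k := by
  rw [walkStep, binaryWord_succ_right hk, signProd_cons, walkStep]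

theorem two_rpow_neg_succ_mul (H : ℝ) (n : ℕ) :
    (2 : ℝ) ^ (-(((n + 1 : ℕ) : ℝ) * H)) = 2 ^ (-H) * 2 ^ (-((n : ℝ) * H)) := by
  rw [← Real.rpow_add two_pos]
  push_cast
  congr 1
  ring

/-- The recursion along the two branches at the root. Each ramp of generation `n + 1` is a ramp of
generation `n` evaluated at `2 t` or `2 t - 1`, according to the first letter of its word. -/
theorem cascadeFun_succ (H : ℝ) (e : List Bool → ℝ) (n : ℕ) {t : ℝ} (ht : t ∈ I) :
    cascadeFun H e (n + 1) t = (2 : ℝ) ^ (-H) * (2 : ℝ) ^ (-((n : ℝ) * H)) *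
      (e [false] * ∑ k ∈ Finset.range (2 ^ n), walkStep (shift e [false]) n k * rampFun n k (2 * t)
      + e [true] * ∑ k ∈ Finset.range (2 ^ n),
          walkStep (shift e [true]) n k * rampFun n k (2 * t - 1)) := by
  rw [cascadeFun_eq_sum H e _ ht, two_rpow_neg_succ_mul, pow_succ, mul_two, Finset.sum_range_add]
  congr 1
  rw [Finset.mul_sum, Finset.mul_sum]
  congr 1
  · refine Finset.sum_congr rfl fun k hk => ?_
    rw [walkStep_succ_left e (Finset.mem_range.1 hk), rampFun_succ, mul_assoc]
  · refine Finset.sum_congr rfl fun k hk => ?_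
    rw [walkStep_succ_right e (Finset.mem_range.1 hk), rampFun_succ_add, mul_assoc]

theorem cascadeFun_succ_left (H : ℝ) (e : List Bool → ℝ) (n : ℕ) {t : ℝ} (h0 : 0 ≤ t)
    (h1 : t ≤ 1 / 2) :
    cascadeFun H e (n + 1) t =
      (2 : ℝ) ^ (-H) * (e [false] * cascadeFun H (shift e [false]) n (2 * t)) := by
  rw [cascadeFun_succ H e n ⟨h0, by linarith⟩,
    cascadeFun_eq_sum H (shift e [false]) n (t := 2 * t) ⟨by linarith, by linarith⟩]
  simp only [rampFun_of_nonpos n _ (show 2 * t - 1 ≤ 0 by linarith), mul_zero,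
    Finset.sum_const_zero, add_zero]
  ring

theorem cascadeFun_succ_right (H : ℝ) (e : List Bool → ℝ) (n : ℕ) {t : ℝ} (h0 : 1 / 2 ≤ t)
    (h1 : t ≤ 1) :
    cascadeFun H e (n + 1) t =
      (2 : ℝ) ^ (-H) * (e [false] * cascadeFun H (shift e [false]) n 1 +
        e [true] * cascadeFun H (shift e [true]) n (2 * t - 1)) := by
  rw [cascadeFun_succ H e n ⟨by linarith, h1⟩,
    cascadeFun_eq_sum H (shift e [true]) n (t := 2 * t - 1) ⟨by linarith, by linarith⟩,
    cascadeFun_eq_sum H (shift e [false]) n (t := 1) ⟨zero_le_one, le_rfl⟩]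
  have h : ∑ k ∈ Finset.range (2 ^ n), walkStep (shift e [false]) n k * rampFun n k (2 * t) =
      ∑ k ∈ Finset.range (2 ^ n), walkStep (shift e [false]) n k * rampFun n k 1 := by
    refine Finset.sum_congr rfl fun k hk => ?_
    rw [rampFun_of_one_le (Finset.mem_range.1 hk) (by linarith),
      rampFun_of_one_le (Finset.mem_range.1 hk) le_rfl]
  rw [h]
  ring

theorem cascadeFun_zero_left (H : ℝ) (e : List Bool → ℝ) {t : ℝ} (ht : t ∈ I) :
    cascadeFun H e 0 t = t := by
  rw [cascadeFun_eq_sum H e 0 ht]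
  simp [walkStep, binaryWord, signProd, rampFun, ht.1, ht.2]

theorem cascadeFun_zero_right (H : ℝ) (e : List Bool → ℝ) (n : ℕ) : cascadeFun H e n 0 = 0 := by
  rw [cascadeFun_eq_sum H e n ⟨le_rfl, zero_le_one⟩]
  simp [rampFun_of_nonpos]

theorem cascadeFun_one_succ (H : ℝ) (e : List Bool → ℝ) (n : ℕ) :
    cascadeFun H e (n + 1) 1 = (2 : ℝ) ^ (-H) * (e [false] * cascadeFun H (shift e [false]) n 1 +
        e [true] * cascadeFun H (shift e [true]) n 1) := by
  rw [cascadeFun_succ_right H e n (by norm_num) le_rfl]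
  norm_num

/-- The self-similarity of the cascade over the dyadic interval of `w`, at finite generations. -/
theorem cascadeFun_sub_leftEnd (H : ℝ) (n : ℕ) (w : List Bool) :
    ∀ (e : List Bool → ℝ) {t : ℝ}, t ∈ dyadicInterval w →
      cascadeFun H e (n + w.length) t - cascadeFun H e (n + w.length) (leftEnd w) =
        signProd e w * (2 : ℝ) ^ (-((w.length : ℝ) * H)) *
          cascadeFun H (shift e w) n (rescale w t) := by
  induction w with
  | nil =>
    intro e t _
    have h : leftEnd [] = 0 := by simp [leftEnd]
    simp only [List.length_nil, add_zero, h, cascadeFun_zero_right, signProd_nil, rescale,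
      List.foldl_nil, CharP.cast_eq_zero, zero_mul, neg_zero, Real.rpow_zero, one_mul, sub_zero]
    rfl
  | cons b w ih =>
    intro e t ht
    have h1 : leftEnd (b :: w) ≤ t := ht.1
    have h2 : t ≤ leftEnd (b :: w) + (2 : ℝ)⁻¹ ^ (w.length + 1) := ht.2
    have ht' : branchInv b t ∈ dyadicInterval w := by
      rw [leftEnd_cons] at h1 h2
      rw [pow_succ] at h2
      exact ⟨by simp only [branchInv]; linarith, by simp only [branchInv]; linarith⟩
    have hl := leftEnd_mem w
    have hu : branchInv b t ≤ 1 := ht'.2.trans (leftEnd_add_le_one w)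
    have hlo : 0 ≤ branchInv b t := hl.1.trans ht'.1
    have key := ih (shift e [b]) ht'
    have e1 : shift (shift e [b]) w = shift e (b :: w) := rfl
    have e2 : rescale w (branchInv b t) = rescale (b :: w) t := rfl
    rw [e1, e2] at key
    have hlen : n + (b :: w).length = (n + w.length) + 1 := by simp [add_assoc]
    have hpow := two_rpow_neg_succ_mul H w.length
    rw [hlen, signProd_cons, List.length_cons, hpow, leftEnd_cons]
    cases b with
    | false =>
      simp only [branchInv, Bool.toNat_false, CharP.cast_eq_zero, sub_zero] at hlo hu key
      rw [cascadeFun_succ_left H e _ (by linarith) (by linarith),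
        cascadeFun_succ_left H e _ (by simp; linarith [hl.1]) (by simp; linarith [hl.2])]
      have e3 : 2 * ((((false.toNat : ℕ) : ℝ) + leftEnd w) / 2) = leftEnd w := by simp; ring
      rw [e3, ← mul_sub, ← mul_sub, key]
      ring
    | true =>
      simp only [branchInv, Bool.toNat_true, Nat.cast_one] at hlo hu key
      rw [cascadeFun_succ_right H e _ (by linarith) (by linarith),
        cascadeFun_succ_right H e _ (by simp; linarith [hl.1]) (by simp; linarith [hl.2])]
      have e3 : 2 * ((((true.toNat : ℕ) : ℝ) + leftEnd w) / 2) - 1 = leftEnd w := by simp; ring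
      rw [e3, ← mul_sub, add_sub_add_left_eq_sub, ← mul_sub, key]
      ring

/-! ### Random sign fields -/

/-- A random sign field: independent signs indexed by the words, each of mean `2 ^ (H - 1)`. -/
structure IsSignField {Ω : Type*} [MeasurableSpace Ω] (P : Measure Ω) (H : ℝ)
    (ε : List Bool → Ω → ℝ) : Prop where
  measurable : ∀ w, Measurable (ε w)
  indep : iIndepFun ε P
  prob_one : ∀ w, P {ω | ε w ω = 1} = ENNReal.ofReal ((1 + (2 : ℝ) ^ (H - 1)) / 2)
  prob_neg_one : ∀ w, P {ω | ε w ω = -1} = ENNReal.ofReal ((1 - (2 : ℝ) ^ (H - 1)) / 2)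

/-- The `n`-th random function of the cascade built from the sign field `ε`. -/
noncomputable def randCascade {Ω : Type*} (H : ℝ) (ε : List Bool → Ω → ℝ) (n : ℕ) (ω : Ω) : C(I, ℝ) :=
  cascade H (fun v => ε v ω) n

/-- The part of the sign field `ε` that hangs below the word `w`. -/
def below {Ω : Type*} (ε : List Bool → Ω → ℝ) (w : List Bool) : List Bool → Ω → ℝ :=
  fun v => ε (w ++ v)

/-- The σ-algebra generated by the signs of the words of `S`. -/
def sigmaOf {Ω : Type*} (ε : List Bool → Ω → ℝ) (S : Set (List Bool)) : MeasurableSpace Ω :=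
  ⨆ u ∈ S, MeasurableSpace.comap (ε u) inferInstance

/-- The words that begin with the letter `b`. -/
def branch (b : Bool) : Set (List Bool) := {u | ∃ v, u = b :: v}

theorem cons_mem_branch (b : Bool) (v : List Bool) : b :: v ∈ branch b := ⟨v, rfl⟩

/-- The ramps of generation `n`, as elements of `C([0,1], ℝ)`. -/
noncomputable def ramp (n k : ℕ) : C(I, ℝ) :=
  ⟨fun t => rampFun n k t, by unfold rampFun; fun_prop⟩

theorem cascade_eq_sum (H : ℝ) (e : List Bool → ℝ) (n : ℕ) :
    cascade H e n = ∑ k ∈ Finset.range (2 ^ n),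
      ((2 : ℝ) ^ (-((n : ℝ) * H)) * walkStep e n k) • ramp n k := by
  ext t
  have h : cascade H e n t = cascadeFun H e n t := rfl
  rw [h, cascadeFun_eq_sum H e n t.2, Finset.mul_sum]
  simp only [ContinuousMap.coe_sum, Finset.sum_apply, ContinuousMap.coe_smul, Pi.smul_apply,
    smul_eq_mul, mul_assoc]
  rfl

section SigmaAlgebras

variable {Ω : Type*} {ε : List Bool → Ω → ℝ}

theorem measurable_sigmaOf {S : Set (List Bool)} {u : List Bool} (hu : u ∈ S) :
    Measurable[sigmaOf ε S] (ε u) := by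
  rw [measurable_iff_comap_le]
  exact le_iSup₂_of_le u hu le_rfl

theorem signFiltration_eq [MeasurableSpace Ω] (hε : ∀ w, Measurable (ε w)) (n : ℕ) :
    signFiltration ε hε n = sigmaOf ε {v | 1 ≤ v.length ∧ v.length ≤ n} :=
  rfl

theorem measurable_signProd {m : MeasurableSpace Ω} {w : List Bool}
    (h : ∀ v : List Bool, 1 ≤ v.length → v.length ≤ w.length → Measurable[m] (ε v)) :
    Measurable[m] (fun ω => signProd (fun v => ε v ω) w) := by
  unfold signProd
  refine Finset.measurable_fun_prod _ fun k hk => h _ ?_ ?_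
  · have := Finset.mem_range.1 hk
    rw [List.length_take]
    omega
  · exact List.length_take_le' _ _

theorem stronglyMeasurable_randCascade_of {m : MeasurableSpace Ω} (H : ℝ) {n : ℕ}
    (h : ∀ v : List Bool, 1 ≤ v.length → v.length ≤ n → Measurable[m] (ε v)) :
    StronglyMeasurable[m] (randCascade H ε n) := by
  have h1 : randCascade H ε n = fun ω => ∑ k ∈ Finset.range (2 ^ n),
      ((2 : ℝ) ^ (-((n : ℝ) * H)) * walkStep (fun v => ε v ω) n k) • ramp n k := by
    funext ω
    exact cascade_eq_sum _ _ _
  rw [h1]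
  refine Finset.stronglyMeasurable_fun_sum _ fun k _ => StronglyMeasurable.smul_const ?_ _
  refine Measurable.stronglyMeasurable (Measurable.const_mul ?_ _)
  exact measurable_signProd fun v h1 h2 => h v h1 (by rwa [length_binaryWord] at h2)

theorem stronglyMeasurable_eval {m : MeasurableSpace Ω} {f : Ω → C(I, ℝ)}
    (hf : StronglyMeasurable[m] f) (t : I) : StronglyMeasurable[m] (fun ω => f ω t) :=
  (continuous_eval_const t).comp_stronglyMeasurable hf

theorem measurable_sign_branch (b : Bool) :
    Measurable[sigmaOf ε (branch b)] (ε [b]) :=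
  measurable_sigmaOf (cons_mem_branch b [])

theorem stronglyMeasurable_randCascade_branch (H : ℝ) (n : ℕ) (b : Bool) :
    StronglyMeasurable[sigmaOf ε (branch b)] (randCascade H (below ε [b]) n) := by
  refine stronglyMeasurable_randCascade_of H fun v _ _ => ?_
  have h : Measurable[sigmaOf ε (branch b)] (ε (b :: v)) := measurable_sigmaOf (cons_mem_branch b v)
  exact h

/-- The cascade below a word of length one does not involve the sign of that word. -/
theorem stronglyMeasurable_randCascade_compl (H : ℝ) (n : ℕ) (b : Bool) :
    StronglyMeasurable[sigmaOf ε {[b]}ᶜ] (randCascade H (below ε [b]) n) := by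
  refine stronglyMeasurable_randCascade_of H fun v hv _ => ?_
  have h1 : b :: v ∈ ({[b]}ᶜ : Set (List Bool)) := by
    rw [Set.mem_compl_singleton_iff]
    rintro h
    simp only [List.cons.injEq, true_and] at h
    simp [h] at hv
  have h : Measurable[sigmaOf ε {[b]}ᶜ] (ε (b :: v)) := measurable_sigmaOf h1
  exact h

end SigmaAlgebras

namespace IsSignField

variable {Ω : Type*} {mΩ : MeasurableSpace Ω} {P : Measure Ω} {H : ℝ} {ε : List Bool → Ω → ℝ}

protected theorem below (h : IsSignField P H ε) (w : List Bool) : IsSignField P H (below ε w) where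
  measurable _ := h.measurable _
  indep := by
    have := h.indep.precomp (g := fun v => w ++ v) (List.append_right_injective w)
    exact this
  prob_one _ := h.prob_one _
  prob_neg_one _ := h.prob_neg_one _

theorem sigmaOf_le (h : IsSignField P H ε) (S : Set (List Bool)) :
    sigmaOf ε S ≤ mΩ :=
  iSup₂_le fun u _ => (h.measurable u).comap_le

theorem indep_sigmaOf (h : IsSignField P H ε) {S T : Set (List Bool)} (hST : Disjoint S T) :
    Indep (sigmaOf ε S) (sigmaOf ε T) P :=
  indep_iSup_of_disjoint (fun u => (h.measurable u).comap_le) h.indep.iIndep hST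

/-- The signs of the two branches at the root are independent. -/
theorem indep_branch (h : IsSignField P H ε) :
    Indep (sigmaOf ε (branch false)) (sigmaOf ε (branch true)) P := by
  refine h.indep_sigmaOf (Set.disjoint_left.2 ?_)
  rintro _ ⟨v, rfl⟩ ⟨u, hu⟩
  simp at hu

/-- A sign is independent of everything that is determined by the other signs. -/
theorem indepFun_sign (h : IsSignField P H ε) (w : List Bool) {β : Type*} [MeasurableSpace β]
    {X : Ω → β} (hX : Measurable[sigmaOf ε {w}ᶜ] X) : IndepFun (ε w) X P := by
  have h1 := h.indep_sigmaOf (S := {w}) (T := {w}ᶜ) disjoint_compl_right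
  rw [IndepFun_iff_Indep]
  refine indep_of_indep_of_le_left (indep_of_indep_of_le_right h1 hX.comap_le) ?_
  rw [← measurable_iff_comap_le]
  exact measurable_sigmaOf (Set.mem_singleton _)

theorem stronglyMeasurable_randCascade (h : IsSignField P H ε) (n : ℕ) :
    StronglyMeasurable (randCascade H ε n) :=
  stronglyMeasurable_randCascade_of H fun v _ _ => h.measurable v

theorem measurable_eval (h : IsSignField P H ε) (n : ℕ) (t : I) :
    Measurable (fun ω => randCascade H ε n ω t) :=
  (stronglyMeasurable_eval (h.stronglyMeasurable_randCascade n) t).measurable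

variable [IsProbabilityMeasure P]

theorem ae_eq_one_or (h : IsSignField P H ε) (hH1 : H ≤ 1) (w : List Bool) :
    ∀ᵐ ω ∂P, ε w ω = 1 ∨ ε w ω = -1 := by
  have h1 : MeasurableSet {ω | ε w ω = 1} := h.measurable w (measurableSet_singleton 1)
  have h2 : MeasurableSet {ω | ε w ω = -1} := h.measurable w (measurableSet_singleton (-1))
  have hm : (2 : ℝ) ^ (H - 1) ≤ 1 := Real.rpow_le_one_of_one_le_of_nonpos one_le_two (by linarith)
  have hm0 : (0 : ℝ) < (2 : ℝ) ^ (H - 1) := by positivity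
  have h3 : P ({ω | ε w ω = 1} ∪ {ω | ε w ω = -1}) = 1 := by
    rw [measure_union _ h2, h.prob_one, h.prob_neg_one, ← ENNReal.ofReal_add (by linarith)
      (by linarith)]
    · rw [← ENNReal.ofReal_one]
      congr 1
      ring
    · rw [Set.disjoint_left]
      intro ω h4 h5
      simp only [Set.mem_ofPred_eq] at h4 h5
      linarith
  exact (mem_ae_iff_prob_eq_one (h1.union h2)).2 h3

theorem ae_abs_eq_one (h : IsSignField P H ε) (hH1 : H ≤ 1) : ∀ᵐ ω ∂P, ∀ w, |ε w ω| = 1 := by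
  rw [ae_all_iff]
  intro w
  filter_upwards [h.ae_eq_one_or hH1 w] with ω hω
  rcases hω with hω | hω <;> simp [hω]

/-- Integrating out a sign that is independent of `X`. -/
theorem integral_comp_mul (h : IsSignField P H ε) (hH1 : H ≤ 1) (w : List Bool) {E : Type*}
    [NormedAddCommGroup E] [NormedSpace ℝ E] [CompleteSpace E] {X : Ω → ℝ} (hX : Measurable X)
    (hind : IndepFun (ε w) X P) {g : ℝ → E} (hg : StronglyMeasurable g)
    (h1 : Integrable (fun ω => g (X ω)) P) (h2 : Integrable (fun ω => g (-X ω)) P) :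
    Integrable (fun ω => g (ε w ω * X ω)) P ∧
    ∫ ω, g (ε w ω * X ω) ∂P = ((1 + (2 : ℝ) ^ (H - 1)) / 2) • ∫ ω, g (X ω) ∂P +
      ((1 - (2 : ℝ) ^ (H - 1)) / 2) • ∫ ω, g (-X ω) ∂P := by
  have hm : (2 : ℝ) ^ (H - 1) ≤ 1 := Real.rpow_le_one_of_one_le_of_nonpos one_le_two (by linarith)
  have hm0 : (0 : ℝ) < (2 : ℝ) ^ (H - 1) := by positivity
  have key : ∀ (a : ℝ) (f : ℝ → E), StronglyMeasurable f → Integrable (fun ω => f (X ω)) P →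
      Integrable ({ω | ε w ω = a}.indicator fun ω => f (X ω)) P ∧
      ∫ ω, ({ω | ε w ω = a}.indicator fun ω => f (X ω)) ω ∂P =
        P.real {ω | ε w ω = a} • ∫ ω, f (X ω) ∂P := by
    intro a f hf hint
    have hs : MeasurableSet {ω | ε w ω = a} := h.measurable w (measurableSet_singleton a)
    refine ⟨hint.indicator hs, ?_⟩
    rw [integral_indicator hs]
    have hi : Indep (MeasurableSpace.comap X inferInstance)
        (MeasurableSpace.comap (ε w) inferInstance) P := hind.symm
    have hc := condExp_indep_eq hX.comap_le (h.measurable w).comap_le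
      (f := fun ω => f (X ω)) (hf.comp_measurable (comap_measurable X)) hi
    have hs' : MeasurableSet[MeasurableSpace.comap (ε w) inferInstance] {ω | ε w ω = a} :=
      ⟨{a}, measurableSet_singleton a, rfl⟩
    rw [← setIntegral_condExp (h.measurable w).comap_le hint hs',
      setIntegral_congr_ae hs (hc.mono fun ω hω _ => hω), setIntegral_const]
  obtain ⟨i1, e1⟩ := key 1 g hg h1
  obtain ⟨i2, e2⟩ := key (-1) (fun x => g (-x)) (hg.comp_measurable measurable_neg) h2
  have hae : (fun ω => g (ε w ω * X ω)) =ᵐ[P] fun ω =>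
      ({ω | ε w ω = 1}.indicator fun ω => g (X ω)) ω +
        ({ω | ε w ω = -1}.indicator fun ω => g (-X ω)) ω := by
    filter_upwards [h.ae_eq_one_or hH1 w] with ω hω
    rcases hω with hω | hω
    · simp [Set.indicator, hω, show ¬ (1 : ℝ) = -1 by norm_num]
    · simp [Set.indicator, hω, show ¬ (-1 : ℝ) = 1 by norm_num]
  refine ⟨(i1.add i2).congr hae.symm, ?_⟩
  rw [integral_congr_ae hae, integral_add i1 i2, e1, e2, measureReal_def, measureReal_def,
    h.prob_one, h.prob_neg_one, ENNReal.toReal_ofReal (by linarith),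
    ENNReal.toReal_ofReal (by linarith)]

theorem integral_sign (h : IsSignField P H ε) (hH1 : H ≤ 1) (w : List Bool) :
    Integrable (ε w) P ∧ ∫ ω, ε w ω ∂P = (2 : ℝ) ^ (H - 1) := by
  have := h.integral_comp_mul hH1 w (X := fun _ => 1) measurable_const
    (indepFun_const_right _ _) (g := id) stronglyMeasurable_id (integrable_const _)
    (integrable_const _)
  simp only [mul_one, id, integral_const, probReal_univ, smul_eq_mul] at this
  refine ⟨this.1, this.2.trans ?_⟩
  ring

end IsSignField

/-! ### The martingale property -/

theorem binaryWord_append (n k : ℕ) (b : Bool) :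
    binaryWord (n + 1) (2 * k + b.toNat) = binaryWord n k ++ [b] := by
  rw [binaryWord, List.ofFn_succ', List.concat_eq_append, binaryWord]
  congr 2
  · funext i
    have hi := i.2
    have h1 : n + 1 - 1 - (i.castSucc : ℕ) = (n - 1 - i) + 1 := by
      simp only [Fin.val_castSucc]
      omega
    rw [h1, Nat.testBit_succ]
    congr 1
    cases b <;> simp <;> omega
  · cases b <;> simp

theorem signProd_append (e : List Bool → ℝ) (w : List Bool) (b : Bool) :
    signProd e (w ++ [b]) = signProd e w * e (w ++ [b]) := by
  rw [signProd, signProd, List.length_append, List.length_singleton, Finset.prod_range_succ]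
  congr 1
  · refine Finset.prod_congr rfl fun k hk => ?_
    rw [List.take_append_of_le_length]
    exact Finset.mem_range.1 hk
  · rw [List.take_of_length_le (by simp)]

theorem sum_range_two_mul {M : Type*} [AddCommMonoid M] (f : ℕ → M) (N : ℕ) :
    ∑ k ∈ Finset.range (2 * N), f k = ∑ k ∈ Finset.range N, (f (2 * k) + f (2 * k + 1)) := by
  induction N with
  | zero => simp
  | succ N ih =>
    rw [Finset.sum_range_succ, ← ih, mul_add, mul_one, Finset.sum_range_succ,
      Finset.sum_range_succ, add_assoc]

/-- A ramp of generation `n` is the mean of the two ramps of generation `n + 1` that it covers. -/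
theorem ramp_eq_half_add (n k : ℕ) :
    ramp n k = (2 : ℝ)⁻¹ • (ramp (n + 1) (2 * k) + ramp (n + 1) (2 * k + 1)) := by
  ext t
  simp only [ramp, rampFun, ContinuousMap.coe_smul, ContinuousMap.coe_add, ContinuousMap.coe_mk,
    Pi.smul_apply, Pi.add_apply, smul_eq_mul, pow_succ]
  push_cast
  have h : (2 : ℝ) ^ n * 2 * (t : ℝ) = 2 * (2 ^ n * t) := by ring
  rw [h]
  rcases le_total (2 ^ n * (t : ℝ) - k) 0 with h1 | h1
  · rw [max_eq_left ((min_le_right _ _).trans h1), max_eq_left ((min_le_right _ _).trans (by linarith)),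
      max_eq_left ((min_le_right _ _).trans (by linarith))]
    ring
  · rcases le_total (2 ^ n * (t : ℝ) - k) (1 / 2) with h2 | h2
    · rw [min_eq_right (by linarith), max_eq_right h1, min_eq_right (by linarith),
        max_eq_right (by linarith), min_eq_right (by linarith), max_eq_left (by linarith)]
      ring
    · rcases le_total (2 ^ n * (t : ℝ) - k) 1 with h3 | h3
      · rw [min_eq_right (by linarith), max_eq_right h1, min_eq_left (by linarith),
          max_eq_right (by linarith), min_eq_right (by linarith), max_eq_right (by linarith)]
        ring
      · rw [min_eq_left (by linarith), max_eq_right zero_le_one, min_eq_left (by linarith),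
          max_eq_right (by linarith), min_eq_left (by linarith), max_eq_right (by linarith)]
        norm_num

namespace IsSignField

variable {Ω : Type*} {mΩ : MeasurableSpace Ω} {P : Measure Ω} {H : ℝ} {ε : List Bool → Ω → ℝ}
  [IsProbabilityMeasure P]

theorem integrable_walkStep (h : IsSignField P H ε) (hH1 : H ≤ 1) (n k : ℕ) :
    Integrable (fun ω => walkStep (fun v => ε v ω) n k) P := by
  refine Integrable.of_bound (C := 1) (Measurable.aestronglyMeasurable ?_) ?_
  · exact measurable_signProd fun v _ _ => h.measurable v
  · filter_upwards [h.ae_abs_eq_one hH1] with ω hω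
    exact (abs_signProd hω _).le

theorem integrable_randCascade (h : IsSignField P H ε) (hH1 : H ≤ 1) (n : ℕ) :
    Integrable (randCascade H ε n) P := by
  have h1 : randCascade H ε n = fun ω => ∑ k ∈ Finset.range (2 ^ n),
      ((2 : ℝ) ^ (-((n : ℝ) * H)) * walkStep (fun v => ε v ω) n k) • ramp n k := by
    funext ω
    exact cascade_eq_sum _ _ _
  rw [h1]
  have h2 : ∀ k, Integrable (fun ω => ((2 : ℝ) ^ (-((n : ℝ) * H)) *
      walkStep (fun v => ε v ω) n k) • ramp n k) P := fun k =>
    ((h.integrable_walkStep hH1 n k).const_mul _).smul_const _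
  exact MeasureTheory.integrable_finsetSum (ε' := C(I, ℝ)) _ fun k _ => h2 k

theorem condExp_walkStep (h : IsSignField P H ε) (hH1 : H ≤ 1) (n k : ℕ) (b : Bool) :
    P[fun ω => walkStep (fun v => ε v ω) (n + 1) (2 * k + b.toNat) |
      signFiltration ε h.measurable n] =ᵐ[P]
    fun ω => walkStep (fun v => ε v ω) n k * (2 : ℝ) ^ (H - 1) := by
  obtain ⟨u, hu⟩ : ∃ u, u = binaryWord n k ++ [b] := ⟨_, rfl⟩
  have hle : sigmaOf ε {v | 1 ≤ v.length ∧ v.length ≤ n} ≤ mΩ := h.sigmaOf_le _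
  have h1 : (fun ω => walkStep (fun v => ε v ω) (n + 1) (2 * k + b.toNat)) =
      (fun ω => walkStep (fun v => ε v ω) n k) * ε u := by
    funext ω
    rw [Pi.mul_apply, walkStep, binaryWord_append, signProd_append, hu, walkStep]
  rw [signFiltration_eq, h1]
  have h2 : StronglyMeasurable[sigmaOf ε {v | 1 ≤ v.length ∧ v.length ≤ n}]
      (fun ω => walkStep (fun v => ε v ω) n k) := by
    refine Measurable.stronglyMeasurable (measurable_signProd fun v h1 h2 => ?_)
    rw [length_binaryWord] at h2
    exact measurable_sigmaOf ⟨h1, h2⟩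
  have hi : Indep (sigmaOf ε {u}) (sigmaOf ε {v | 1 ≤ v.length ∧ v.length ≤ n}) P := by
    refine h.indep_sigmaOf ?_
    rw [Set.disjoint_singleton_left]
    simp [hu, length_binaryWord]
  have hu' : StronglyMeasurable[sigmaOf ε {u}] (ε u) :=
    (measurable_sigmaOf (Set.mem_singleton _)).stronglyMeasurable
  have h3 := condExp_indep_eq (h.sigmaOf_le {u}) hle hu' hi
  have h4 : ∀ᵐ ω ∂P, ‖walkStep (fun v => ε v ω) n k‖ ≤ 1 := by
    filter_upwards [h.ae_abs_eq_one hH1] with ω hω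
    exact (abs_signProd hω _).le
  have h5 := condExp_stronglyMeasurable_mul_of_bound hle h2 (h.integral_sign hH1 u).1 1 h4
  filter_upwards [h3, h5] with ω hω h5
  rw [h5, Pi.mul_apply, hω, (h.integral_sign hH1 u).2]

theorem martingale (h : IsSignField P H ε) (hH1 : H ≤ 1) :
    Martingale (randCascade H ε) (signFiltration ε h.measurable) P := by
  refine martingale_nat (fun n => ?_) (h.integrable_randCascade hH1) fun n => ?_
  · exact stronglyMeasurable_randCascade_of H fun v h1 h2 =>
      measurable_sigmaOf (S := {v | 1 ≤ v.length ∧ v.length ≤ n}) ⟨h1, h2⟩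
  · set c : ℝ := (2 : ℝ) ^ (-(((n + 1 : ℕ) : ℝ) * H)) with hc
    set T : ℕ → ℝ →L[ℝ] C(I, ℝ) := fun j =>
      ContinuousLinearMap.toSpanSingleton ℝ (c • ramp (n + 1) j) with hT
    have h1 : randCascade H ε (n + 1) = ∑ j ∈ Finset.range (2 * 2 ^ n),
        (T j) ∘ (fun ω => walkStep (fun v => ε v ω) (n + 1) j) := by
      funext ω
      rw [randCascade, cascade_eq_sum, pow_succ', Finset.sum_apply]
      refine Finset.sum_congr rfl fun j _ => ?_
      simp only [hT, Function.comp_apply, ContinuousLinearMap.toSpanSingleton_apply, smul_smul]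
      rw [mul_comm]
    rw [h1]
    have h2 := condExp_finsetSum (μ := P) (s := Finset.range (2 * 2 ^ n))
      (f := fun j => (T j) ∘ (fun ω => walkStep (fun v => ε v ω) (n + 1) j))
      (fun j _ => (T j).integrable_comp (h.integrable_walkStep hH1 (n + 1) j))
      (signFiltration ε h.measurable n)
    refine EventuallyEq.symm (h2.trans ?_)
    have h3 : ∀ j, P[(T j) ∘ (fun ω => walkStep (fun v => ε v ω) (n + 1) j) |
        signFiltration ε h.measurable n] =ᵐ[P] fun ω =>
          T j (P[fun ω => walkStep (fun v => ε v ω) (n + 1) j | signFiltration ε h.measurable n] ω) :=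
      fun j => ((T j).comp_condExp_comm (h.integrable_walkStep hH1 (n + 1) j)).symm
    have h4 := fun b k => h.condExp_walkStep hH1 n k b
    filter_upwards [ae_all_iff.2 h3, ae_all_iff.2 (h4 false), ae_all_iff.2 (h4 true)]
      with ω h3 h4 h5
    simp only [Bool.toNat_false, add_zero, Bool.toNat_true] at h4 h5
    rw [Finset.sum_apply, Finset.sum_congr rfl fun j _ => h3 j, sum_range_two_mul, randCascade,
      cascade_eq_sum]
    refine Finset.sum_congr rfl fun k _ => ?_
    rw [h4, h5]
    simp only [hT, ContinuousLinearMap.toSpanSingleton_apply]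
    rw [ramp_eq_half_add n k, ← smul_add, ← smul_add, smul_smul, smul_smul]
    congr 1
    rw [hc, two_rpow_neg_succ_mul, Real.rpow_sub two_pos, Real.rpow_neg zero_le_two H,
      Real.rpow_one]
    have : (2 : ℝ) ^ H ≠ 0 := by positivity
    field_simp

end IsSignField

/-! ### Sub-Gaussian increments of the terminal value -/

/-- Absolute moments of a sub-Gaussian variable. -/
theorem lintegral_enorm_pow_le_of_hasSubgaussianMGF {Ω : Type*} {mΩ : MeasurableSpace Ω}
    {P : Measure Ω} [IsProbabilityMeasure P] {X : Ω → ℝ} {c : ℝ≥0} {s : ℝ} (hs : 0 < s)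
    (hc : (c : ℝ) = s ^ 2) (hX : HasSubgaussianMGF X c P) (q : ℕ) :
    ∫⁻ ω, ‖X ω‖ₑ ^ q ∂P ≤ ENNReal.ofReal (4 * q.factorial * s ^ q) := by
  have hbound : ∀ x : ℝ, |x| ^ q ≤ q.factorial * s ^ q *
      (Real.exp (s⁻¹ * x) + Real.exp (-s⁻¹ * x)) := by
    intro x
    have h1 := Real.pow_div_factorial_le_exp (|x| / s) (by positivity) q
    have h2 : Real.exp (|x| / s) ≤ Real.exp (s⁻¹ * x) + Real.exp (-s⁻¹ * x) := by
      rcases abs_cases x with ⟨h, _⟩ | ⟨h, _⟩ <;> rw [h]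
      · rw [div_eq_inv_mul]
        linarith [Real.exp_pos (-s⁻¹ * x)]
      · rw [div_eq_inv_mul, mul_neg, ← neg_mul]
        linarith [Real.exp_pos (s⁻¹ * x)]
    rw [div_pow, div_div, div_le_iff₀ (by positivity)] at h1
    calc |x| ^ q ≤ Real.exp (|x| / s) * (s ^ q * q.factorial) := h1
      _ ≤ (Real.exp (s⁻¹ * x) + Real.exp (-s⁻¹ * x)) * (s ^ q * q.factorial) := by gcongr
      _ = _ := by ring
  have hint : Integrable (fun ω => (q.factorial : ℝ) * s ^ q *
      (Real.exp (s⁻¹ * X ω) + Real.exp (-s⁻¹ * X ω))) P :=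
    ((hX.integrable_exp_mul _).add (hX.integrable_exp_mul _)).const_mul _
  calc ∫⁻ ω, ‖X ω‖ₑ ^ q ∂P ≤ ∫⁻ ω, ENNReal.ofReal (q.factorial * s ^ q *
      (Real.exp (s⁻¹ * X ω) + Real.exp (-s⁻¹ * X ω))) ∂P := by
        refine lintegral_mono fun ω => ?_
        rw [Real.enorm_eq_ofReal_abs, ← ENNReal.ofReal_pow (abs_nonneg _)]
        exact ENNReal.ofReal_le_ofReal (hbound _)
    _ = ENNReal.ofReal (q.factorial * s ^ q * (mgf X P s⁻¹ + mgf X P (-s⁻¹))) := by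
        rw [← ofReal_integral_eq_lintegral_ofReal hint (ae_of_all _ fun ω => by positivity),
          integral_const_mul, integral_add (hX.integrable_exp_mul _) (hX.integrable_exp_mul _)]
        rfl
    _ ≤ _ := by
        refine ENNReal.ofReal_le_ofReal ?_
        have h1 := hX.mgf_le s⁻¹
        have h2 := hX.mgf_le (-s⁻¹)
        have h3 : (c : ℝ) * s⁻¹ ^ 2 / 2 = 1 / 2 := by rw [hc]; field_simp
        rw [neg_sq] at h2
        rw [h3] at h1 h2
        have h4 : Real.exp (1 / 2) ≤ 2 := by
          have := Real.exp_one_lt_d9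
          have h5 : Real.exp (1 / 2) ^ 2 = Real.exp 1 := by rw [← Real.exp_nat_mul]; norm_num
          nlinarith [Real.exp_pos (1 / 2)]
        have h6 : (0 : ℝ) ≤ q.factorial * s ^ q := by positivity
        nlinarith

theorem hasSubgaussianMGF_const_mul_of_eq {Ω : Type*} {mΩ : MeasurableSpace Ω} {P : Measure Ω}
    {X : Ω → ℝ} {c d : ℝ≥0} (h : HasSubgaussianMGF X c P) (r : ℝ) (hd : (d : ℝ) = r ^ 2 * c) :
    HasSubgaussianMGF (fun ω => r * X ω) d P := by
  convert h.const_mul r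
  exact NNReal.eq hd

/-- The value at `1` of the `n`-th random function. -/
noncomputable def endValue {Ω : Type*} (H : ℝ) (ε : List Bool → Ω → ℝ) (n : ℕ) (ω : Ω) : ℝ :=
  randCascade H ε n ω 1

theorem endValue_zero {Ω : Type*} (H : ℝ) (ε : List Bool → Ω → ℝ) (ω : Ω) :
    endValue H ε 0 ω = 1 :=
  cascadeFun_zero_left H _ ⟨zero_le_one, le_rfl⟩

theorem endValue_succ {Ω : Type*} (H : ℝ) (ε : List Bool → Ω → ℝ) (n : ℕ) (ω : Ω) :
    endValue H ε (n + 1) ω = (2 : ℝ) ^ (-H) * (ε [false] ω * endValue H (below ε [false]) n ω +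
      ε [true] ω * endValue H (below ε [true]) n ω) :=
  cascadeFun_one_succ H _ n

namespace IsSignField

variable {Ω : Type*} {mΩ : MeasurableSpace Ω} {P : Measure Ω} {H : ℝ} {ε : List Bool → Ω → ℝ}

theorem measurable_endValue (h : IsSignField P H ε) (n : ℕ) : Measurable (endValue H ε n) :=
  h.measurable_eval n 1

theorem measurable_sign_mul_eval (b : Bool) (n : ℕ) (t : I) :
    Measurable[sigmaOf ε (branch b)] (fun ω => ε [b] ω * randCascade H (below ε [b]) n ω t) :=
  (measurable_sign_branch b).mul
    (stronglyMeasurable_eval (stronglyMeasurable_randCascade_branch H n b) t).measurable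

theorem indepFun_branch (h : IsSignField P H ε) {β γ : Type*} [MeasurableSpace β]
    [MeasurableSpace γ] {f : Ω → β} {g : Ω → γ} (hf : Measurable[sigmaOf ε (branch false)] f)
    (hg : Measurable[sigmaOf ε (branch true)] g) : IndepFun f g P := by
  rw [IndepFun_iff_Indep]
  exact indep_of_indep_of_le_left (indep_of_indep_of_le_right h.indep_branch hg.comap_le)
    hf.comap_le

theorem indepFun_sign_eval (h : IsSignField P H ε) (b : Bool) (n : ℕ) (t : I) :
    IndepFun (ε [b]) (fun ω => randCascade H (below ε [b]) n ω t) P :=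
  h.indepFun_sign [b]
    (stronglyMeasurable_eval (stronglyMeasurable_randCascade_compl H n b) t).measurable

variable [IsProbabilityMeasure P]

theorem integrable_endValue (h : IsSignField P H ε) (hH1 : H ≤ 1) (n : ℕ) :
    Integrable (endValue H ε n) P :=
  (ContinuousMap.evalCLM ℝ (1 : I)).integrable_comp (h.integrable_randCascade hH1 n)

theorem integral_sign_mul (h : IsSignField P H ε) (hH1 : H ≤ 1) (w : List Bool) {X : Ω → ℝ}
    (hX : Measurable X) (hind : IndepFun (ε w) X P) (hint : Integrable X P) :
    Integrable (fun ω => ε w ω * X ω) P ∧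
    ∫ ω, ε w ω * X ω ∂P = (2 : ℝ) ^ (H - 1) * ∫ ω, X ω ∂P := by
  have h1 := h.integral_comp_mul hH1 w hX hind (g := id) stronglyMeasurable_id hint hint.neg
  refine ⟨h1.1, h1.2.trans ?_⟩
  simp only [id, integral_neg, smul_eq_mul]
  ring

theorem integral_endValue (hH1 : H ≤ 1) (n : ℕ) :
    ∀ {ε : List Bool → Ω → ℝ}, IsSignField P H ε → ∫ ω, endValue H ε n ω ∂P = 1 := by
  induction n with
  | zero => intro ε _; simp [endValue_zero]
  | succ n ih =>
    intro ε h
    have h1 := fun b => h.integral_sign_mul hH1 [b] ((h.below [b]).measurable_endValue n)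
      (h.indepFun_sign_eval b n 1) ((h.below [b]).integrable_endValue hH1 n)
    simp_rw [endValue_succ]
    rw [integral_const_mul, integral_add (h1 false).1 (h1 true).1, (h1 false).2, (h1 true).2,
      ih (h.below _), ih (h.below _), ← two_mul, mul_one, mul_left_comm, ← Real.rpow_add two_pos]
    have h2 : -H + (H - 1) = -1 := by ring
    rw [h2, Real.rpow_neg_one]
    norm_num

/-- Multiplication by an independent sign preserves sub-Gaussianity. -/
theorem hasSubgaussianMGF_sign_mul (h : IsSignField P H ε) (hH1 : H ≤ 1) (w : List Bool)
    {X : Ω → ℝ} (hX : Measurable X) (hind : IndepFun (ε w) X P) {c : ℝ≥0}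
    (hs : HasSubgaussianMGF X c P) : HasSubgaussianMGF (fun ω => ε w ω * X ω) c P := by
  have key : ∀ t : ℝ, _ := fun t => h.integral_comp_mul hH1 w hX hind
    (g := fun x => Real.exp (t * x))
    (Continuous.stronglyMeasurable (by fun_prop)) (hs.integrable_exp_mul t)
    (by simpa using hs.integrable_exp_mul (-t))
  have hm : (2 : ℝ) ^ (H - 1) ≤ 1 := Real.rpow_le_one_of_one_le_of_nonpos one_le_two (by linarith)
  have hm0 : (0 : ℝ) < (2 : ℝ) ^ (H - 1) := by positivity
  refine ⟨fun t => (key t).1, fun t => ?_⟩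
  refine (key t).2.trans_le ?_
  have h1 := hs.mgf_le t
  have h2 := hs.mgf_le (-t)
  rw [neg_sq] at h2
  have h3 : ∫ ω, Real.exp (t * -X ω) ∂P = mgf X P (-t) := by
    simp [mgf]
  have h4 : ∫ ω, Real.exp (t * X ω) ∂P = mgf X P t := rfl
  rw [h3, h4, smul_eq_mul, smul_eq_mul]
  nlinarith

/-- The successive differences of the terminal values are sub-Gaussian, with a variance proxy that
decays geometrically because `2 ^ (1 - 2 H) < 1`. -/
theorem hasSubgaussianMGF_endValue_sub (hH : 1 / 2 < H) (hH1 : H ≤ 1) (n : ℕ) :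
    ∀ {ε : List Bool → Ω → ℝ}, IsSignField P H ε →
      HasSubgaussianMGF (fun ω => endValue H ε (n + 1) ω - endValue H ε n ω)
        (9 * (2 : ℝ≥0) ^ ((1 - 2 * H) * n)) P := by
  have h2H : (2 : ℝ) ^ (-H) ≤ 1 :=
    Real.rpow_le_one_of_one_le_of_nonpos one_le_two (by linarith)
  have h2H0 : (0 : ℝ) < (2 : ℝ) ^ (-H) := by positivity
  induction n with
  | zero =>
    intro ε h
    have h1 := hasSubgaussianMGF_of_mem_Icc_of_integral_eq_zero
      (X := fun ω => endValue H ε (0 + 1) ω - endValue H ε 0 ω) (a := -3) (b := 3) (μ := P)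
      ((h.measurable_endValue 1).sub (h.measurable_endValue 0)).aemeasurable ?_ ?_
    · convert h1 using 1
      ext
      simp only [Nat.cast_zero, mul_zero, NNReal.rpow_zero, mul_one]
      norm_num
    · filter_upwards [h.ae_abs_eq_one hH1] with ω hω
      rw [endValue_succ, endValue_zero, endValue_zero, endValue_zero]
      have h1 := abs_le.1 (hω [false]).le
      have h2 := abs_le.1 (hω [true]).le
      constructor <;> nlinarith
    · rw [integral_sub (h.integrable_endValue hH1 _) (h.integrable_endValue hH1 _),
        integral_endValue hH1 _ h, integral_endValue hH1 _ h, sub_self]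
  | succ n ih =>
    intro ε h
    set X : Bool → Ω → ℝ := fun b ω => endValue H (below ε [b]) (n + 1) ω -
      endValue H (below ε [b]) n ω with hX
    have hXm : ∀ b, Measurable (X b) := fun b =>
      ((h.below [b]).measurable_endValue _).sub ((h.below [b]).measurable_endValue _)
    have hXb : ∀ b, Measurable[sigmaOf ε (branch b)] (fun ω => ε [b] ω * X b ω) := by
      intro b
      have h1 := (measurable_sign_mul_eval (ε := ε) (H := H) b (n + 1) 1).sub
        (measurable_sign_mul_eval (ε := ε) (H := H) b n 1)
      convert h1 using 1
      funext ω
      simp only [hX, endValue, Pi.sub_apply]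
      ring
    have hXi : ∀ b, IndepFun (ε [b]) (X b) P := fun b => h.indepFun_sign [b]
      ((stronglyMeasurable_eval (stronglyMeasurable_randCascade_compl H (n + 1) b) 1).sub
        (stronglyMeasurable_eval (stronglyMeasurable_randCascade_compl H n b) 1)).measurable
    have hs := fun b => h.hasSubgaussianMGF_sign_mul hH1 [b] (hXm b) (hXi b) (ih (h.below [b]))
    have h4 : (2 : ℝ) ^ ((1 - 2 * H) * ((n : ℝ) + 1)) =
        (2 : ℝ) ^ (-H) * (2 : ℝ) ^ (-H) * (2 ^ (1 : ℝ) * 2 ^ ((1 - 2 * H) * n)) := by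
      rw [← Real.rpow_add two_pos, ← Real.rpow_add two_pos, ← Real.rpow_add two_pos]
      congr 1
      ring
    have h3 := hasSubgaussianMGF_const_mul_of_eq ((hs false).add_of_indepFun (hs true)
      (h.indepFun_branch (hXb false) (hXb true))) ((2 : ℝ) ^ (-H))
      (d := 9 * (2 : ℝ≥0) ^ ((1 - 2 * H) * (n + 1 : ℕ))) (by
        push_cast
        rw [h4, Real.rpow_one]
        ring)
    convert h3 using 1
    funext ω
    rw [endValue_succ H ε (n + 1), endValue_succ H ε n]
    simp only [hX]
    ring

end IsSignField

/-! ### Convergence of the cascade -/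

theorem eLpNorm_natCast_pow {Ω E : Type*} {mΩ : MeasurableSpace Ω} [NormedAddCommGroup E]
    {P : Measure Ω} (f : Ω → E) {q : ℕ} (hq : q ≠ 0) :
    eLpNorm f q P ^ q = ∫⁻ ω, ‖f ω‖ₑ ^ q ∂P := by
  have := eLpNorm_nnreal_pow_eq_lintegral (μ := P) (f := f) (p := (q : ℝ≥0)) (by exact_mod_cast hq)
  simpa using this

/-- The `L^q` norm of a maximum of two functions loses a factor `2 ^ (1 / q) ≤ 2 ^ (1 / 2)`. -/
theorem eLpNorm_max_le {Ω E : Type*} {mΩ : MeasurableSpace Ω} [NormedAddCommGroup E]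
    {P : Measure Ω} {f g : Ω → E} (hf : StronglyMeasurable f) {q : ℕ} (hq : 2 ≤ q) {A : ℝ≥0∞}
    (h1 : eLpNorm f q P ≤ A) (h2 : eLpNorm g q P ≤ A) :
    eLpNorm (fun ω => max ‖f ω‖ ‖g ω‖) q P ≤ ENNReal.ofReal (2 ^ (1 / 2 : ℝ)) * A := by
  have hq0 : q ≠ 0 := by omega
  rw [← ENNReal.pow_le_pow_left_iff hq0, eLpNorm_natCast_pow _ hq0, mul_pow]
  calc ∫⁻ ω, ‖max ‖f ω‖ ‖g ω‖‖ₑ ^ q ∂P ≤ ∫⁻ ω, (‖f ω‖ₑ ^ q + ‖g ω‖ₑ ^ q) ∂P := by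
        refine lintegral_mono fun ω => ?_
        rcases max_choice ‖f ω‖ ‖g ω‖ with h | h <;> rw [h, enorm_norm]
        · exact le_self_add
        · exact le_add_self
    _ = eLpNorm f q P ^ q + eLpNorm g q P ^ q := by
        rw [lintegral_add_left (hf.enorm.pow_const q), eLpNorm_natCast_pow _ hq0,
          eLpNorm_natCast_pow _ hq0]
    _ ≤ A ^ q + A ^ q := by gcongr
    _ = 2 * A ^ q := (two_mul _).symm
    _ ≤ _ := by
        gcongr
        rw [← ENNReal.ofReal_pow (by positivity), ← ENNReal.ofReal_ofNat]
        refine ENNReal.ofReal_le_ofReal ?_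
        calc (2 : ℝ) = (2 ^ (1 / 2 : ℝ)) ^ 2 := by
              rw [← Real.rpow_natCast, ← Real.rpow_mul two_pos.le]; norm_num
          _ ≤ _ := pow_le_pow_right₀ (Real.one_le_rpow one_le_two (by norm_num)) hq

/-- The difference of two successive functions of the cascade. -/
noncomputable def cascadeIncr {Ω : Type*} (H : ℝ) (ε : List Bool → Ω → ℝ) (n : ℕ) (ω : Ω) :
    C(I, ℝ) :=
  randCascade H ε (n + 1) ω - randCascade H ε n ω

theorem norm_cascadeIncr_zero_le {Ω : Type*} {H : ℝ} (hH : 0 < H) {ε : List Bool → Ω → ℝ} {ω : Ω}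
    (hω : ∀ w, |ε w ω| = 1) : ‖cascadeIncr H ε 0 ω‖ ≤ 3 := by
  have h2H : (2 : ℝ) ^ (-H) ≤ 1 := Real.rpow_le_one_of_one_le_of_nonpos one_le_two (by linarith)
  have h2H0 : (0 : ℝ) < (2 : ℝ) ^ (-H) := by positivity
  rw [ContinuousMap.norm_le _ (by norm_num)]
  rintro ⟨t, ht⟩
  have e1 : cascadeIncr H ε 0 ω ⟨t, ht⟩ =
      cascadeFun H (fun v => ε v ω) (0 + 1) t - cascadeFun H (fun v => ε v ω) 0 t := rfl
  have h1 := abs_le.1 (hω [false]).le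
  have h2 := abs_le.1 (hω [true]).le
  rw [e1, cascadeFun_zero_left H _ ht, Real.norm_eq_abs]
  have ht0 := ht.1
  have ht1 := ht.2
  rcases le_total t (1 / 2) with h | h
  · rw [cascadeFun_succ_left H _ 0 ht0 h, cascadeFun_zero_left H _ ⟨by linarith, by linarith⟩]
    have h3 : |(2 : ℝ) ^ (-H) * (ε [false] ω * (2 * t))| ≤ 1 := by
      rw [abs_mul, abs_mul, hω, abs_of_pos h2H0, abs_of_nonneg (by linarith)]
      nlinarith
    rw [abs_le] at h3 ⊢
    constructor <;> linarith
  · rw [cascadeFun_succ_right H _ 0 h ht1, cascadeFun_zero_left H _ ⟨zero_le_one, le_rfl⟩,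
      cascadeFun_zero_left H _ ⟨by linarith, by linarith⟩]
    have h3 : |(2 : ℝ) ^ (-H) * (ε [false] ω * 1 + ε [true] ω * (2 * t - 1))| ≤ 2 := by
      rw [abs_mul, abs_of_pos h2H0]
      have h4 : |ε [false] ω * 1 + ε [true] ω * (2 * t - 1)| ≤ 2 := by
        refine (abs_add_le _ _).trans ?_
        rw [abs_mul, abs_mul, hω, hω, abs_one, abs_of_nonneg (show 0 ≤ 2 * t - 1 by linarith)]
        linarith
      nlinarith [abs_nonneg (ε [false] ω * 1 + ε [true] ω * (2 * t - 1))]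
    rw [abs_le] at h3 ⊢
    constructor <;> linarith

/-- On the right half of the interval the values of the right branch are added to the terminal value
of the left branch; on the left half only the left branch contributes. -/
theorem norm_cascadeIncr_succ_le {Ω : Type*} (H : ℝ) {ε : List Bool → Ω → ℝ} {ω : Ω}
    (hω : ∀ w, |ε w ω| = 1) (n : ℕ) :
    ‖cascadeIncr H ε (n + 1) ω‖ ≤ (2 : ℝ) ^ (-H) *
      (max ‖cascadeIncr H (below ε [false]) n ω‖ ‖cascadeIncr H (below ε [true]) n ω‖ +
        ‖endValue H (below ε [false]) (n + 1) ω - endValue H (below ε [false]) n ω‖) := by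
  have h2H0 : (0 : ℝ) < (2 : ℝ) ^ (-H) := by positivity
  have hD : ∀ (b : Bool) (t : ℝ) (ht : t ∈ I),
      |cascadeFun H (shift (fun v => ε v ω) [b]) (n + 1) t -
        cascadeFun H (shift (fun v => ε v ω) [b]) n t| ≤ ‖cascadeIncr H (below ε [b]) n ω‖ :=
    fun b t ht => ContinuousMap.norm_coe_le_norm (cascadeIncr H (below ε [b]) n ω) ⟨t, ht⟩
  have hE : endValue H (below ε [false]) (n + 1) ω - endValue H (below ε [false]) n ω =
      cascadeFun H (shift (fun v => ε v ω) [false]) (n + 1) 1 -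
        cascadeFun H (shift (fun v => ε v ω) [false]) n 1 := rfl
  rw [ContinuousMap.norm_le _ (by positivity)]
  rintro ⟨t, ht⟩
  have e1 : cascadeIncr H ε (n + 1) ω ⟨t, ht⟩ =
    cascadeFun H (fun v => ε v ω) (n + 1 + 1) t - cascadeFun H (fun v => ε v ω) (n + 1) t := rfl
  have ht0 := ht.1
  have ht1 := ht.2
  rw [e1, hE, Real.norm_eq_abs, Real.norm_eq_abs]
  rcases le_total t (1 / 2) with h | h
  · rw [cascadeFun_succ_left H _ _ ht0 h, cascadeFun_succ_left H _ _ ht0 h, ← mul_sub, ← mul_sub,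
      abs_mul, abs_mul, hω, one_mul, abs_of_pos h2H0]
    gcongr
    exact (hD false (2 * t) ⟨by linarith, by linarith⟩).trans
      (le_add_of_le_of_nonneg (le_max_left _ _) (abs_nonneg _))
  · rw [cascadeFun_succ_right H _ _ h ht1, cascadeFun_succ_right H _ _ h ht1, ← mul_sub,
      add_sub_add_comm, ← mul_sub, ← mul_sub, abs_mul, abs_of_pos h2H0]
    gcongr
    refine (abs_add_le _ _).trans ?_
    rw [abs_mul, abs_mul, hω, hω, one_mul, one_mul, add_comm]
    gcongr
    exact (hD true (2 * t - 1) ⟨by linarith, by linarith⟩).trans (le_max_right _ _)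

/-- The geometric rate at which the cascade converges; for `H > 1 / 2` it lies strictly between
`2 ^ (1 / 2 - H)` and `1`. The gap absorbs the increments of the terminal values, which decay like
`2 ^ ((1 / 2 - H) n)`. -/
noncomputable def cascadeRate (H : ℝ) : ℝ := ((2 : ℝ) ^ (1 / 2 - H) + 1) / 2

theorem two_rpow_lt_one {H : ℝ} (hH : 1 / 2 < H) : (2 : ℝ) ^ (1 / 2 - H) < 1 :=
  Real.rpow_lt_one_of_one_lt_of_neg one_lt_two (by linarith)

theorem cascadeRate_pos (H : ℝ) : 0 < cascadeRate H := by unfold cascadeRate; positivity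

theorem cascadeRate_lt_one {H : ℝ} (hH : 1 / 2 < H) : cascadeRate H < 1 := by
  have := two_rpow_lt_one hH
  unfold cascadeRate
  linarith

/-- The constant of the geometric bound `cascadeConst H q * cascadeRate H ^ n` for the `L^q` norm of
the `n`-th increment of the cascade. -/
noncomputable def cascadeConst (H : ℝ) (q : ℕ) : ℝ :=
  3 + 12 * q.factorial / (cascadeRate H - (2 : ℝ) ^ (1 / 2 - H))

theorem cascadeConst_nonneg {H : ℝ} (hH : 1 / 2 < H) (q : ℕ) : 0 ≤ cascadeConst H q := by
  have := two_rpow_lt_one hH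
  have : 0 < cascadeRate H - (2 : ℝ) ^ (1 / 2 - H) := by unfold cascadeRate; linarith
  unfold cascadeConst
  positivity

/-- The sum of the tail of the geometric series that dominates the increments of the cascade. -/
noncomputable def cascadeTail (H : ℝ) (q n : ℕ) : ℝ≥0∞ :=
  ∑' k, ENNReal.ofReal (cascadeConst H q * cascadeRate H ^ (k + n))

theorem cascadeTail_zero_ne_top {H : ℝ} (hH : 1 / 2 < H) (q : ℕ) :
    ∑' k, ENNReal.ofReal (cascadeConst H q * cascadeRate H ^ k) ≠ ⊤ :=
  ((summable_geometric_of_lt_one (cascadeRate_pos H).le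
    (cascadeRate_lt_one hH)).mul_left _).tsum_ofReal_ne_top

theorem tendsto_cascadeTail {H : ℝ} (hH : 1 / 2 < H) (q : ℕ) :
    Tendsto (cascadeTail H q) atTop (𝓝 0) :=
  ENNReal.tendsto_sum_nat_add _ (cascadeTail_zero_ne_top hH q)

theorem cascadeTail_ne_top {H : ℝ} (hH : 1 / 2 < H) (q : ℕ) :
    cascadeTail H q 0 ≠ ⊤ := cascadeTail_zero_ne_top hH q

namespace IsSignField

variable {Ω : Type*} {mΩ : MeasurableSpace Ω} {P : Measure Ω} {H : ℝ} {ε : List Bool → Ω → ℝ}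

theorem stronglyMeasurable_cascadeIncr (h : IsSignField P H ε) (n : ℕ) :
    StronglyMeasurable (cascadeIncr H ε n) :=
  (h.stronglyMeasurable_randCascade (n + 1)).sub (h.stronglyMeasurable_randCascade n)

variable [IsProbabilityMeasure P]

theorem eLpNorm_endValue_sub_le (h : IsSignField P H ε) (hH : 1 / 2 < H) (hH1 : H ≤ 1) {q : ℕ}
    (hq : q ≠ 0) (n : ℕ) :
    eLpNorm (fun ω => endValue H ε (n + 1) ω - endValue H ε n ω) q P ≤
      ENNReal.ofReal (12 * q.factorial * ((2 : ℝ) ^ (1 / 2 - H)) ^ n) := by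
  have h1 := lintegral_enorm_pow_le_of_hasSubgaussianMGF
    (s := 3 * ((2 : ℝ) ^ (1 / 2 - H)) ^ n) (by positivity) ?_
    (hasSubgaussianMGF_endValue_sub hH hH1 n h) q
  · rw [← ENNReal.pow_le_pow_left_iff hq, eLpNorm_natCast_pow _ hq]
    refine h1.trans ?_
    rw [← ENNReal.ofReal_pow (by positivity)]
    refine ENNReal.ofReal_le_ofReal ?_
    have h2 : (1 : ℝ) ≤ 4 * q.factorial := by
      have : (1 : ℝ) ≤ q.factorial := by exact_mod_cast q.factorial_pos
      linarith
    calc 4 * (q.factorial : ℝ) * (3 * ((2 : ℝ) ^ (1 / 2 - H)) ^ n) ^ q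
        ≤ (4 * q.factorial) ^ q * (3 * ((2 : ℝ) ^ (1 / 2 - H)) ^ n) ^ q := by
          gcongr
          exact le_self_pow₀ h2 hq
      _ = _ := by rw [← mul_pow]; congr 1; ring
  · push_cast
    rw [mul_pow, ← Real.rpow_natCast _ n, ← Real.rpow_mul two_pos.le, ← Real.rpow_natCast _ 2,
      ← Real.rpow_natCast _ 2, ← Real.rpow_mul two_pos.le]
    norm_num
    congr 1
    ring

/-- The increments of the cascade decay geometrically in every `L^q`. The sup norm of an increment
is controlled by those of the two branches and by the increment of a terminal value. -/
theorem eLpNorm_cascadeIncr_le (hH : 1 / 2 < H) (hH1 : H ≤ 1) {q : ℕ} (hq : 2 ≤ q) (n : ℕ) :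
    ∀ {ε : List Bool → Ω → ℝ}, IsSignField P H ε →
      eLpNorm (cascadeIncr H ε n) q P ≤ ENNReal.ofReal (cascadeConst H q * cascadeRate H ^ n) := by
  have hr := two_rpow_lt_one hH
  have hr0 : (0 : ℝ) < (2 : ℝ) ^ (1 / 2 - H) := by positivity
  have hgap : 0 < cascadeRate H - (2 : ℝ) ^ (1 / 2 - H) := by unfold cascadeRate; linarith
  have hK0 := cascadeConst_nonneg hH q
  have hK3 : 3 ≤ cascadeConst H q := by
    unfold cascadeConst
    exact le_add_of_nonneg_right (by positivity)
  have hKC : 12 * q.factorial ≤ cascadeConst H q * (cascadeRate H - (2 : ℝ) ^ (1 / 2 - H)) := by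
    have h1 : 12 * (q.factorial : ℝ) / (cascadeRate H - (2 : ℝ) ^ (1 / 2 - H)) ≤ cascadeConst H q :=
      le_add_of_nonneg_left (by norm_num)
    rwa [div_le_iff₀ hgap] at h1
  induction n with
  | zero =>
    intro ε h
    refine (eLpNorm_le_of_ae_bound (C := 3) ?_).trans ?_
    · filter_upwards [h.ae_abs_eq_one hH1] with ω hω
      exact norm_cascadeIncr_zero_le (by linarith) hω
    · rw [measure_univ, ENNReal.one_rpow, one_mul, pow_zero, mul_one]
      exact ENNReal.ofReal_le_ofReal hK3
  | succ n ih =>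
    intro ε h
    set M : Ω → ℝ := fun ω =>
      max ‖cascadeIncr H (below ε [false]) n ω‖ ‖cascadeIncr H (below ε [true]) n ω‖ with hM
    set D : Ω → ℝ := fun ω =>
      ‖endValue H (below ε [false]) (n + 1) ω - endValue H (below ε [false]) n ω‖ with hD
    have hMm : AEStronglyMeasurable M P :=
      (((h.below [false]).stronglyMeasurable_cascadeIncr n).norm.sup
        ((h.below [true]).stronglyMeasurable_cascadeIncr n).norm).aestronglyMeasurable
    have hDm : AEStronglyMeasurable D P :=
      (((h.below [false]).measurable_endValue (n + 1)).sub
        ((h.below [false]).measurable_endValue n)).norm.aestronglyMeasurable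
    have hM1 : eLpNorm M q P ≤ ENNReal.ofReal (2 ^ (1 / 2 : ℝ)) *
        ENNReal.ofReal (cascadeConst H q * cascadeRate H ^ n) :=
      eLpNorm_max_le ((h.below [false]).stronglyMeasurable_cascadeIncr n) hq
        (ih (h.below [false])) (ih (h.below [true]))
    have hD1 : eLpNorm D q P ≤ ENNReal.ofReal (12 * q.factorial * ((2 : ℝ) ^ (1 / 2 - H)) ^ n) := by
      rw [hD, eLpNorm_norm]
      exact (h.below [false]).eLpNorm_endValue_sub_le hH hH1 (by omega) n
    have hq1 : (1 : ℝ≥0∞) ≤ q := by exact_mod_cast (by omega : 1 ≤ q)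
    calc eLpNorm (cascadeIncr H ε (n + 1)) q P
        ≤ eLpNorm ((2 : ℝ) ^ (-H) • (M + D)) q P := by
          refine eLpNorm_mono_ae_real ?_
          filter_upwards [h.ae_abs_eq_one hH1] with ω hω
          exact norm_cascadeIncr_succ_le H hω n
      _ = ‖(2 : ℝ) ^ (-H)‖ₑ * eLpNorm (M + D) q P := eLpNorm_const_smul _ _ _ _
      _ ≤ ENNReal.ofReal ((2 : ℝ) ^ (-H)) * (ENNReal.ofReal (2 ^ (1 / 2 : ℝ)) *
        ENNReal.ofReal (cascadeConst H q * cascadeRate H ^ n) +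
          ENNReal.ofReal (12 * q.factorial * ((2 : ℝ) ^ (1 / 2 - H)) ^ n)) := by
          rw [Real.enorm_eq_ofReal (by positivity)]
          gcongr
          exact (eLpNorm_add_le hMm hDm hq1).trans (add_le_add hM1 hD1)
      _ = ENNReal.ofReal ((2 : ℝ) ^ (-H) * (2 ^ (1 / 2 : ℝ) * (cascadeConst H q * cascadeRate H ^ n)
          + 12 * q.factorial * ((2 : ℝ) ^ (1 / 2 - H)) ^ n)) := by
          have := cascadeRate_pos H
          rw [← ENNReal.ofReal_mul (by positivity), ← ENNReal.ofReal_add (by positivity)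
            (by positivity), ← ENNReal.ofReal_mul (by positivity)]
      _ ≤ _ := by
          refine ENNReal.ofReal_le_ofReal ?_
          have h1 : (2 : ℝ) ^ (-H) * 2 ^ (1 / 2 : ℝ) = 2 ^ (1 / 2 - H) := by
            rw [← Real.rpow_add two_pos]; congr 1; ring
          have h2 : (2 : ℝ) ^ (-H) ≤ 1 :=
            Real.rpow_le_one_of_one_le_of_nonpos one_le_two (by linarith)
          have h3 : ((2 : ℝ) ^ (1 / 2 - H)) ^ n ≤ cascadeRate H ^ n :=
            pow_le_pow_left₀ hr0.le (by linarith) n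
          have h4 : (0 : ℝ) < cascadeRate H ^ n := pow_pos (cascadeRate_pos H) n
          have h5 : (2 : ℝ) ^ (-H) * (12 * q.factorial * ((2 : ℝ) ^ (1 / 2 - H)) ^ n) ≤
              12 * q.factorial * cascadeRate H ^ n := by
            calc (2 : ℝ) ^ (-H) * (12 * q.factorial * ((2 : ℝ) ^ (1 / 2 - H)) ^ n)
                ≤ 1 * (12 * q.factorial * ((2 : ℝ) ^ (1 / 2 - H)) ^ n) := by gcongr
              _ ≤ _ := by rw [one_mul]; gcongr
          rw [mul_add, ← mul_assoc, h1, pow_succ]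
          nlinarith

theorem eLpNorm_randCascade_sub_le (h : IsSignField P H ε) (hH : 1 / 2 < H) (hH1 : H ≤ 1) {q : ℕ}
    (hq : 2 ≤ q) (n m : ℕ) :
    eLpNorm (fun ω => randCascade H ε (n + m) ω - randCascade H ε n ω) q P ≤ cascadeTail H q n := by
  have h1 : (fun ω => randCascade H ε (n + m) ω - randCascade H ε n ω) =
      ∑ k ∈ Finset.range m, cascadeIncr H ε (k + n) := by
    funext ω
    rw [Finset.sum_apply, Finset.sum_congr rfl fun k _ => show cascadeIncr H ε (k + n) ω =
      randCascade H ε (n + (k + 1)) ω - randCascade H ε (n + k) ω by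
        rw [cascadeIncr, add_comm k n, add_assoc],
      Finset.sum_range_sub (fun k => randCascade H ε (n + k) ω), add_zero]
  have hq1 : (1 : ℝ≥0∞) ≤ q := by exact_mod_cast (by omega : 1 ≤ q)
  rw [h1]
  refine (eLpNorm_sum_le (fun k _ =>
    (h.stronglyMeasurable_cascadeIncr (k + n)).aestronglyMeasurable) hq1).trans ?_
  exact (Finset.sum_le_sum fun k _ => eLpNorm_cascadeIncr_le hH hH1 hq (k + n) h).trans
    (ENNReal.sum_le_tsum _)

theorem ae_exists_tendsto (h : IsSignField P H ε) (hH : 1 / 2 < H) (hH1 : H ≤ 1) :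
    ∀ᵐ ω ∂P, ∃ f, Tendsto (fun n => randCascade H ε n ω) atTop (𝓝 f) := by
  have hm : ∀ n, AEMeasurable (fun ω => ‖cascadeIncr H ε n ω‖ₑ) P := fun n =>
    (h.stronglyMeasurable_cascadeIncr n).enorm.aemeasurable
  have h1 : ∫⁻ ω, ∑' n, ‖cascadeIncr H ε n ω‖ₑ ∂P ≠ ⊤ := by
    rw [lintegral_tsum hm]
    refine ne_top_of_le_ne_top (cascadeTail_zero_ne_top hH 2) (ENNReal.tsum_le_tsum fun n => ?_)
    rw [← eLpNorm_one_eq_lintegral_enorm]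
    exact (eLpNorm_le_eLpNorm_of_exponent_le (by norm_num)
      (h.stronglyMeasurable_cascadeIncr n).aestronglyMeasurable).trans
      (eLpNorm_cascadeIncr_le hH hH1 le_rfl n h)
  filter_upwards [ae_lt_top' (AEMeasurable.tsum hm) h1] with ω hω
  refine cauchySeq_tendsto_of_complete (cauchySeq_of_edist_le_of_tsum_ne_top _ (fun n => ?_) hω.ne)
  rw [edist_comm, edist_eq_enorm_sub]
  rfl

theorem eLpNorm_randCascade_sub_limit_le (h : IsSignField P H ε) (hH : 1 / 2 < H) (hH1 : H ≤ 1)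
    {B : Ω → C(I, ℝ)} (hB : ∀ᵐ ω ∂P, Tendsto (fun n => randCascade H ε n ω) atTop (𝓝 (B ω)))
    {q : ℕ} (hq : 2 ≤ q) (n : ℕ) :
    eLpNorm (fun ω => randCascade H ε n ω - B ω) q P ≤ cascadeTail H q n := by
  have h1 : eLpNorm (fun ω => randCascade H ε n ω - B ω) q P =
      eLpNorm (fun ω => B ω - randCascade H ε n ω) q P :=
    eLpNorm_sub_comm (randCascade H ε n) B q P
  rw [h1]
  refine (Lp.eLpNorm_lim_le_liminf_eLpNorm
    (f := fun m ω => randCascade H ε (n + m) ω - randCascade H ε n ω) (fun m =>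
    ((h.stronglyMeasurable_randCascade _).sub
      (h.stronglyMeasurable_randCascade _)).aestronglyMeasurable) _ ?_).trans ?_
  · filter_upwards [hB] with ω hω
    refine Tendsto.sub_const ?_ _
    simpa only [add_comm n] using (tendsto_add_atTop_iff_nat n).2 hω
  · exact liminf_le_of_le (by isBoundedDefault) fun b hb => by
      obtain ⟨m, hm⟩ := hb.exists
      exact hm.trans (h.eLpNorm_randCascade_sub_le hH hH1 hq n m)

theorem eLpNorm_randCascade_le (h : IsSignField P H ε) (hH : 1 / 2 < H) (hH1 : H ≤ 1)
    {q : ℕ} (hq : 2 ≤ q) (n : ℕ) :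
    eLpNorm (randCascade H ε n) q P ≤ 1 + cascadeTail H q 0 := by
  have h1 : randCascade H ε n = (fun ω => randCascade H ε (0 + n) ω - randCascade H ε 0 ω) +
      randCascade H ε 0 := by
    funext ω
    simp
  have hq1 : (1 : ℝ≥0∞) ≤ q := by exact_mod_cast (by omega : 1 ≤ q)
  rw [h1, add_comm]
  refine (eLpNorm_add_le (h.stronglyMeasurable_randCascade _).aestronglyMeasurable
    ((h.stronglyMeasurable_randCascade _).sub
      (h.stronglyMeasurable_randCascade _)).aestronglyMeasurable hq1).trans
    (add_le_add ?_ (h.eLpNorm_randCascade_sub_le hH hH1 hq 0 n))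
  refine (eLpNorm_le_of_ae_bound (C := 1) (ae_of_all _ fun ω => ?_)).trans (by simp)
  rw [ContinuousMap.norm_le _ zero_le_one]
  intro t
  have h2 : randCascade H ε 0 ω t = t := cascadeFun_zero_left H _ t.2
  rw [h2, Real.norm_eq_abs, abs_of_nonneg t.2.1]
  exact t.2.2

theorem eLpNorm_limit_le (h : IsSignField P H ε) (hH : 1 / 2 < H) (hH1 : H ≤ 1)
    {B : Ω → C(I, ℝ)} (hB : ∀ᵐ ω ∂P, Tendsto (fun n => randCascade H ε n ω) atTop (𝓝 (B ω)))
    {q : ℕ} (hq : 2 ≤ q) : eLpNorm B q P ≤ 1 + cascadeTail H q 0 := by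
  refine (Lp.eLpNorm_lim_le_liminf_eLpNorm (fun m =>
    (h.stronglyMeasurable_randCascade m).aestronglyMeasurable) _ hB).trans ?_
  exact liminf_le_of_le (by isBoundedDefault) fun b hb => by
    obtain ⟨m, hm⟩ := hb.exists
    exact hm.trans (h.eLpNorm_randCascade_le hH hH1 hq m)

theorem memLp_and_tendsto_eLpNorm (h : IsSignField P H ε) (hH : 1 / 2 < H) (hH1 : H ≤ 1)
    {B : Ω → C(I, ℝ)} (hBm : StronglyMeasurable B)
    (hB : ∀ᵐ ω ∂P, Tendsto (fun n => randCascade H ε n ω) atTop (𝓝 (B ω)))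
    {q : ℝ≥0∞} (hq : q ≠ ⊤) :
    MemLp B q P ∧
      Tendsto (fun n => eLpNorm (fun ω => randCascade H ε n ω - B ω) q P) atTop (𝓝 0) := by
  obtain ⟨N, hN⟩ := ENNReal.exists_nat_gt hq
  have hqN : q ≤ ((N + 2 : ℕ) : ℝ≥0∞) := by
    push_cast
    exact hN.le.trans le_self_add
  constructor
  · refine MemLp.mono_exponent (q := ((N + 2 : ℕ) : ℝ≥0∞)) ⟨hBm.aestronglyMeasurable, ?_⟩ hqN
    exact (h.eLpNorm_limit_le hH hH1 hB (by omega)).trans_lt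
      (ENNReal.add_lt_top.2 ⟨ENNReal.one_lt_top, (cascadeTail_ne_top hH _).lt_top⟩)
  · refine tendsto_of_tendsto_of_tendsto_of_le_of_le tendsto_const_nhds
      (tendsto_cascadeTail hH (N + 2)) (fun n => zero_le) fun n => ?_
    refine (eLpNorm_le_eLpNorm_of_exponent_le hqN
      ((h.stronglyMeasurable_randCascade n).sub hBm).aestronglyMeasurable).trans ?_
    exact h.eLpNorm_randCascade_sub_limit_le hH hH1 hB (by omega) n

theorem integral_randCascade (h : IsSignField P H ε) (hH1 : H ≤ 1) (n : ℕ) :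
    ∫ ω, randCascade H ε n ω ∂P = idFun := by
  have h1 := (h.martingale hH1).setIntegral_eq (Nat.zero_le n) (s := Set.univ) MeasurableSet.univ
  rw [setIntegral_univ, setIntegral_univ] at h1
  rw [← h1]
  have h2 : ∀ ω, randCascade H ε 0 ω = idFun := fun ω => by
    ext t
    exact cascadeFun_zero_left H _ t.2
  simp [h2]

theorem integral_limit (h : IsSignField P H ε) (hH : 1 / 2 < H) (hH1 : H ≤ 1)
    {B : Ω → C(I, ℝ)} (hBm : StronglyMeasurable B)
    (hB : ∀ᵐ ω ∂P, Tendsto (fun n => randCascade H ε n ω) atTop (𝓝 (B ω))) :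
    Integrable B P ∧ ∫ ω, B ω ∂P = idFun := by
  obtain ⟨h1, h2⟩ := h.memLp_and_tendsto_eLpNorm hH hH1 hBm hB (q := 1) ENNReal.one_ne_top
  have h3 : Integrable B P := memLp_one_iff_integrable.1 h1
  refine ⟨h3, ?_⟩
  have h4 := tendsto_integral_of_L1 B hBm.aestronglyMeasurable
    (Eventually.of_forall fun n => h.integrable_randCascade hH1 n) (l := atTop)
    (by simpa only [eLpNorm_one_eq_lintegral_enorm] using h2)
  simp_rw [h.integral_randCascade hH1] at h4
  exact tendsto_nhds_unique h4 tendsto_const_nhds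

end IsSignField

/-! ### Characteristic functions and small ball estimates -/

/-- A bound on the probabilities of the approximating events passes to an event that is eventually
contained in them. -/
theorem measure_le_of_ae_eventually {Ω : Type*} {mΩ : MeasurableSpace Ω} {P : Measure Ω} {S : Set Ω}
    {A : ℕ → Set Ω} {c : ℝ≥0∞} (h : ∀ᵐ ω ∂P, ω ∈ S → ∀ᶠ n in atTop, ω ∈ A n)
    (hc : ∀ᶠ n in atTop, P (A n) ≤ c) : P S ≤ c := by
  have h1 : P S ≤ P (⋃ N, ⋂ n ≥ N, A n) := by
    refine measure_mono_ae ?_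
    filter_upwards [h] with ω hω hS
    obtain ⟨N, hN⟩ := eventually_atTop.1 (hω hS)
    exact Set.mem_iUnion.2 ⟨N, Set.mem_iInter₂.2 hN⟩
  have hmono : Monotone fun N => ⋂ n ≥ N, A n := by
    intro N M hNM
    exact Set.biInter_subset_biInter_left fun n hn => le_trans hNM hn
  refine h1.trans ?_
  rw [hmono.measure_iUnion]
  refine iSup_le fun N => ?_
  obtain ⟨M, hM⟩ := eventually_atTop.1 hc
  exact (measure_mono (Set.biInter_subset_of_mem (le_max_left N M))).trans (hM _ (le_max_right N M))

/-- The Fourier transform of the law of the difference of two independent uniform variables is a sum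
of two squares, hence nonnegative; it serves as a smooth substitute for the indicator of a ball. -/
theorem integral_cos_sub_mul (y : ℝ) :
    ∫ z, Real.cos ((z.1 - z.2) * y)
      ∂((volume.restrict (Set.Icc (0 : ℝ) 1)).prod (volume.restrict (Set.Icc (0 : ℝ) 1))) =
      (∫ u in Set.Icc (0 : ℝ) 1, Real.cos (u * y)) * (∫ u in Set.Icc (0 : ℝ) 1, Real.cos (u * y)) +
      (∫ u in Set.Icc (0 : ℝ) 1, Real.sin (u * y)) *
        (∫ u in Set.Icc (0 : ℝ) 1, Real.sin (u * y)) := by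
  have hc : IntegrableOn (fun u : ℝ => Real.cos (u * y)) (Set.Icc 0 1) :=
    Continuous.integrableOn_Icc (by fun_prop)
  have hs : IntegrableOn (fun u : ℝ => Real.sin (u * y)) (Set.Icc 0 1) :=
    Continuous.integrableOn_Icc (by fun_prop)
  rw [← integral_prod_mul, ← integral_prod_mul, ← integral_add (hc.mul_prod hc) (hs.mul_prod hs)]
  refine integral_congr_ae (ae_of_all _ fun z => ?_)
  simp only
  rw [sub_mul, Real.cos_sub]

theorem one_fourth_le_integral_cos {y : ℝ} (hy : |y| ≤ 1) :
    1 / 4 ≤ ∫ z, Real.cos ((z.1 - z.2) * y)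
      ∂((volume.restrict (Set.Icc (0 : ℝ) 1)).prod (volume.restrict (Set.Icc (0 : ℝ) 1))) := by
  have hc : IntegrableOn (fun u : ℝ => Real.cos (u * y)) (Set.Icc 0 1) :=
    Continuous.integrableOn_Icc (by fun_prop)
  have h2 : 1 / 2 ≤ ∫ u in Set.Icc (0 : ℝ) 1, Real.cos (u * y) := by
    have h3 : ∫ _ in Set.Icc (0 : ℝ) 1, (1 / 2 : ℝ) = 1 / 2 := by simp
    rw [← h3]
    refine setIntegral_mono_on (by simp) hc measurableSet_Icc fun u hu => ?_
    have h4 := Real.one_sub_sq_div_two_le_cos (x := u * y)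
    have h5 : (u * y) ^ 2 ≤ 1 := by
      rw [sq_le_one_iff_abs_le_one, abs_mul, abs_of_nonneg hu.1]
      exact mul_le_one₀ hu.2 (abs_nonneg _) hy
    linarith
  rw [integral_cos_sub_mul]
  nlinarith [mul_self_nonneg (∫ u in Set.Icc (0 : ℝ) 1, Real.sin (u * y))]

theorem integral_cos_le_norm_charFun {Ω : Type*} {mΩ : MeasurableSpace Ω} {P : Measure Ω}
    [IsProbabilityMeasure P] {X : Ω → ℝ} (hX : Measurable X) (x : ℝ) :
    ∫ ω, Real.cos (x * X ω) ∂P ≤ ‖charFun (P.map X) x‖ := by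
  have hint : Integrable (fun ω => Complex.exp (x * X ω * Complex.I)) P := by
    refine Integrable.of_bound (C := 1) (by fun_prop) (ae_of_all _ fun ω => ?_)
    rw [← Complex.ofReal_mul, Complex.norm_exp_ofReal_mul_I]
  have h1 : (charFun (P.map X) x).re = ∫ ω, Real.cos (x * X ω) ∂P := by
    rw [charFun_apply_real, integral_map hX.aemeasurable (by fun_prop)]
    rw [← RCLike.re_eq_complex_re, ← integral_re hint]
    refine integral_congr_ae (ae_of_all _ fun ω => ?_)
    simp only [RCLike.re_eq_complex_re]
    rw [← Complex.ofReal_mul, Complex.exp_ofReal_mul_I_re]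
  rw [← h1]
  exact Complex.re_le_norm _

/-- A decaying characteristic function forces small balls to have small mass. -/
theorem prob_abs_le_of_charFun_le {Ω : Type*} {mΩ : MeasurableSpace Ω} {P : Measure Ω}
    [IsProbabilityMeasure P] {X : Ω → ℝ} (hX : Measurable X) {r κ C : ℝ} (hr : 0 < r) (hκ : 0 < κ)
    (hC : ∀ x, |x| ≤ r⁻¹ → ‖charFun (P.map X) x‖ ≤ C / (1 + (κ * x) ^ 2)) :
    P {ω | |X ω| ≤ r} ≤ ENNReal.ofReal (4 * Real.pi * C / κ * r) := by
  set ν : Measure ℝ := volume.restrict (Set.Icc (0 : ℝ) 1) with hν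
  have hprob : IsProbabilityMeasure ν := ⟨by simp [hν]⟩
  have hC0 : 0 ≤ C := by
    have h1 := hC 0 (by rw [abs_zero]; positivity)
    have h2 := norm_nonneg (charFun (P.map X) 0)
    simp only [mul_zero, ne_eq, OfNat.ofNat_ne_zero, not_false_eq_true, zero_pow, add_zero,
      div_one] at h1
    linarith
  have hmeas : MeasurableSet {ω | |X ω| ≤ r} := measurableSet_le hX.abs measurable_const
  have hF : Integrable (Function.uncurry fun (ω : Ω) (z : ℝ × ℝ) =>
      Real.cos ((z.1 - z.2) * (X ω / r))) (P.prod (ν.prod ν)) := by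
    refine Integrable.of_bound (C := 1) (Measurable.aestronglyMeasurable ?_)
      (ae_of_all _ fun z => Real.abs_cos_le_one _)
    unfold Function.uncurry
    fun_prop
  have hG : Integrable (fun x : ℝ => C * (1 + (κ / r * x) ^ 2)⁻¹) :=
    (integrable_inv_one_add_sq.comp_mul_left' (by positivity)).const_mul C
  have hGint : ∫ x : ℝ, C * (1 + (κ / r * x) ^ 2)⁻¹ = Real.pi * C / κ * r := by
    rw [integral_const_mul, Measure.integral_comp_mul_left (fun x => (1 + x ^ 2)⁻¹),
      integral_univ_inv_one_add_sq, abs_of_pos (by positivity), smul_eq_mul]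
    field_simp
  have hz : ∀ z : ℝ × ℝ, z.1 ∈ Set.Icc (0 : ℝ) 1 → z.2 ∈ Set.Icc (0 : ℝ) 1 →
      ∫ ω, Real.cos ((z.1 - z.2) * (X ω / r)) ∂P ≤ C * (1 + (κ / r * (z.1 - z.2)) ^ 2)⁻¹ := by
    intro z h1 h2
    have h3 : |(z.1 - z.2) / r| ≤ r⁻¹ := by
      rw [abs_div, abs_of_pos hr, div_eq_mul_inv]
      refine mul_le_of_le_one_left (by positivity) ?_
      rw [abs_le]
      constructor <;> linarith [h1.1, h1.2, h2.1, h2.2]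
    have h4 := (integral_cos_le_norm_charFun (P := P) hX ((z.1 - z.2) / r)).trans (hC _ h3)
    calc ∫ ω, Real.cos ((z.1 - z.2) * (X ω / r)) ∂P
        = ∫ ω, Real.cos ((z.1 - z.2) / r * X ω) ∂P := by
          refine integral_congr_ae (ae_of_all _ fun ω => ?_)
          simp only
          congr 1
          ring
      _ ≤ _ := h4
      _ = _ := by rw [div_eq_mul_inv]; congr 4; ring
  have hGprod : Integrable (fun z : ℝ × ℝ => C * (1 + (κ / r * (z.1 - z.2)) ^ 2)⁻¹) (ν.prod ν) := by
    refine Integrable.of_bound (C := C) (Measurable.aestronglyMeasurable (by fun_prop))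
      (ae_of_all _ fun z => ?_)
    rw [Real.norm_eq_abs, abs_mul, abs_of_nonneg hC0, abs_of_nonneg (by positivity)]
    exact mul_le_of_le_one_right hC0 (inv_le_one_of_one_le₀ (le_add_of_nonneg_right (sq_nonneg _)))
  have hinner : ∀ v : ℝ, ∫ u, C * (1 + (κ / r * (u - v)) ^ 2)⁻¹ ∂ν ≤ Real.pi * C / κ * r := by
    intro v
    have h1 := hG.comp_sub_right v
    calc ∫ u, C * (1 + (κ / r * (u - v)) ^ 2)⁻¹ ∂ν
        ≤ ∫ u, C * (1 + (κ / r * (u - v)) ^ 2)⁻¹ :=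
          setIntegral_le_integral h1 (ae_of_all _ fun u => by positivity)
      _ = ∫ u, C * (1 + (κ / r * u) ^ 2)⁻¹ :=
          integral_sub_right_eq_self (fun u => C * (1 + (κ / r * u) ^ 2)⁻¹) v
      _ = _ := hGint
  have hreal : P.real {ω | |X ω| ≤ r} ≤ 4 * Real.pi * C / κ * r := by
    have h1 : (1 / 4 : ℝ) * P.real {ω | |X ω| ≤ r} ≤
        ∫ ω, ∫ z, Real.cos ((z.1 - z.2) * (X ω / r)) ∂(ν.prod ν) ∂P := by
      have h2 : ∫ ω, {ω | |X ω| ≤ r}.indicator (fun _ => (1 / 4 : ℝ)) ω ∂P =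
          (1 / 4 : ℝ) * P.real {ω | |X ω| ≤ r} := by
        rw [integral_indicator_const _ hmeas, smul_eq_mul, mul_comm]
      rw [← h2]
      refine integral_mono ((integrable_const _).indicator hmeas) hF.integral_prod_left fun ω => ?_
      by_cases hω : |X ω| ≤ r
      · rw [Set.indicator_of_mem (by exact hω)]
        refine one_fourth_le_integral_cos ?_
        rw [abs_div, abs_of_pos hr]
        exact div_le_one_of_le₀ hω hr.le
      · rw [Set.indicator_of_notMem (by exact hω)]
        rw [integral_cos_sub_mul]
        exact add_nonneg (mul_self_nonneg _) (mul_self_nonneg _)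
    rw [integral_integral_swap hF] at h1
    have h2 : ∫ z, ∫ ω, Real.cos ((z.1 - z.2) * (X ω / r)) ∂P ∂(ν.prod ν) ≤
        ∫ z, C * (1 + (κ / r * (z.1 - z.2)) ^ 2)⁻¹ ∂(ν.prod ν) := by
      refine integral_mono_ae hF.integral_prod_right hGprod ?_
      have h3 : ∀ᵐ z ∂(ν.prod ν), z ∈ Set.Icc (0 : ℝ) 1 ×ˢ Set.Icc (0 : ℝ) 1 := by
        rw [hν, Measure.prod_restrict]
        exact ae_restrict_mem (measurableSet_Icc.prod measurableSet_Icc)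
      filter_upwards [h3] with z h3
      exact hz z h3.1 h3.2
    have h4 : ∫ z, C * (1 + (κ / r * (z.1 - z.2)) ^ 2)⁻¹ ∂(ν.prod ν) ≤ Real.pi * C / κ * r := by
      rw [integral_prod_symm _ hGprod]
      calc ∫ v, ∫ u, C * (1 + (κ / r * (u - v)) ^ 2)⁻¹ ∂ν ∂ν
          ≤ ∫ _, Real.pi * C / κ * r ∂ν :=
            integral_mono hGprod.integral_prod_right (integrable_const _) hinner
        _ = _ := by simp
    have h5 : 4 * Real.pi * C / κ * r = 4 * (Real.pi * C / κ * r) := by ring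
    linarith
  rw [← ENNReal.ofReal_toReal (measure_ne_top P _)]
  exact ENNReal.ofReal_le_ofReal hreal

/-- A uniform bound for the second moments of the cascade. -/
noncomputable def cascadeMoment (H : ℝ) : ℝ := ((1 + cascadeTail H 2 0) ^ 2).toReal

theorem one_le_cascadeMoment {H : ℝ} (hH : 1 / 2 < H) : 1 ≤ cascadeMoment H := by
  have hfin : (1 + cascadeTail H 2 0) ^ 2 ≠ ⊤ :=
    ENNReal.pow_ne_top (ENNReal.add_ne_top.2 ⟨ENNReal.one_ne_top, cascadeTail_ne_top hH 2⟩)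
  exact ENNReal.toReal_mono hfin (one_le_pow₀ le_self_add)

theorem sub_sq_le_sin (y : ℝ) : y - y ^ 2 ≤ Real.sin y := by
  rcases le_or_gt y 0 with h | h
  · have := Real.le_sin h
    nlinarith [sq_nonneg y]
  · have h1 := Real.sin_gt_sub_cube h
    have h2 := Real.neg_one_le_sin y
    rcases le_or_gt y 6 with h3 | h3
    · nlinarith [sq_nonneg y, mul_nonneg (sq_nonneg y) (sub_nonneg.2 h3)]
    · nlinarith

namespace IsSignField

variable {Ω : Type*} {mΩ : MeasurableSpace Ω} {P : Measure Ω} {H : ℝ} {ε : List Bool → Ω → ℝ}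
  [IsProbabilityMeasure P]

theorem integral_endValue_sq_le (h : IsSignField P H ε) (hH : 1 / 2 < H) (hH1 : H ≤ 1) (n : ℕ) :
    Integrable (fun ω => endValue H ε n ω ^ 2) P ∧
      ∫ ω, endValue H ε n ω ^ 2 ∂P ≤ cascadeMoment H := by
  have h1 : ∫⁻ ω, ENNReal.ofReal (endValue H ε n ω ^ 2) ∂P ≤ (1 + cascadeTail H 2 0) ^ 2 := by
    calc ∫⁻ ω, ENNReal.ofReal (endValue H ε n ω ^ 2) ∂P
        ≤ ∫⁻ ω, ‖randCascade H ε n ω‖ₑ ^ 2 ∂P := by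
          refine lintegral_mono fun ω => ?_
          rw [← ofReal_norm, ← ENNReal.ofReal_pow (norm_nonneg _), ← sq_abs (endValue H ε n ω)]
          refine ENNReal.ofReal_le_ofReal ?_
          gcongr
          exact ContinuousMap.norm_coe_le_norm (randCascade H ε n ω) 1
      _ = eLpNorm (randCascade H ε n) (2 : ℕ) P ^ 2 := (eLpNorm_natCast_pow _ two_ne_zero).symm
      _ ≤ _ := by
          gcongr
          exact h.eLpNorm_randCascade_le hH hH1 le_rfl n
  have hfin : (1 + cascadeTail H 2 0) ^ 2 ≠ ⊤ :=
    ENNReal.pow_ne_top (ENNReal.add_ne_top.2 ⟨ENNReal.one_ne_top, cascadeTail_ne_top hH 2⟩)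
  have hm : Measurable fun ω => endValue H ε n ω ^ 2 := (h.measurable_endValue n).pow_const 2
  have hint : Integrable (fun ω => endValue H ε n ω ^ 2) P := by
    refine ⟨hm.aestronglyMeasurable, ?_⟩
    rw [hasFiniteIntegral_iff_ofReal (ae_of_all _ fun ω => sq_nonneg _)]
    exact h1.trans_lt hfin.lt_top
  refine ⟨hint, ?_⟩
  rw [integral_eq_lintegral_of_nonneg_ae (ae_of_all _ fun ω => sq_nonneg _) hm.aestronglyMeasurable]
  exact ENNReal.toReal_mono hfin h1

/-- The effect of an independent sign on a characteristic function. -/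
theorem charFun_sign_mul (h : IsSignField P H ε) (hH1 : H ≤ 1) (w : List Bool) {X : Ω → ℝ}
    (hX : Measurable X) (hind : IndepFun (ε w) X P) (x : ℝ) :
    charFun (P.map fun ω => ε w ω * X ω) x =
      ⟨(charFun (P.map X) x).re, (2 : ℝ) ^ (H - 1) * (charFun (P.map X) x).im⟩ := by
  have hm : Measurable fun ω => ε w ω * X ω := (h.measurable w).mul hX
  have hint : ∀ y : ℝ, Integrable (fun ω => Complex.exp (x * (y * X ω : ℝ) * Complex.I)) P := by
    intro y
    refine Integrable.of_bound (C := 1) (by fun_prop) (ae_of_all _ fun ω => ?_)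
    rw [← Complex.ofReal_mul, Complex.norm_exp_ofReal_mul_I]
  have h1 := (h.integral_comp_mul hH1 w hX hind (g := fun y : ℝ => Complex.exp (x * y * Complex.I))
    (Continuous.stronglyMeasurable (by fun_prop)) (by simpa using hint 1) (by simpa using hint (-1))).2
  have h2 : ∫ ω, Complex.exp (x * (-X ω : ℝ) * Complex.I) ∂P =
      (starRingEnd ℂ) (charFun (P.map X) x) := by
    rw [← charFun_neg, charFun_apply_real, integral_map hX.aemeasurable (by fun_prop)]
    simp
  have h3 : ∫ ω, Complex.exp (x * (X ω : ℝ) * Complex.I) ∂P = charFun (P.map X) x := by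
    rw [charFun_apply_real, integral_map hX.aemeasurable (by fun_prop)]
  have h4 : charFun (P.map fun ω => ε w ω * X ω) x =
      ∫ ω, Complex.exp (x * (ε w ω * X ω : ℝ) * Complex.I) ∂P := by
    rw [charFun_apply_real, integral_map hm.aemeasurable (by fun_prop)]
  rw [h4, h1, h2, h3]
  apply Complex.ext
  · simp
    ring
  · simp
    ring

/-- An independent sign reduces the modulus of a characteristic function by the part of its imaginary
part that it removes. -/
theorem sq_norm_charFun_sign_mul (h : IsSignField P H ε) (hH1 : H ≤ 1) (w : List Bool) {X : Ω → ℝ}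
    (hX : Measurable X) (hind : IndepFun (ε w) X P) (x : ℝ) :
    ‖charFun (P.map fun ω => ε w ω * X ω) x‖ ^ 2 = ‖charFun (P.map X) x‖ ^ 2 -
      (1 - ((2 : ℝ) ^ (H - 1)) ^ 2) * (charFun (P.map X) x).im ^ 2 := by
  rw [h.charFun_sign_mul hH1 w hX hind, Complex.sq_norm, Complex.sq_norm, Complex.normSq_mk,
    Complex.normSq_apply]
  ring

theorem norm_charFun_sign_mul_le (h : IsSignField P H ε) (hH1 : H ≤ 1) (w : List Bool) {X : Ω → ℝ}
    (hX : Measurable X) (hind : IndepFun (ε w) X P) (x : ℝ) :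
    ‖charFun (P.map fun ω => ε w ω * X ω) x‖ ≤ ‖charFun (P.map X) x‖ := by
  have hm : (2 : ℝ) ^ (H - 1) ≤ 1 := Real.rpow_le_one_of_one_le_of_nonpos one_le_two (by linarith)
  have hm0 : (0 : ℝ) < (2 : ℝ) ^ (H - 1) := by positivity
  refine le_of_sq_le_sq ?_ (norm_nonneg _)
  rw [h.sq_norm_charFun_sign_mul hH1 w hX hind]
  have : 0 ≤ 1 - ((2 : ℝ) ^ (H - 1)) ^ 2 := by nlinarith
  nlinarith [mul_nonneg this (sq_nonneg (charFun (P.map X) x).im)]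

/-- A characteristic function factors along the two branches at the root. -/
theorem charFun_branches (h : IsSignField P H ε) {Y : Bool → Ω → ℝ}
    (hY : ∀ b, Measurable[sigmaOf ε (branch b)] (fun ω => ε [b] ω * Y b ω)) (x : ℝ) :
    charFun (P.map fun ω => (2 : ℝ) ^ (-H) * (ε [false] ω * Y false ω + ε [true] ω * Y true ω)) x =
      charFun (P.map fun ω => ε [false] ω * Y false ω) (2 ^ (-H) * x) *
        charFun (P.map fun ω => ε [true] ω * Y true ω) (2 ^ (-H) * x) := by
  have hm : ∀ b, Measurable (fun ω => ε [b] ω * Y b ω) := fun b =>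
    (hY b).mono (h.sigmaOf_le _) le_rfl
  rw [charFun_map_mul_comp (f := fun ω => ε [false] ω * Y false ω + ε [true] ω * Y true ω)
      ((hm false).add (hm true)).aemeasurable,
    (h.indepFun_branch (hY false) (hY true)).charFun_map_fun_add_eq_mul (hm false).aemeasurable
      (hm true).aemeasurable, Pi.mul_apply]

theorem charFun_endValue_succ (h : IsSignField P H ε) (n : ℕ) (x : ℝ) :
    charFun (P.map (endValue H ε (n + 1))) x =
      charFun (P.map fun ω => ε [false] ω * endValue H (below ε [false]) n ω) (2 ^ (-H) * x) *
        charFun (P.map fun ω => ε [true] ω * endValue H (below ε [true]) n ω) (2 ^ (-H) * x) := by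
  rw [← h.charFun_branches (Y := fun b => endValue H (below ε [b]) n)
    (fun b => measurable_sign_mul_eval b n 1)]
  congr 2
  funext ω
  exact endValue_succ H ε n ω

theorem norm_charFun_endValue_sign_le (h : IsSignField P H ε) (hH1 : H ≤ 1) (n : ℕ) (b : Bool)
    (x : ℝ) : ‖charFun (P.map fun ω => ε [b] ω * endValue H (below ε [b]) n ω) x‖ ≤
      ‖charFun (P.map (endValue H (below ε [b]) n)) x‖ :=
  h.norm_charFun_sign_mul_le hH1 [b] ((h.below [b]).measurable_endValue n)
    (h.indepFun_sign_eval b n 1) x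

/-- The terminal value has mean one, so its characteristic function leaves the real axis at the
origin with unit speed. -/
theorem half_abs_le_abs_im_charFun (h : IsSignField P H ε) (hH : 1 / 2 < H) (hH1 : H ≤ 1) (n : ℕ)
    {x : ℝ} (hx : |x| ≤ 1 / (2 * cascadeMoment H)) :
    |x| / 2 ≤ |(charFun (P.map (endValue H ε n)) x).im| := by
  have hm := h.measurable_endValue n
  obtain ⟨hi2, hK⟩ := h.integral_endValue_sq_le hH hH1 n
  have hK1 := one_le_cascadeMoment hH
  have him : ∀ y : ℝ, (charFun (P.map (endValue H ε n)) y).im =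
      ∫ ω, Real.sin (y * endValue H ε n ω) ∂P := by
    intro y
    have hint : Integrable (fun ω => Complex.exp (y * endValue H ε n ω * Complex.I)) P := by
      refine Integrable.of_bound (C := 1) (by fun_prop) (ae_of_all _ fun ω => ?_)
      rw [← Complex.ofReal_mul, Complex.norm_exp_ofReal_mul_I]
    rw [charFun_apply_real, integral_map hm.aemeasurable (by fun_prop), ← RCLike.im_eq_complex_im,
      ← integral_im hint]
    refine integral_congr_ae (ae_of_all _ fun ω => ?_)
    simp only [RCLike.im_eq_complex_im]
    rw [← Complex.ofReal_mul, Complex.exp_ofReal_mul_I_im]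
  have hpos : ∀ y : ℝ, 0 ≤ y → y ≤ 1 / (2 * cascadeMoment H) →
      y / 2 ≤ (charFun (P.map (endValue H ε n)) y).im := by
    intro y hy0 hy
    have hi1 := h.integrable_endValue hH1 n
    have h1 : ∫ ω, (y * endValue H ε n ω - y ^ 2 * endValue H ε n ω ^ 2) ∂P ≤
        ∫ ω, Real.sin (y * endValue H ε n ω) ∂P := by
      refine integral_mono ((hi1.const_mul y).sub (hi2.const_mul _)) ?_ fun ω => ?_
      · exact Integrable.of_bound (C := 1) (by fun_prop)
          (ae_of_all _ fun ω => Real.abs_sin_le_one _)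
      · have := sub_sq_le_sin (y * endValue H ε n ω)
        rwa [mul_pow] at this
    rw [integral_sub (hi1.const_mul y) (hi2.const_mul _), integral_const_mul, integral_const_mul,
      integral_endValue hH1 n h, mul_one] at h1
    rw [him]
    rw [le_div_iff₀ (by linarith)] at hy
    nlinarith [mul_le_mul_of_nonneg_left hK (sq_nonneg y)]
  rcases le_total 0 x with h0 | h0
  · rw [abs_of_nonneg h0] at hx ⊢
    exact (hpos x h0 hx).trans (le_abs_self _)
  · rw [abs_of_nonpos h0] at hx ⊢
    have h1 := hpos (-x) (by linarith) hx
    rw [charFun_neg, Complex.conj_im] at h1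
    exact h1.trans (neg_le_abs _)

/-- The bound for `j = 0` comes from the action of the signs on the imaginary part; each further
generation multiplies the argument by `2 ^ H` and squares the bound. -/
theorem norm_charFun_endValue_le (hH : 1 / 2 < H) (hH1 : H ≤ 1) (n : ℕ) {x : ℝ}
    (hx : |x| ≤ 1 / (2 * cascadeMoment H)) (j : ℕ) :
    ∀ {ε : List Bool → Ω → ℝ}, IsSignField P H ε →
      ‖charFun (P.map (endValue H ε (n + 1 + j))) ((2 ^ H) ^ j * x)‖ ≤
        (1 - (1 - ((2 : ℝ) ^ (H - 1)) ^ 2) * ((2 : ℝ) ^ (-H)) ^ 2 / 4 * x ^ 2) ^ (2 ^ j) := by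
  have hm : (2 : ℝ) ^ (H - 1) ≤ 1 := Real.rpow_le_one_of_one_le_of_nonpos one_le_two (by linarith)
  have hm0 : (0 : ℝ) < (2 : ℝ) ^ (H - 1) := by positivity
  have hm2 : 0 ≤ 1 - ((2 : ℝ) ^ (H - 1)) ^ 2 := by nlinarith
  have h2H : (2 : ℝ) ^ (-H) ≤ 1 := Real.rpow_le_one_of_one_le_of_nonpos one_le_two (by linarith)
  have h2H0 : (0 : ℝ) < (2 : ℝ) ^ (-H) := by positivity
  induction j with
  | zero =>
    intro ε h
    rw [pow_zero, one_mul, pow_zero, pow_one, add_zero, h.charFun_endValue_succ, norm_mul]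
    set z : Bool → ℝ := fun b =>
      ‖charFun (P.map fun ω => ε [b] ω * endValue H (below ε [b]) n ω) (2 ^ (-H) * x)‖ with hz
    have key : ∀ b, z b ^ 2 ≤
        1 - (1 - ((2 : ℝ) ^ (H - 1)) ^ 2) * ((2 : ℝ) ^ (-H)) ^ 2 / 4 * x ^ 2 := by
      intro b
      have hb := h.below [b]
      simp only [hz]
      rw [h.sq_norm_charFun_sign_mul hH1 [b] (hb.measurable_endValue n) (h.indepFun_sign_eval b n 1)]
      have : IsProbabilityMeasure (P.map (endValue H (below ε [b]) n)) :=
        Measure.isProbabilityMeasure_map (hb.measurable_endValue n).aemeasurable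
      have h1 := norm_charFun_le_one (μ := P.map (endValue H (below ε [b]) n)) (2 ^ (-H) * x)
      have h2 := hb.half_abs_le_abs_im_charFun hH hH1 n (x := 2 ^ (-H) * x) (by
        rw [abs_mul, abs_of_pos h2H0]
        exact (mul_le_of_le_one_left (abs_nonneg x) h2H).trans hx)
      have h3 : (2 ^ (-H) * x) ^ 2 / 4 ≤
          (charFun (P.map (endValue H (below ε [b]) n)) (2 ^ (-H) * x)).im ^ 2 := by
        rw [← sq_abs (charFun _ _).im, ← sq_abs (2 ^ (-H) * x)]
        calc |2 ^ (-H) * x| ^ 2 / 4 = (|2 ^ (-H) * x| / 2) ^ 2 := by ring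
          _ ≤ _ := by gcongr
      have h4 := mul_le_mul_of_nonneg_left h3 hm2
      have h5 : ‖charFun (P.map (endValue H (below ε [b]) n)) (2 ^ (-H) * x)‖ ^ 2 ≤ 1 :=
        pow_le_one₀ (norm_nonneg _) h1
      linarith [mul_pow ((2 : ℝ) ^ (-H)) x 2, mul_assoc (1 - ((2 : ℝ) ^ (H - 1)) ^ 2)
        (((2 : ℝ) ^ (-H)) ^ 2 / 4) (x ^ 2)]
    have h1 := key false
    have h2 := key true
    change z false * z true ≤ _
    nlinarith [sq_nonneg (z false - z true)]
  | succ j ih =>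
    intro ε h
    rw [← add_assoc, h.charFun_endValue_succ, norm_mul, pow_succ 2 j, pow_mul, sq]
    have h1 : (2 : ℝ) ^ (-H) * ((2 ^ H) ^ (j + 1) * x) = (2 ^ H) ^ j * x := by
      rw [Real.rpow_neg two_pos.le, pow_succ]
      have : (2 : ℝ) ^ H ≠ 0 := by positivity
      field_simp
    rw [h1]
    refine mul_le_mul ((h.norm_charFun_endValue_sign_le hH1 _ _ _).trans (ih (h.below _)))
      ((h.norm_charFun_endValue_sign_le hH1 _ _ _).trans (ih (h.below _))) (norm_nonneg _) ?_
    exact (norm_nonneg _).trans ((h.norm_charFun_endValue_sign_le hH1 _ false _).trans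
      (ih (h.below _)))

end IsSignField

theorem exists_sq_mul_pow_le {θ : ℝ} (h0 : 0 ≤ θ) (h1 : θ < 1) :
    ∃ M : ℝ, 0 ≤ M ∧ ∀ N : ℕ, (N : ℝ) ^ 2 * θ ^ N ≤ M := by
  have h := tendsto_pow_const_mul_const_pow_of_abs_lt_one 2 (r := θ) (by rwa [abs_of_nonneg h0])
  obtain ⟨M, hM⟩ := h.bddAbove_range
  have hM' : ∀ N : ℕ, (N : ℝ) ^ 2 * θ ^ N ≤ M := fun N => hM ⟨N, rfl⟩
  exact ⟨M, by simpa using hM' 0, hM'⟩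

/-- The image of a point of `[0, 1]` under `t ↦ 2 t`, stopped at `1`. -/
def leftHalf (t : I) : I := ⟨min (2 * t) 1, le_min (by linarith [t.2.1]) zero_le_one, min_le_right _ _⟩

/-- The image of a point of `[0, 1]` under `t ↦ 2 t - 1`, started at `0`. -/
def rightHalf (t : I) : I :=
  ⟨max (2 * t - 1) 0, le_max_right _ _, max_le (by linarith [t.2.2]) zero_le_one⟩

theorem randCascade_succ_apply {Ω : Type*} (H : ℝ) (ε : List Bool → Ω → ℝ) (n : ℕ) (ω : Ω) (t : I) :
    randCascade H ε (n + 1) ω t = (2 : ℝ) ^ (-H) *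
      (ε [false] ω * randCascade H (below ε [false]) n ω (leftHalf t) +
        ε [true] ω * randCascade H (below ε [true]) n ω (rightHalf t)) := by
  change cascadeFun H (fun v => ε v ω) (n + 1) t = (2 : ℝ) ^ (-H) *
      (ε [false] ω * cascadeFun H (shift (fun v => ε v ω) [false]) n (min (2 * t) 1) +
        ε [true] ω * cascadeFun H (shift (fun v => ε v ω) [true]) n (max (2 * t - 1) 0))
  rcases le_total (t : ℝ) (1 / 2) with h | h
  · rw [cascadeFun_succ_left H _ n t.2.1 h, min_eq_left (by linarith), max_eq_right (by linarith),
      cascadeFun_zero_right, mul_zero, add_zero]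
  · rw [cascadeFun_succ_right H _ n h t.2.2, min_eq_right (by linarith), max_eq_left (by linarith)]

namespace IsSignField

variable {Ω : Type*} {mΩ : MeasurableSpace Ω} {P : Measure Ω} {H : ℝ} [IsProbabilityMeasure P]

/-- For `H < 1` the characteristic functions of the terminal values decay quadratically, on a range
that grows with the generation: each branching squares the bound available at a smaller argument. -/
theorem exists_charFun_endValue_decay (P : Measure Ω) [IsProbabilityMeasure P] (hH : 1 / 2 < H)
    (hH1 : H < 1) :
    ∃ a C : ℝ, 0 < a ∧ 0 ≤ C ∧ ∀ n j : ℕ, j < n → ∀ ε : List Bool → Ω → ℝ, IsSignField P H ε →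
      ∀ x : ℝ, |x| ≤ a * (2 ^ H) ^ j → ‖charFun (P.map (endValue H ε n)) x‖ ≤ C / (1 + x ^ 2) := by
  set K := cascadeMoment H with hK
  have hK1 : 1 ≤ K := one_le_cascadeMoment hH
  have hm : (2 : ℝ) ^ (H - 1) < 1 := Real.rpow_lt_one_of_one_lt_of_neg one_lt_two (by linarith)
  have hm0 : (0 : ℝ) < (2 : ℝ) ^ (H - 1) := by positivity
  have hm2 : 0 < 1 - ((2 : ℝ) ^ (H - 1)) ^ 2 := by nlinarith
  have h2H : (2 : ℝ) ^ (-H) ≤ 1 := Real.rpow_le_one_of_one_le_of_nonpos one_le_two (by linarith)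
  have h2H0 : (0 : ℝ) < (2 : ℝ) ^ (-H) := by positivity
  have h2Hp : (1 : ℝ) ≤ 2 ^ H := Real.one_le_rpow one_le_two (by linarith)
  have h2H2 : (2 : ℝ) ^ H ≤ 2 := by
    calc (2 : ℝ) ^ H ≤ 2 ^ (1 : ℝ) := Real.rpow_le_rpow_of_exponent_le one_le_two hH1.le
      _ = 2 := Real.rpow_one 2
  set c := (1 - ((2 : ℝ) ^ (H - 1)) ^ 2) * ((2 : ℝ) ^ (-H)) ^ 2 / 4 with hc
  have hc0 : 0 < c := by positivity
  have hc1 : c ≤ 1 := by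
    have h1 : ((2 : ℝ) ^ (-H)) ^ 2 ≤ 1 := pow_le_one₀ h2H0.le h2H
    have h2 : (1 - ((2 : ℝ) ^ (H - 1)) ^ 2) ≤ 1 := by nlinarith
    have h3 := mul_le_one₀ h2 (sq_nonneg _) h1
    linarith
  set a := 1 / (2 * K) with ha
  have ha0 : 0 < a := by positivity
  have ha1 : a ≤ 1 := by rw [ha, div_le_one (by positivity)]; linarith
  have hsq : ∀ y : ℝ, |y| ≤ a → c * y ^ 2 ≤ 1 := by
    intro y hy
    have h1 : y ^ 2 ≤ 1 := by rw [sq_le_one_iff_abs_le_one]; linarith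
    exact mul_le_one₀ hc1 (sq_nonneg _) h1
  set θ := 1 - c * (a * 2 ^ (-H)) ^ 2 with hθ
  have hθ1 : θ < 1 := by
    have : 0 < c * (a * 2 ^ (-H)) ^ 2 := by positivity
    linarith
  have hθ0 : 0 ≤ θ := by
    have := hsq (a * 2 ^ (-H)) (by
      rw [abs_of_pos (by positivity)]
      exact mul_le_of_le_one_right ha0.le h2H)
    linarith
  obtain ⟨M, hM0, hM⟩ := exists_sq_mul_pow_le hθ0 hθ1
  refine ⟨a, (1 + a ^ 2) * (1 + M), ha0, by positivity, fun n j hjn ε h x hx => ?_⟩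
  classical
  have hex : ∃ i, |x| ≤ a * (2 ^ H) ^ i := ⟨j, hx⟩
  -- the number of branchings needed to bring the argument into the range where the bound starts
  set i := Nat.find hex with hi
  have hxi : |x| ≤ a * (2 ^ H) ^ i := Nat.find_spec hex
  have hij : i ≤ j := Nat.find_min' hex hx
  rw [le_div_iff₀ (by positivity)]
  rcases Nat.eq_zero_or_pos i with h0 | h0
  · have : IsProbabilityMeasure (P.map (endValue H ε n)) :=
      Measure.isProbabilityMeasure_map (h.measurable_endValue n).aemeasurable
    have h1 := norm_charFun_le_one (μ := P.map (endValue H ε n)) x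
    rw [h0, pow_zero, mul_one] at hxi
    have h2 : x ^ 2 ≤ a ^ 2 := by rw [← sq_abs x]; gcongr
    calc ‖charFun (P.map (endValue H ε n)) x‖ * (1 + x ^ 2) ≤ 1 * (1 + a ^ 2) := by gcongr
      _ ≤ _ := by nlinarith [sq_nonneg a]
  · have hlow : a * (2 ^ H) ^ (i - 1) < |x| := not_le.1 (Nat.find_min hex (by omega))
    have hpow : (0 : ℝ) < (2 ^ H) ^ i := by positivity
    set y := x / (2 ^ H) ^ i with hy
    have hxy : x = (2 ^ H) ^ i * y := by rw [hy]; field_simp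
    have hya : |y| ≤ a := by
      rw [hy, abs_div, abs_of_pos hpow, div_le_iff₀ hpow]
      exact hxi
    have hyl : a * 2 ^ (-H) ≤ |y| := by
      rw [hy, abs_div, abs_of_pos hpow, le_div_iff₀ hpow]
      refine le_trans (le_of_eq ?_) hlow.le
      obtain ⟨l, hl⟩ : ∃ l, i = l + 1 := ⟨i - 1, by omega⟩
      rw [hl, Nat.add_sub_cancel, pow_succ, Real.rpow_neg two_pos.le]
      field_simp
    have h1 := norm_charFun_endValue_le hH hH1.le (n - 1 - i) hya i h
    have hn : n - 1 - i + 1 + i = n := by omega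
    rw [hn, ← hxy, ← hc] at h1
    have h2 : 1 - c * y ^ 2 ≤ θ := by
      have : (a * 2 ^ (-H)) ^ 2 ≤ y ^ 2 := by rw [← sq_abs y]; gcongr
      have := mul_le_mul_of_nonneg_left this hc0.le
      linarith
    have h3 : ‖charFun (P.map (endValue H ε n)) x‖ ≤ θ ^ (2 ^ i) :=
      h1.trans (pow_le_pow_left₀ (by linarith [hsq y hya]) h2 _)
    have h4 : 1 + x ^ 2 ≤ (1 + a ^ 2) * ((2 ^ i : ℕ) : ℝ) ^ 2 := by
      have h5 : x ^ 2 ≤ a ^ 2 * ((2 ^ i : ℕ) : ℝ) ^ 2 := by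
        rw [← sq_abs x, ← mul_pow]
        push_cast
        refine pow_le_pow_left₀ (abs_nonneg _) (hxi.trans ?_) 2
        gcongr
      have h6 : (1 : ℝ) ≤ ((2 ^ i : ℕ) : ℝ) ^ 2 := by
        push_cast
        exact one_le_pow₀ (one_le_pow₀ one_le_two)
      linarith
    have h7 := hM (2 ^ i)
    calc ‖charFun (P.map (endValue H ε n)) x‖ * (1 + x ^ 2)
        ≤ θ ^ (2 ^ i) * ((1 + a ^ 2) * ((2 ^ i : ℕ) : ℝ) ^ 2) := by gcongr
      _ = (1 + a ^ 2) * (((2 ^ i : ℕ) : ℝ) ^ 2 * θ ^ (2 ^ i)) := by ring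
      _ ≤ (1 + a ^ 2) * M := by gcongr
      _ ≤ _ := by gcongr; linarith

/-- The characteristic function of an increment over an interval that contains the dyadic interval
of `w` is dominated by that of a terminal value of the cascade below `w`. -/
theorem norm_charFun_increment_le (hH1 : H ≤ 1) (n : ℕ) (β : ℝ) (w : List Bool) :
    ∀ x : ℝ, (∀ ε : List Bool → Ω → ℝ, IsSignField P H ε →
      ‖charFun (P.map (endValue H ε n)) (((2 : ℝ) ^ (-H)) ^ w.length * x)‖ ≤ β) →
    ∀ {ε : List Bool → Ω → ℝ}, IsSignField P H ε → ∀ {s t : I}, (s : ℝ) ≤ leftEnd w →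
      leftEnd w + (2 : ℝ)⁻¹ ^ w.length ≤ t →
      ‖charFun (P.map fun ω => randCascade H ε (n + w.length) ω t -
        randCascade H ε (n + w.length) ω s) x‖ ≤ β := by
  induction w with
  | nil =>
    intro x hβ ε h s t hs ht
    have hl : leftEnd [] = 0 := by simp [leftEnd]
    rw [hl] at hs ht
    have hs0 : s = 0 := Subtype.ext (le_antisymm hs s.2.1)
    have ht1 : t = 1 := Subtype.ext (le_antisymm t.2.2 (by simpa using ht))
    have h1 : (fun ω => randCascade H ε (n + 0) ω t - randCascade H ε (n + 0) ω s) =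
        endValue H ε n := by
      funext ω
      have h2 : randCascade H ε n ω 0 = 0 := cascadeFun_zero_right H _ n
      rw [hs0, ht1, add_zero, h2, sub_zero, endValue]
    have := hβ ε h
    simp only [List.length_nil, pow_zero, one_mul] at this ⊢
    rwa [h1]
  | cons b w ih =>
    intro x hβ ε h s t hs ht
    set m := n + w.length with hm
    have hlen : n + (b :: w).length = m + 1 := by simp [hm, add_assoc]
    set Y : Bool → Ω → ℝ := fun c ω =>
      if c then randCascade H (below ε [true]) m ω (rightHalf t) -
        randCascade H (below ε [true]) m ω (rightHalf s)
      else randCascade H (below ε [false]) m ω (leftHalf t) -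
        randCascade H (below ε [false]) m ω (leftHalf s) with hY
    have hYs : ∀ c (m' : MeasurableSpace Ω), StronglyMeasurable[m'] (randCascade H (below ε [c]) m) →
        Measurable[m'] (Y c) := by
      intro c m' hc
      cases c
      · exact ((stronglyMeasurable_eval hc _).sub (stronglyMeasurable_eval hc _)).measurable
      · exact ((stronglyMeasurable_eval hc _).sub (stronglyMeasurable_eval hc _)).measurable
    have hYb : ∀ c, Measurable[sigmaOf ε (branch c)] (fun ω => ε [c] ω * Y c ω) := fun c =>
      (measurable_sign_branch c).mul (hYs c _ (stronglyMeasurable_randCascade_branch H m c))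
    have hYm : ∀ c, Measurable (Y c) := fun c =>
      hYs c _ ((h.below [c]).stronglyMeasurable_randCascade m)
    have hYi : ∀ c, IndepFun (ε [c]) (Y c) P := fun c =>
      h.indepFun_sign [c] (hYs c _ (stronglyMeasurable_randCascade_compl H m c))
    have hX : (fun ω => randCascade H ε (m + 1) ω t - randCascade H ε (m + 1) ω s) =
        fun ω => (2 : ℝ) ^ (-H) * (ε [false] ω * Y false ω + ε [true] ω * Y true ω) := by
      funext ω
      rw [randCascade_succ_apply, randCascade_succ_apply]
      simp only [hY, if_true, Bool.false_eq_true, if_false]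
      ring
    rw [hlen, hX, h.charFun_branches hYb, norm_mul]
    have hle : ∀ c, ‖charFun (P.map fun ω => ε [c] ω * Y c ω) (2 ^ (-H) * x)‖ ≤ 1 := by
      intro c
      have : IsProbabilityMeasure (P.map fun ω => ε [c] ω * Y c ω) :=
        Measure.isProbabilityMeasure_map ((h.measurable [c]).mul (hYm c)).aemeasurable
      exact norm_charFun_le_one _
    have hβ' : ∀ ε : List Bool → Ω → ℝ, IsSignField P H ε → ‖charFun (P.map (endValue H ε n))
        (((2 : ℝ) ^ (-H)) ^ w.length * (2 ^ (-H) * x))‖ ≤ β := by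
      intro ε' h'
      have := hβ ε' h'
      rwa [List.length_cons, pow_succ, mul_assoc] at this
    have hb : ‖charFun (P.map fun ω => ε [b] ω * Y b ω) (2 ^ (-H) * x)‖ ≤ β := by
      refine (h.norm_charFun_sign_mul_le hH1 [b] (hYm b) (hYi b) _).trans ?_
      have hw := leftEnd_add_le_one w
      have hw0 := (leftEnd_mem w).1
      rw [leftEnd_cons] at hs ht
      rw [List.length_cons, pow_succ] at ht
      cases b
      · refine ih (2 ^ (-H) * x) hβ' (h.below [false]) (s := leftHalf s) (t := leftHalf t) ?_ ?_
        · simp only [Bool.toNat_false, CharP.cast_eq_zero, zero_add] at hs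
          exact (min_le_left _ _).trans (by linarith)
        · simp only [Bool.toNat_false, CharP.cast_eq_zero, zero_add] at ht
          exact le_min (by linarith) hw
      · refine ih (2 ^ (-H) * x) hβ' (h.below [true]) (s := rightHalf s) (t := rightHalf t) ?_ ?_
        · simp only [Bool.toNat_true, Nat.cast_one] at hs
          exact max_le (by linarith) hw0
        · simp only [Bool.toNat_true, Nat.cast_one] at ht
          exact le_max_of_le_left (by linarith)
    cases b
    · exact (mul_le_of_le_one_right (norm_nonneg _) (hle true)).trans hb
    · exact (mul_le_of_le_one_left (norm_nonneg _) (hle false)).trans hb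

/-- The small ball estimate for `H < 1`: the increment between `s` and `t` charges `[-r, r]` as if it
had a density bounded by a multiple of `(t - s) ^ (-H)`. -/
theorem exists_prob_abs_sub_le (P : Measure Ω) [IsProbabilityMeasure P] (hH : 1 / 2 < H)
    (hH1 : H < 1) :
    ∃ C : ℝ, 0 ≤ C ∧ ∀ (ε : List Bool → Ω → ℝ), IsSignField P H ε → ∀ B : Ω → C(I, ℝ),
      (∀ᵐ ω ∂P, Tendsto (fun n => randCascade H ε n ω) atTop (𝓝 (B ω))) →
      ∀ s t : I, s < t → ∀ r : ℝ, 0 < r →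
        P {ω | |B ω t - B ω s| ≤ r} ≤ ENNReal.ofReal (C * r * ((t : ℝ) - s) ^ (-H)) := by
  obtain ⟨a, C, ha, hC, hdec⟩ := exists_charFun_endValue_decay P hH hH1
  refine ⟨32 * Real.pi * C, by positivity, fun ε h B hB s t hst r hr => ?_⟩
  have hu0 : (0 : ℝ) < t - s := sub_pos.2 hst
  obtain ⟨w, hw1, hw2, hw3⟩ := exists_dyadicInterval_between s.2 t.2 hst
  set κ : ℝ := ((2 : ℝ) ^ (-H)) ^ w.length with hκ
  have hκ0 : 0 < κ := by positivity
  have h2H : (2 : ℝ) ^ (-H) ≤ 1 := Real.rpow_le_one_of_one_le_of_nonpos one_le_two (by linarith)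
  have hκ1 : κ ≤ 1 := pow_le_one₀ (by positivity) h2H
  have h2Hp : (1 : ℝ) < 2 ^ H := Real.one_lt_rpow one_lt_two (by linarith)
  obtain ⟨j, hj⟩ := pow_unbounded_of_one_lt ((2 * r)⁻¹ / a) h2Hp
  rw [div_lt_iff₀ ha] at hj
  have hbound : ∀ n, j < n → P {ω | |randCascade H ε (n + w.length) ω t -
      randCascade H ε (n + w.length) ω s| ≤ 2 * r} ≤
        ENNReal.ofReal (4 * Real.pi * C / κ * (2 * r)) := by
    intro n hn
    refine prob_abs_le_of_charFun_le ((h.measurable_eval _ t).sub (h.measurable_eval _ s))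
      (by positivity) hκ0 fun x hx => ?_
    refine norm_charFun_increment_le hH1.le n _ w x (fun ε' h' => ?_) h hw1 hw2
    refine hdec n j hn ε' h' _ ?_
    rw [abs_mul, abs_of_pos hκ0]
    calc κ * |x| ≤ 1 * (2 * r)⁻¹ := by gcongr
      _ ≤ _ := by linarith
  have hlim : P {ω | |B ω t - B ω s| ≤ r} ≤ ENNReal.ofReal (4 * Real.pi * C / κ * (2 * r)) := by
    refine measure_le_of_ae_eventually (A := fun n => {ω | |randCascade H ε (n + w.length) ω t -
      randCascade H ε (n + w.length) ω s| ≤ 2 * r}) ?_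
      ((eventually_gt_atTop j).mono hbound)
    filter_upwards [hB] with ω hω hS
    have hω' := (tendsto_add_atTop_iff_nat w.length).2 hω
    have h1 : Tendsto (fun n => |randCascade H ε (n + w.length) ω t -
        randCascade H ε (n + w.length) ω s|) atTop (𝓝 |B ω t - B ω s|) :=
      ((((continuous_eval_const t).tendsto _).comp hω').sub
        (((continuous_eval_const s).tendsto _).comp hω')).abs
    have h2 : |B ω t - B ω s| < 2 * r := lt_of_le_of_lt hS (by linarith)
    exact (h1.eventually_lt_const h2).mono fun n hn => hn.le
  refine hlim.trans (ENNReal.ofReal_le_ofReal ?_)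
  have h4 : κ⁻¹ ≤ 4 * ((t : ℝ) - s) ^ (-H) := by
    have h5 : κ⁻¹ = ((2 : ℝ) ^ w.length) ^ H := by
      rw [hκ, Real.rpow_neg two_pos.le, inv_pow, inv_inv, ← Real.rpow_natCast, ← Real.rpow_natCast,
        ← Real.rpow_mul two_pos.le, ← Real.rpow_mul two_pos.le, mul_comm]
    rw [h5]
    calc ((2 : ℝ) ^ w.length) ^ H ≤ (4 / ((t : ℝ) - s)) ^ H := by gcongr
      _ = 4 ^ H * ((t : ℝ) - s) ^ (-H) := by
          rw [Real.div_rpow (by norm_num) hu0.le, Real.rpow_neg hu0.le, div_eq_mul_inv]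
      _ ≤ _ := by
          gcongr
          calc (4 : ℝ) ^ H ≤ 4 ^ (1 : ℝ) :=
                Real.rpow_le_rpow_of_exponent_le (by norm_num) hH1.le
            _ = 4 := Real.rpow_one 4
  calc 4 * Real.pi * C / κ * (2 * r) = 8 * Real.pi * C * r * κ⁻¹ := by ring
    _ ≤ 8 * Real.pi * C * r * (4 * ((t : ℝ) - s) ^ (-H)) := by gcongr
    _ = _ := by ring

end IsSignField

/-! ### Almost sure size and oscillation of the functions of the tree -/

theorem measure_exists_word_le {Ω : Type*} {mΩ : MeasurableSpace Ω} {P : Measure Ω}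
    {A : List Bool → Set Ω} {p : ℕ} {c : ℝ≥0∞} (hA : ∀ w : List Bool, w.length = p → P (A w) ≤ c) :
    P {ω | ∃ w : List Bool, w.length = p ∧ ω ∈ A w} ≤ 2 ^ p * c := by
  have h1 : {ω | ∃ w : List Bool, w.length = p ∧ ω ∈ A w} ⊆
      ⋃ f : Fin p → Bool, A (List.ofFn f) := by
    rintro ω ⟨w, rfl, hω⟩
    exact Set.mem_iUnion.2 ⟨w.get, by rwa [List.ofFn_get]⟩
  calc P {ω | ∃ w : List Bool, w.length = p ∧ ω ∈ A w}
      ≤ ∑ f : Fin p → Bool, P (A (List.ofFn f)) :=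
        (measure_mono h1).trans (measure_iUnion_fintype_le _ _)
    _ ≤ ∑ _f : Fin p → Bool, c := Finset.sum_le_sum fun f _ => hA _ (List.length_ofFn)
    _ = _ := by simp

/-- The Borel–Cantelli lemma along the generations of the binary tree. -/
theorem ae_eventually_forall_word {Ω : Type*} {mΩ : MeasurableSpace Ω} {P : Measure Ω}
    {A : List Bool → Set Ω} {c : ℕ → ℝ≥0∞} (hA : ∀ w : List Bool, P (A w) ≤ c w.length)
    (hc : ∑' p, 2 ^ p * c p ≠ ⊤) :
    ∀ᵐ ω ∂P, ∀ᶠ p in atTop, ∀ w : List Bool, w.length = p → ω ∉ A w := by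
  have h1 : ∑' p, P {ω | ∃ w : List Bool, w.length = p ∧ ω ∈ A w} ≠ ⊤ :=
    ne_top_of_le_ne_top hc (ENNReal.tsum_le_tsum fun p =>
      measure_exists_word_le fun w hw => hw ▸ hA w)
  filter_upwards [ae_eventually_notMem h1] with ω hω
  filter_upwards [hω] with p hp w hw hmem
  exact hp ⟨w, hw, hmem⟩

theorem summable_two_pow_mul_pow_sq {θ : ℝ} (h0 : 0 ≤ θ) (h1 : θ < 1) :
    Summable fun p : ℕ => (2 : ℝ) ^ p * θ ^ (p ^ 2) := by
  have h2 : Tendsto (fun p : ℕ => 2 * θ ^ p) atTop (𝓝 (2 * 0)) :=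
    (tendsto_pow_atTop_nhds_zero_of_lt_one h0 h1).const_mul 2
  rw [mul_zero] at h2
  refine Summable.of_norm_bounded_eventually_nat
    (summable_geometric_of_lt_one (r := (1 / 2 : ℝ)) (by norm_num) (by norm_num)) ?_
  filter_upwards [h2.eventually_le_const (show (0 : ℝ) < 1 / 2 by norm_num)] with p hp
  rw [Real.norm_of_nonneg (by positivity), sq, pow_mul, ← mul_pow]
  exact pow_le_pow_left₀ (by positivity) hp p

/-- The functions of `C([0,1], ℝ)` whose oscillation is at most `x`. -/
def oscLE (x : ℝ) : Set C(I, ℝ) := {f | ∀ s t : I, |f s - f t| ≤ x}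

theorem isClosed_oscLE (x : ℝ) : IsClosed (oscLE x) := by
  have h : oscLE x = ⋂ s : I, ⋂ t : I, {f : C(I, ℝ) | |f s - f t| ≤ x} := by
    ext f
    simp only [oscLE, Set.mem_ofPred_eq, Set.mem_iInter]
  rw [h]
  exact isClosed_iInter fun s => isClosed_iInter fun t => isClosed_le
    ((continuous_eval_const s).sub (continuous_eval_const t)).abs continuous_const

theorem measurableSet_preimage_of_isClosed {Ω E : Type*} {m : MeasurableSpace Ω}
    [TopologicalSpace E] [TopologicalSpace.PseudoMetrizableSpace E] {f : Ω → E}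
    (hf : StronglyMeasurable[m] f) {S : Set E} (hS : IsClosed S) : MeasurableSet[m] (f ⁻¹' S) := by
  borelize E
  exact hf.measurable hS.measurableSet

theorem randCascade_mem_oscLE_below {Ω : Type*} {H : ℝ} {ε : List Bool → Ω → ℝ} {n : ℕ} {ω : Ω}
    (hω : ∀ w, |ε w ω| = 1) {x : ℝ} (h : randCascade H ε (n + 1) ω ∈ oscLE ((2 : ℝ) ^ (-H) * x))
    (b : Bool) : randCascade H (below ε [b]) n ω ∈ oscLE x := by
  intro s t
  have h2H : (0 : ℝ) < (2 : ℝ) ^ (-H) := by positivity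
  have hs := s.2
  have ht := t.2
  cases b
  · set g : I → I := fun u => ⟨(u : ℝ) / 2, by linarith [u.2.1], by linarith [u.2.2]⟩ with hg
    have h1 : ∀ u, leftHalf (g u) = u := fun u => by
      apply Subtype.ext
      simp only [leftHalf, hg]
      rw [min_eq_left (by linarith [u.2.2])]
      ring
    have h2 : ∀ u, rightHalf (g u) = 0 := fun u => by
      apply Subtype.ext
      simp only [rightHalf, hg]
      rw [max_eq_right (by linarith [u.2.2])]
      rfl
    have h3 := h (g s) (g t)
    rw [randCascade_succ_apply, randCascade_succ_apply, h1, h1, h2, h2, ← mul_sub,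
      add_sub_add_right_eq_sub, ← mul_sub, abs_mul, abs_mul, hω, one_mul, abs_of_pos h2H] at h3
    exact le_of_mul_le_mul_left h3 h2H
  · set g : I → I := fun u => ⟨((u : ℝ) + 1) / 2, by linarith [u.2.1], by linarith [u.2.2]⟩ with hg
    have h1 : ∀ u, leftHalf (g u) = 1 := fun u => by
      apply Subtype.ext
      simp only [leftHalf, hg]
      rw [min_eq_right (by linarith [u.2.1])]
      rfl
    have h2 : ∀ u, rightHalf (g u) = u := fun u => by
      apply Subtype.ext
      simp only [rightHalf, hg]
      rw [max_eq_left (by linarith [u.2.1])]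
      ring
    have h3 := h (g s) (g t)
    rw [randCascade_succ_apply, randCascade_succ_apply, h1, h1, h2, h2, ← mul_sub,
      add_sub_add_left_eq_sub, ← mul_sub, abs_mul, abs_mul, hω, one_mul, abs_of_pos h2H] at h3
    exact le_of_mul_le_mul_left h3 h2H

/-- An upper bound, uniform over the generations, for the probability that the terminal value of the
cascade is at most `1 / 2`. -/
noncomputable def smallProb (H : ℝ) : ℝ := 1 - 1 / (4 * cascadeMoment H)

theorem smallProb_nonneg {H : ℝ} (hH : 1 / 2 < H) : 0 ≤ smallProb H := by
  have := one_le_cascadeMoment hH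
  have h : 1 / (4 * cascadeMoment H) ≤ 1 := by
    rw [div_le_one (by linarith)]
    linarith
  unfold smallProb
  linarith

theorem smallProb_lt_one {H : ℝ} (hH : 1 / 2 < H) : smallProb H < 1 := by
  have := one_le_cascadeMoment hH
  have h : 0 < 1 / (4 * cascadeMoment H) := by positivity
  unfold smallProb
  linarith

namespace IsSignField

variable {Ω : Type*} {mΩ : MeasurableSpace Ω} {P : Measure Ω} {H : ℝ} {ε : List Bool → Ω → ℝ}
  [IsProbabilityMeasure P]

/-- A second moment (Paley–Zygmund) estimate. -/
theorem prob_endValue_le_half (h : IsSignField P H ε) (hH : 1 / 2 < H) (hH1 : H ≤ 1) (n : ℕ) :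
    P {ω | endValue H ε n ω ≤ 1 / 2} ≤ ENNReal.ofReal (smallProb H) := by
  set K := cascadeMoment H with hK
  have hK1 : 1 ≤ K := one_le_cascadeMoment hH
  obtain ⟨hi2, hK2⟩ := h.integral_endValue_sq_le hH hH1 n
  have hi1 := h.integrable_endValue hH1 n
  have hS : MeasurableSet {ω | endValue H ε n ω ≤ 1 / 2} :=
    measurableSet_le (h.measurable_endValue n) measurable_const
  have hind : Integrable ({ω | endValue H ε n ω ≤ 1 / 2}ᶜ.indicator fun _ => K) P :=
    (integrable_const K).indicator hS.compl
  have hsum : Integrable (fun ω => 1 / 2 + (4 * K)⁻¹ * endValue H ε n ω ^ 2) P :=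
    (integrable_const _).add (hi2.const_mul _)
  have h1 : ∫ ω, endValue H ε n ω ∂P ≤ ∫ ω, ((1 / 2 + (4 * K)⁻¹ * endValue H ε n ω ^ 2) +
      {ω | endValue H ε n ω ≤ 1 / 2}ᶜ.indicator (fun _ => K) ω) ∂P := by
    refine integral_mono hi1 (hsum.add hind) fun ω => ?_
    -- where `X > 1 / 2`, complete the square in `(4 K)⁻¹ X ^ 2 - X + K`
    by_cases hω : endValue H ε n ω ≤ 1 / 2
    · simp only
      rw [Set.indicator_of_notMem
        (show ω ∉ {ω | endValue H ε n ω ≤ 1 / 2}ᶜ from fun hc => hc hω)]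
      have : 0 ≤ (4 * K)⁻¹ * endValue H ε n ω ^ 2 := by positivity
      linarith
    · simp only
      rw [Set.indicator_of_mem (by exact hω)]
      have h2 : (4 * K)⁻¹ * endValue H ε n ω ^ 2 + K - endValue H ε n ω =
          (4 * K)⁻¹ * (endValue H ε n ω - 2 * K) ^ 2 := by
        field_simp
        ring
      have h3 : 0 ≤ (4 * K)⁻¹ * (endValue H ε n ω - 2 * K) ^ 2 := by positivity
      linarith
  rw [integral_endValue hH1 n h, integral_add hsum hind,
    integral_add (integrable_const _) (hi2.const_mul _), integral_const_mul,
    integral_indicator_const _ hS.compl, probReal_compl_eq_one_sub hS] at h1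
  simp only [integral_const, probReal_univ, smul_eq_mul, one_mul] at h1
  have h4 : (4 * K)⁻¹ * ∫ ω, endValue H ε n ω ^ 2 ∂P ≤ 1 / 4 := by
    calc (4 * K)⁻¹ * ∫ ω, endValue H ε n ω ^ 2 ∂P ≤ (4 * K)⁻¹ * K := by gcongr
      _ = 1 / 4 := by field_simp
  have h5 : P.real {ω | endValue H ε n ω ≤ 1 / 2} ≤ smallProb H := by
    have h6 : 1 / (4 * K) ≤ 1 - P.real {ω | endValue H ε n ω ≤ 1 / 2} := by
      rw [div_le_iff₀ (by positivity)]
      linarith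
    unfold smallProb
    linarith
  rw [← ENNReal.ofReal_toReal (measure_ne_top P _)]
  exact ENNReal.ofReal_le_ofReal h5

/-- A small oscillation of the cascade forces small oscillations in both of its independent
branches, so its probability is squared at each generation. -/
theorem prob_randCascade_oscLE_le (hH : 1 / 2 < H) (hH1 : H ≤ 1) (n k : ℕ) :
    ∀ {ε : List Bool → Ω → ℝ}, IsSignField P H ε →
      P (randCascade H ε (n + k) ⁻¹' oscLE (((2 : ℝ) ^ (-H)) ^ k * (1 / 2))) ≤
        ENNReal.ofReal (smallProb H) ^ (2 ^ k) := by
  induction k with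
  | zero =>
    intro ε h
    rw [pow_zero, pow_zero, pow_one, add_zero, one_mul]
    refine (measure_mono fun ω hω => ?_).trans (h.prob_endValue_le_half hH hH1 n)
    have h1 : |randCascade H ε n ω 1 - randCascade H ε n ω 0| ≤ 1 / 2 := hω 1 0
    have h2 : randCascade H ε n ω 0 = 0 := cascadeFun_zero_right H _ n
    rw [h2, sub_zero] at h1
    exact (le_abs_self _).trans h1
  | succ k ih =>
    intro ε h
    set E : Bool → Set Ω := fun b =>
      randCascade H (below ε [b]) (n + k) ⁻¹' oscLE (((2 : ℝ) ^ (-H)) ^ k * (1 / 2)) with hE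
    have hEm : ∀ b, MeasurableSet[sigmaOf ε (branch b)] (E b) := fun b =>
      measurableSet_preimage_of_isClosed (stronglyMeasurable_randCascade_branch H (n + k) b)
        (isClosed_oscLE _)
    have h1 : P (E false ∩ E true) = P (E false) * P (E true) :=
      (Indep_iff _ _ _).1 h.indep_branch _ _ (hEm false) (hEm true)
    calc P (randCascade H ε (n + (k + 1)) ⁻¹' oscLE (((2 : ℝ) ^ (-H)) ^ (k + 1) * (1 / 2)))
        ≤ P (E false ∩ E true) := by
          refine measure_mono_ae ?_
          filter_upwards [h.ae_abs_eq_one hH1] with ω hω hmem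
          have h2 : randCascade H ε (n + k + 1) ω ∈
              oscLE ((2 : ℝ) ^ (-H) * (((2 : ℝ) ^ (-H)) ^ k * (1 / 2))) := by
            rw [← mul_assoc, ← pow_succ']
            exact hmem
          exact ⟨randCascade_mem_oscLE_below hω h2 false, randCascade_mem_oscLE_below hω h2 true⟩
      _ = P (E false) * P (E true) := h1
      _ ≤ ENNReal.ofReal (smallProb H) ^ (2 ^ k) * ENNReal.ofReal (smallProb H) ^ (2 ^ k) :=
          mul_le_mul' (ih (h.below _)) (ih (h.below _))
      _ = _ := by rw [← pow_add, pow_succ 2 k, mul_two]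

theorem prob_limit_oscLE_le (h : IsSignField P H ε) (hH : 1 / 2 < H) (hH1 : H ≤ 1)
    {B : Ω → C(I, ℝ)} (hB : ∀ᵐ ω ∂P, Tendsto (fun n => randCascade H ε n ω) atTop (𝓝 (B ω)))
    (k : ℕ) :
    P (B ⁻¹' oscLE (((2 : ℝ) ^ (-H)) ^ k * (1 / 4))) ≤ ENNReal.ofReal (smallProb H) ^ (2 ^ k) := by
  have hpos : (0 : ℝ) < ((2 : ℝ) ^ (-H)) ^ k := by positivity
  refine measure_le_of_ae_eventually
    (A := fun n => randCascade H ε (n + k) ⁻¹' oscLE (((2 : ℝ) ^ (-H)) ^ k * (1 / 2))) ?_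
    (Eventually.of_forall fun n => prob_randCascade_oscLE_le hH hH1 n k h)
  filter_upwards [hB] with ω hω hmem
  have h1 := (tendsto_add_atTop_iff_nat k).2 hω
  filter_upwards [Metric.tendsto_nhds.1 h1 (((2 : ℝ) ^ (-H)) ^ k * (1 / 8)) (by positivity)]
    with n hn s t
  have h2 : ∀ u : I, |randCascade H ε (n + k) ω u - B ω u| ≤ ((2 : ℝ) ^ (-H)) ^ k * (1 / 8) :=
    fun u => (ContinuousMap.dist_apply_le_dist u).trans hn.le
  have h3 : |B ω s - B ω t| ≤ ((2 : ℝ) ^ (-H)) ^ k * (1 / 4) := hmem s t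
  have h4 := abs_le.1 (h2 s)
  have h5 := abs_le.1 (h2 t)
  have h6 := abs_le.1 h3
  rw [abs_le]
  constructor <;> linarith

/-- Almost surely, the oscillation of the limit below a word decays at most polynomially in the
length of the word. -/
theorem ae_eventually_osc (h : IsSignField P H ε) (hH : 1 / 2 < H) (hH1 : H ≤ 1)
    {B : List Bool → Ω → C(I, ℝ)}
    (hB : ∀ w, ∀ᵐ ω ∂P, Tendsto (fun n => randCascade H (below ε w) n ω) atTop (𝓝 (B w ω))) :
    ∀ᵐ ω ∂P, ∀ᶠ p : ℕ in atTop, ∀ w : List Bool, w.length = p →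
      ∃ s t : I, 1 / (16 * (p : ℝ) ^ 2) < |B w ω s - B w ω t| := by
  have hθ0 := smallProb_nonneg hH
  have hθ1 := smallProb_lt_one hH
  have hle : ENNReal.ofReal (smallProb H) ≤ 1 := by
    rw [← ENNReal.ofReal_one]
    exact ENNReal.ofReal_le_ofReal hθ1.le
  have hBC := ae_eventually_forall_word (P := P)
    -- `2 log₂ p` generations bring the probability below `smallProb H ^ (p ^ 2)`, which beats `2 ^ p`
    (A := fun w => B w ⁻¹' oscLE (((2 : ℝ) ^ (-H)) ^ (2 * Nat.clog 2 w.length) * (1 / 4)))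
    (c := fun p => ENNReal.ofReal (smallProb H) ^ (p ^ 2)) (fun w => ?_) ?_
  · filter_upwards [hBC] with ω hω
    filter_upwards [hω, eventually_ge_atTop 2] with p hp hp2 w hw
    have h1 := hp w hw
    rw [hw] at h1
    simp only [Set.mem_preimage, oscLE, Set.mem_ofPred_eq, not_forall, not_le] at h1
    obtain ⟨s, t, hst⟩ := h1
    refine ⟨s, t, lt_of_le_of_lt ?_ hst⟩
    have h2 : 2 ^ (Nat.clog 2 p) ≤ 2 * p := by
      have h3 := Nat.pow_pred_clog_lt_self one_lt_two (show 1 < p by omega)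
      have h4 : 0 < Nat.clog 2 p := Nat.clog_pos one_lt_two hp2
      obtain ⟨l, hl⟩ : ∃ l, Nat.clog 2 p = l + 1 := ⟨Nat.clog 2 p - 1, by omega⟩
      rw [hl] at h3 ⊢
      rw [Nat.pred_succ] at h3
      rw [pow_succ]
      omega
    have h3 : (2 : ℝ)⁻¹ ≤ 2 ^ (-H) := by
      rw [← Real.rpow_neg_one]
      exact Real.rpow_le_rpow_of_exponent_le one_le_two (by linarith)
    have hp0 : (0 : ℝ) < p := by exact_mod_cast (by omega : 0 < p)
    have h5 : ((2 : ℝ) ^ (Nat.clog 2 p)) ≤ 2 * p := by exact_mod_cast h2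
    calc 1 / (16 * (p : ℝ) ^ 2) = ((2 * (p : ℝ)) ^ 2)⁻¹ * (1 / 4) := by field_simp; norm_num
      _ ≤ (((2 : ℝ) ^ (Nat.clog 2 p)) ^ 2)⁻¹ * (1 / 4) := by gcongr
      _ = ((2 : ℝ)⁻¹) ^ (2 * Nat.clog 2 p) * (1 / 4) := by rw [← pow_mul, inv_pow, mul_comm 2]
      _ ≤ _ := by gcongr
  · refine ((h.below w).prob_limit_oscLE_le hH hH1 (hB w) _).trans ?_
    refine pow_le_pow_right_of_le_one' hle ?_
    rw [mul_comm, pow_mul]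
    exact Nat.pow_le_pow_left (Nat.le_pow_clog one_lt_two _) 2
  · have h1 := (summable_two_pow_mul_pow_sq hθ0 hθ1).tsum_ofReal_ne_top
    convert h1 using 3 with p
    rw [ENNReal.ofReal_mul (by positivity), ENNReal.ofReal_pow (by positivity),
      ENNReal.ofReal_pow hθ0, ENNReal.ofReal_ofNat]

/-- Almost surely, the limit below a word grows at most subexponentially in the length of the
word. -/
theorem ae_eventually_norm_le (h : IsSignField P H ε) (hH : 1 / 2 < H) (hH1 : H ≤ 1)
    {B : List Bool → Ω → C(I, ℝ)} (hBm : ∀ w, StronglyMeasurable (B w))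
    (hB : ∀ w, ∀ᵐ ω ∂P, Tendsto (fun n => randCascade H (below ε w) n ω) atTop (𝓝 (B w ω)))
    {δ : ℝ} (hδ : 0 < δ) :
    ∀ᵐ ω ∂P, ∀ᶠ p : ℕ in atTop, ∀ w : List Bool, w.length = p →
      ‖B w ω‖ ≤ (2 : ℝ) ^ (δ * p) := by
  -- a moment of order `q + 2 ≥ 2 / δ` makes Markov's inequality beat the `2 ^ p` words of length `p`
  obtain ⟨q, hq⟩ := exists_nat_gt (2 / δ)
  have hqδ : 2 ≤ ((q + 2 : ℕ) : ℝ) * δ := by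
    rw [div_lt_iff₀ hδ] at hq
    push_cast
    linarith
  have hq2 : q + 2 ≠ 0 := by omega
  set M : ℝ≥0∞ := (1 + cascadeTail H (q + 2) 0) ^ (q + 2) with hM
  have hMtop : M ≠ ⊤ := ENNReal.pow_ne_top
    (ENNReal.add_ne_top.2 ⟨ENNReal.one_ne_top, cascadeTail_ne_top hH _⟩)
  have hBC := ae_eventually_forall_word (P := P)
    (A := fun w => {ω | ENNReal.ofReal ((2 : ℝ) ^ (2 * w.length)) ≤ ‖B w ω‖ₑ ^ (q + 2)})
    (c := fun p => M / ENNReal.ofReal ((2 : ℝ) ^ (2 * p))) (fun w => ?_) ?_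
  · filter_upwards [hBC] with ω hω
    filter_upwards [hω] with p hp w hw
    have h1 := hp w hw
    simp only [not_le] at h1
    rw [hw, ← ofReal_norm, ← ENNReal.ofReal_pow (norm_nonneg _),
      ENNReal.ofReal_lt_ofReal_iff (by positivity)] at h1
    refine (pow_le_pow_iff_left₀ (norm_nonneg _) (by positivity) hq2).1 (h1.le.trans ?_)
    rw [← Real.rpow_natCast, ← Real.rpow_natCast, ← Real.rpow_mul two_pos.le]
    refine Real.rpow_le_rpow_of_exponent_le one_le_two ?_
    have hp0 : (0 : ℝ) ≤ p := p.cast_nonneg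
    push_cast at hqδ ⊢
    nlinarith
  · have hm : AEMeasurable (fun ω => ‖B w ω‖ₑ ^ (q + 2)) P :=
      ((hBm w).enorm.pow_const (q + 2)).aemeasurable
    refine (meas_ge_le_lintegral_div hm (by positivity) ENNReal.ofReal_ne_top).trans ?_
    gcongr
    rw [← eLpNorm_natCast_pow _ hq2]
    exact pow_le_pow_left' ((h.below w).eLpNorm_limit_le hH hH1 (hB w) (by omega)) _
  · have h1 : ∀ p : ℕ, 2 ^ p * (M / ENNReal.ofReal ((2 : ℝ) ^ (2 * p))) =
        M * ENNReal.ofReal ((1 / 2 : ℝ) ^ p) := by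
      intro p
      have h2 : (2 : ℝ≥0∞) ^ p = ENNReal.ofReal (2 ^ p) := by
        rw [ENNReal.ofReal_pow two_pos.le, ENNReal.ofReal_ofNat]
      rw [div_eq_mul_inv, ← ENNReal.ofReal_inv_of_pos (by positivity), h2, mul_left_comm,
        ← ENNReal.ofReal_mul (by positivity)]
      congr 2
      rw [two_mul, pow_add, one_div, inv_pow]
      field_simp
    simp_rw [h1]
    rw [ENNReal.tsum_mul_left]
    exact ENNReal.mul_ne_top hMtop
      (summable_geometric_of_lt_one (by norm_num) (by norm_num)).tsum_ofReal_ne_top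

end IsSignField

/-! ### Hölder regularity and pointwise exponents of the limit -/

section Deterministic

variable {H : ℝ} {e : List Bool → ℝ} {f : List Bool → C(I, ℝ)}

/-- The scaling relation between the limit and the functions of the tree. -/
theorem limit_sub_leftEnd
    (hf : ∀ w, Tendsto (fun n => cascade H (shift e w) n) atTop (𝓝 (f w)))
    (w : List Bool) (t : I) (ht : (t : ℝ) ∈ dyadicInterval w) :
    f [] t - f [] ⟨leftEnd w, leftEnd_mem w⟩ =
      signProd e w * (2 : ℝ) ^ (-((w.length : ℝ) * H)) * f w ⟨rescale w t, rescale_mem ht⟩ := by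
  have hev : ∀ v (s : I), Tendsto (fun n => cascade H (shift e v) n s) atTop (𝓝 (f v s)) :=
    fun v s => ((continuous_eval_const s).tendsto _).comp (hf v)
  have h1 := ((hev [] t).sub (hev [] ⟨leftEnd w, leftEnd_mem w⟩)).comp
    (tendsto_add_atTop_nat w.length)
  have h2 := (hev w ⟨rescale w t, rescale_mem ht⟩).const_mul
    (signProd e w * (2 : ℝ) ^ (-((w.length : ℝ) * H)))
  refine tendsto_nhds_unique (h1.congr fun n => ?_) h2
  exact cascadeFun_sub_leftEnd H n w e ht

theorem abs_limit_sub_eq (he : ∀ w, |e w| = 1)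
    (hf : ∀ w, Tendsto (fun n => cascade H (shift e w) n) atTop (𝓝 (f w)))
    (w : List Bool) (s t : I) (hs : (s : ℝ) ∈ dyadicInterval w) (ht : (t : ℝ) ∈ dyadicInterval w) :
    |f [] s - f [] t| = (2 : ℝ) ^ (-((w.length : ℝ) * H)) *
      |f w ⟨rescale w s, rescale_mem hs⟩ - f w ⟨rescale w t, rescale_mem ht⟩| := by
  rw [← sub_sub_sub_cancel_right _ _ (f [] ⟨leftEnd w, leftEnd_mem w⟩),
    limit_sub_leftEnd hf w s hs, limit_sub_leftEnd hf w t ht, ← mul_sub, abs_mul, abs_mul,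
    abs_signProd he, one_mul, abs_of_pos (by positivity)]

/-- Two points at distance at most `2 ^ (-p)` lie in the same dyadic interval of generation `p` or in
two adjacent ones. -/
theorem exists_dyadicInterval_chain (p : ℕ) {s t : I} (hst : s ≤ t)
    (h : (t : ℝ) - s ≤ (2 : ℝ)⁻¹ ^ p) :
    ∃ (v w : List Bool) (u : I), v.length = p ∧ w.length = p ∧ (s : ℝ) ∈ dyadicInterval v ∧
      (u : ℝ) ∈ dyadicInterval v ∧ (u : ℝ) ∈ dyadicInterval w ∧ (t : ℝ) ∈ dyadicInterval w := by
  have hp : (0 : ℝ) < 2 ^ p := by positivity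
  have hst' : (s : ℝ) ≤ t := hst
  rcases eq_or_lt_of_le s.2.2 with h1 | h1
  · obtain ⟨w, hw, hs⟩ := exists_mem_dyadicInterval p s.2
    have ht : t = s := le_antisymm (Subtype.coe_le_coe.1 (h1 ▸ t.2.2)) hst
    exact ⟨w, w, s, hw, hw, hs, hs, hs, ht ▸ hs⟩
  · have h0 : 0 ≤ 2 ^ p * (s : ℝ) := mul_nonneg hp.le s.2.1
    set k := ⌊2 ^ p * (s : ℝ)⌋₊ with hk
    have hk1 : (k : ℝ) ≤ 2 ^ p * s := Nat.floor_le h0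
    have hk2 : 2 ^ p * (s : ℝ) < k + 1 := Nat.lt_floor_add_one _
    have hkp : k < 2 ^ p := by
      rw [hk, Nat.floor_lt h0]
      push_cast
      nlinarith
    have hs := mem_dyadicInterval_binaryWord hkp hk1 hk2.le
    have hts : 2 ^ p * (t : ℝ) ≤ 2 ^ p * s + 1 := by
      have h2 : 2 ^ p * ((t : ℝ) - s) ≤ 2 ^ p * (2 : ℝ)⁻¹ ^ p := by gcongr
      rw [inv_pow, mul_inv_cancel₀ hp.ne'] at h2
      linarith
    rcases le_or_gt (2 ^ p * (t : ℝ)) (k + 1) with h3 | h3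
    · have ht := mem_dyadicInterval_binaryWord hkp
        (hk1.trans (mul_le_mul_of_nonneg_left hst' hp.le)) h3
      exact ⟨_, _, t, length_binaryWord _ _, length_binaryWord _ _, hs, ht, ht, ht⟩
    · have h4 : (k : ℝ) + 1 < 2 ^ p := h3.trans_le (mul_le_of_le_one_right hp.le t.2.2)
      have hkp' : k + 1 < 2 ^ p := by exact_mod_cast h4
      have hu : 2 ^ p * (((k : ℝ) + 1) / 2 ^ p) = k + 1 := by field_simp
      refine ⟨binaryWord p k, binaryWord p (k + 1), ⟨((k : ℝ) + 1) / 2 ^ p, by positivity, ?_⟩,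
        length_binaryWord _ _, length_binaryWord _ _, hs,
        mem_dyadicInterval_binaryWord hkp ?_ ?_, mem_dyadicInterval_binaryWord hkp' ?_ ?_,
        mem_dyadicInterval_binaryWord hkp' ?_ ?_⟩
      · rw [div_le_one hp]
        exact h4.le
      all_goals push_cast
      all_goals linarith

/-- A modulus of continuity along the dyadic scales gives Hölder continuity. -/
theorem exists_holderWith_of_dyadic {g : C(I, ℝ)} {α : ℝ≥0} {K : ℝ} {p₀ : ℕ} (hK : 0 ≤ K)
    (hg : ∀ p, p₀ ≤ p → ∀ s t : I, |(s : ℝ) - t| ≤ (2 : ℝ)⁻¹ ^ p →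
      |g s - g t| ≤ K * ((2 : ℝ)⁻¹ ^ p) ^ (α : ℝ)) :
    ∃ C : ℝ≥0, HolderWith C α g := by
  set A : ℝ := K * 2 ^ (α : ℝ) + 2 * ‖g‖ / ((2 : ℝ)⁻¹ ^ p₀) ^ (α : ℝ) with hA
  have hA0 : 0 ≤ A := by positivity
  refine ⟨A.toNNReal, fun s t => ?_⟩
  have hmain : |g s - g t| ≤ A * |(s : ℝ) - t| ^ (α : ℝ) := by
    rcases eq_or_ne s t with rfl | hne
    · rw [sub_self, abs_zero]
      positivity
    have hd : 0 < |(s : ℝ) - t| := abs_pos.2 (sub_ne_zero.2 fun h => hne (Subtype.ext h))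
    have hd1 : |(s : ℝ) - t| ≤ 1 := by
      rw [abs_le]
      constructor <;> linarith [s.2.1, s.2.2, t.2.1, t.2.2]
    obtain ⟨p, h1, h2⟩ := exists_nat_pow_near_of_lt_one hd hd1
      (show (0 : ℝ) < 2⁻¹ by norm_num) (by norm_num)
    rcases le_or_gt p₀ p with hp | hp
    · have h3 : ((2 : ℝ)⁻¹ ^ p) ^ (α : ℝ) ≤ 2 ^ (α : ℝ) * |(s : ℝ) - t| ^ (α : ℝ) := by
        rw [← Real.mul_rpow two_pos.le hd.le]
        refine Real.rpow_le_rpow (by positivity) ?_ α.2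
        rw [pow_succ] at h1
        linarith
      calc |g s - g t| ≤ K * ((2 : ℝ)⁻¹ ^ p) ^ (α : ℝ) := hg p hp s t h2
        _ ≤ K * (2 ^ (α : ℝ) * |(s : ℝ) - t| ^ (α : ℝ)) := by gcongr
        _ = K * 2 ^ (α : ℝ) * |(s : ℝ) - t| ^ (α : ℝ) := by ring
        _ ≤ _ := by
          gcongr
          rw [hA]
          have : 0 ≤ 2 * ‖g‖ / ((2 : ℝ)⁻¹ ^ p₀) ^ (α : ℝ) := by positivity
          linarith
    · have h3 : (2 : ℝ)⁻¹ ^ p₀ ≤ |(s : ℝ) - t| :=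
        (pow_le_pow_of_le_one (by norm_num) (by norm_num) (by omega)).trans h1.le
      have h4 : ((2 : ℝ)⁻¹ ^ p₀) ^ (α : ℝ) ≤ |(s : ℝ) - t| ^ (α : ℝ) :=
        Real.rpow_le_rpow (by positivity) h3 α.2
      have h5 : (0 : ℝ) < ((2 : ℝ)⁻¹ ^ p₀) ^ (α : ℝ) := by positivity
      calc |g s - g t| ≤ |g s| + |g t| := abs_sub _ _
        _ ≤ 2 * ‖g‖ := by
          rw [two_mul]
          exact add_le_add (g.norm_coe_le_norm s) (g.norm_coe_le_norm t)
        _ = 2 * ‖g‖ / ((2 : ℝ)⁻¹ ^ p₀) ^ (α : ℝ) * ((2 : ℝ)⁻¹ ^ p₀) ^ (α : ℝ) := by field_simp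
        _ ≤ 2 * ‖g‖ / ((2 : ℝ)⁻¹ ^ p₀) ^ (α : ℝ) * |(s : ℝ) - t| ^ (α : ℝ) := by gcongr
        _ ≤ _ := by
          gcongr
          rw [hA]
          have : 0 ≤ K * 2 ^ (α : ℝ) := by positivity
          linarith
  have h6 : edist s t = ENNReal.ofReal |(s : ℝ) - t| := by
    rw [edist_dist, Subtype.dist_eq, Real.dist_eq]
  rw [h6, edist_dist, Real.dist_eq, ENNReal.ofReal_rpow_of_nonneg (abs_nonneg _) α.coe_nonneg]
  refine le_trans ?_ (ENNReal.ofReal_mul hA0).le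
  exact ENNReal.ofReal_le_ofReal hmain

theorem holderWith_abs_sub_le {g : C(I, ℝ)} {C α : ℝ≥0} (h : HolderWith C α g) (s t : I) :
    |g s - g t| ≤ C * |(s : ℝ) - t| ^ (α : ℝ) := by
  have h1 := h.dist_le s t
  rwa [Real.dist_eq, Subtype.dist_eq, Real.dist_eq] at h1

/-- Subexponential growth of the functions of the tree gives Hölder continuity with every exponent
less than `H`. -/
theorem exists_holderWith_limit (he : ∀ w, |e w| = 1)
    (hf : ∀ w, Tendsto (fun n => cascade H (shift e w) n) atTop (𝓝 (f w)))
    {δ : ℝ} (hδ : ∀ᶠ p : ℕ in atTop, ∀ w : List Bool, w.length = p → ‖f w‖ ≤ (2 : ℝ) ^ (δ * p))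
    {α : ℝ≥0} (hα : (α : ℝ) + δ ≤ H) : ∃ C : ℝ≥0, HolderWith C α (f []) := by
  obtain ⟨p₀, hp₀⟩ := eventually_atTop.1 hδ
  have hword : ∀ p, p₀ ≤ p → ∀ w : List Bool, w.length = p → ∀ s t : I,
      (s : ℝ) ∈ dyadicInterval w → (t : ℝ) ∈ dyadicInterval w →
        |f [] s - f [] t| ≤ 2 * ((2 : ℝ)⁻¹ ^ p) ^ (α : ℝ) := by
    intro p hp w hw s t hs ht
    have h1 : |f w ⟨rescale w s, rescale_mem hs⟩ - f w ⟨rescale w t, rescale_mem ht⟩| ≤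
        2 * (2 : ℝ) ^ (δ * p) := by
      refine (abs_sub _ _).trans ?_
      rw [two_mul]
      exact add_le_add (((f w).norm_coe_le_norm _).trans (hp₀ p hp w hw))
        (((f w).norm_coe_le_norm _).trans (hp₀ p hp w hw))
    have h2 : ((2 : ℝ)⁻¹ ^ p) ^ (α : ℝ) = 2 ^ (-((p : ℝ) * α)) := by
      rw [← Real.rpow_natCast, ← Real.rpow_mul (by norm_num), Real.inv_rpow two_pos.le,
        Real.rpow_neg two_pos.le]
    calc |f [] s - f [] t| ≤ (2 : ℝ) ^ (-((p : ℝ) * H)) * (2 * (2 : ℝ) ^ (δ * p)) := by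
          rw [abs_limit_sub_eq he hf w s t hs ht, hw]
          gcongr
      _ = 2 * (2 : ℝ) ^ (-((p : ℝ) * H) + δ * p) := by
          rw [Real.rpow_add two_pos]
          ring
      _ ≤ 2 * 2 ^ (-((p : ℝ) * α)) := by
          gcongr
          · exact one_le_two
          · have : 0 ≤ (p : ℝ) * (H - (α + δ)) := mul_nonneg p.cast_nonneg (by linarith)
            linarith
      _ = _ := by rw [h2]
  refine exists_holderWith_of_dyadic (K := 4) (p₀ := p₀) (by norm_num) fun p hp s t hst => ?_
  wlog hle : s ≤ t generalizing s t
  · rw [abs_sub_comm]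
    exact this t s (by rwa [abs_sub_comm]) (le_of_not_ge hle)
  obtain ⟨v, w, u, hv, hw, h1, h2, h3, h4⟩ := exists_dyadicInterval_chain p hle
    ((le_abs_self _).trans (by rwa [abs_sub_comm]))
  have h5 := hword p hp v hv s u h1 h2
  have h6 := hword p hp w hw u t h3 h4
  have h7 := abs_sub_le (f [] s) (f [] u) (f [] t)
  linarith

/-- Polynomial lower bounds for the oscillations of the functions of the tree give large increments
near every point. -/
theorem frequently_rpow_le_abs_sub (he : ∀ w, |e w| = 1)
    (hf : ∀ w, Tendsto (fun n => cascade H (shift e w) n) atTop (𝓝 (f w)))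
    (hosc : ∀ᶠ p : ℕ in atTop, ∀ w : List Bool, w.length = p →
      ∃ s t : I, 1 / (16 * (p : ℝ) ^ 2) < |f w s - f w t|)
    {a : ℝ} (ha0 : 0 ≤ a) (ha : H < a) (t : I) :
    ∃ᶠ s : I in 𝓝[≠] t, |(s : ℝ) - t| ^ a ≤ |f [] s - f [] t| := by
  have hpoly : Tendsto (fun p : ℕ => (p : ℝ) ^ 2 * ((2 : ℝ) ^ (-(a - H))) ^ p) atTop (𝓝 0) :=
    tendsto_pow_const_mul_const_pow_of_lt_one 2 (by positivity)
      (Real.rpow_lt_one_of_one_lt_of_neg one_lt_two (by linarith))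
  have hall : ∀ᶠ p : ℕ in atTop, ∃ s : I, s ≠ t ∧ |(s : ℝ) - t| ≤ (2 : ℝ)⁻¹ ^ p ∧
      |(s : ℝ) - t| ^ a ≤ |f [] s - f [] t| := by
    filter_upwards [hosc, hpoly.eventually_le_const (show (0 : ℝ) < 1 / 32 by norm_num),
      eventually_ge_atTop 1] with p hp hp2 hp1
    have hp0 : (0 : ℝ) < p := by exact_mod_cast hp1
    obtain ⟨w, hw, ht⟩ := exists_mem_dyadicInterval p t.2
    obtain ⟨x, y, hxy⟩ := hp w hw
    -- one of the two points is far, in value, from the image of `t`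
    obtain ⟨z, hz⟩ : ∃ z : I, 1 / (32 * (p : ℝ) ^ 2) < |f w z - f w ⟨rescale w t, rescale_mem ht⟩| := by
      by_contra! hc
      have h1 := abs_sub_le (f w x) (f w ⟨rescale w t, rescale_mem ht⟩) (f w y)
      have h2 := hc x
      have h3 := hc y
      rw [abs_sub_comm] at h3
      have h4 : 1 / (16 * (p : ℝ) ^ 2) = 1 / (32 * (p : ℝ) ^ 2) + 1 / (32 * (p : ℝ) ^ 2) := by
        field_simp
        norm_num
      linarith
    obtain ⟨s', hs, hsz⟩ := exists_rescale_eq w z.2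
    set s : I := ⟨s', dyadicInterval_subset w hs⟩ with hsdef
    have hz' : (⟨rescale w s, rescale_mem hs⟩ : I) = z := Subtype.ext hsz
    have h1 := abs_limit_sub_eq he hf w s t hs ht
    rw [hz', hw] at h1
    have h2 : (0 : ℝ) < 1 / (32 * (p : ℝ) ^ 2) := by positivity
    have h3 : (2 : ℝ) ^ (-((p : ℝ) * H)) * (1 / (32 * (p : ℝ) ^ 2)) < |f [] s - f [] t| := by
      rw [h1]
      gcongr
    have hd : |(s : ℝ) - t| ≤ (2 : ℝ)⁻¹ ^ p := hw ▸ abs_sub_le_of_mem_dyadicInterval hs ht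
    refine ⟨s, ?_, hd, ?_⟩
    · intro hst
      rw [hst, sub_self, abs_zero] at h3
      have : (0 : ℝ) < (2 : ℝ) ^ (-((p : ℝ) * H)) * (1 / (32 * (p : ℝ) ^ 2)) := by positivity
      linarith
    · calc |(s : ℝ) - t| ^ a ≤ ((2 : ℝ)⁻¹ ^ p) ^ a :=
            Real.rpow_le_rpow (abs_nonneg _) hd ha0
        _ = 2 ^ (-((p : ℝ) * H)) * ((2 : ℝ) ^ (-(a - H))) ^ p := by
          rw [← Real.rpow_natCast, ← Real.rpow_natCast, ← Real.rpow_mul (by norm_num),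
            ← Real.rpow_mul two_pos.le, ← Real.rpow_add two_pos, Real.inv_rpow two_pos.le,
            ← Real.rpow_neg two_pos.le]
          congr 1
          ring
        _ ≤ 2 ^ (-((p : ℝ) * H)) * (1 / (32 * (p : ℝ) ^ 2)) := by
          gcongr
          rw [le_div_iff₀ (by positivity)]
          linarith
        _ ≤ _ := h3.le
  rw [(nhdsWithin_hasBasis Metric.nhds_basis_ball _).frequently_iff]
  intro r hr
  have hr' : ∀ᶠ p : ℕ in atTop, (2 : ℝ)⁻¹ ^ p < r :=
    (tendsto_pow_atTop_nhds_zero_of_lt_one (by norm_num) (by norm_num)).eventually_lt_const hr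
  obtain ⟨p, ⟨s, h1, h2, h3⟩, h4⟩ := (hall.and hr').exists
  refine ⟨s, ⟨?_, h1⟩, h3⟩
  rw [Metric.mem_ball, Subtype.dist_eq, Real.dist_eq]
  exact h2.trans_lt h4

end Deterministic

theorem le_pointwiseExponent {g : C(I, ℝ)} {H : ℝ} (hH : 0 < H)
    (h : ∀ α : ℝ≥0, 0 < α → (α : ℝ) < H → ∃ C : ℝ≥0, HolderWith C α g) (t : I) :
    (H : EReal) ≤ pointwiseExponent g t := by
  refine EReal.ge_of_forall_gt_iff_ge.1 fun a ha => ?_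
  have haH : a < H := by exact_mod_cast ha
  obtain ⟨α, hα1, hα2⟩ := exists_between (max_lt haH hH)
  have hα0 : 0 < α := (le_max_right _ _).trans_lt hα1
  obtain ⟨C, hC⟩ := h ⟨α, hα0.le⟩ hα0 hα2
  have haα : 0 < α - a := by linarith [le_max_left a 0]
  have hdist : Tendsto (fun s : I => |(s : ℝ) - t|) (𝓝[≠] t) (𝓝 0) := by
    have h1 : Continuous fun s : I => |(s : ℝ) - t| := by fun_prop
    have h2 := h1.tendsto t
    rw [sub_self, abs_zero] at h2
    exact h2.mono_left nhdsWithin_le_nhds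
  have hsmall : Tendsto (fun s : I => (C : ℝ) * |(s : ℝ) - t| ^ (α - a)) (𝓝[≠] t) (𝓝 0) := by
    have h1 := (hdist.rpow_const (Or.inr haα.le)).const_mul (C : ℝ)
    rwa [Real.zero_rpow haα.ne', mul_zero] at h1
  refine le_liminf_of_le (h := ?_)
  filter_upwards [hdist.eventually_lt_const one_pos, hsmall.eventually_le_const one_pos,
    self_mem_nhdsWithin] with s hs1 hs2 hst
  have hd : 0 < |(s : ℝ) - t| := abs_pos.2 (sub_ne_zero.2 fun h => hst (Subtype.ext h))
  have hlog : Real.log |(s : ℝ) - t| < 0 := Real.log_neg hd hs1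
  rw [ENNReal.log_ofReal]
  split_ifs with h0
  · rw [EReal.bot_div_of_neg_ne_bot (by exact_mod_cast hlog) (EReal.coe_ne_bot _)]
    exact le_top
  · push Not at h0
    rw [← EReal.coe_div, EReal.coe_le_coe_iff, le_div_iff_of_neg hlog, ← Real.log_rpow hd]
    refine Real.log_le_log h0 ((holderWith_abs_sub_le hC s t).trans ?_)
    calc (C : ℝ) * |(s : ℝ) - t| ^ α
        = C * |(s : ℝ) - t| ^ (α - a) * |(s : ℝ) - t| ^ a := by
          rw [mul_assoc, ← Real.rpow_add hd, sub_add_cancel]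
      _ ≤ 1 * |(s : ℝ) - t| ^ a := by gcongr
      _ = _ := one_mul _

theorem pointwiseExponent_le {g : C(I, ℝ)} {H : ℝ} {t : I}
    (h : ∀ a, H < a → ∃ᶠ s : I in 𝓝[≠] t, |(s : ℝ) - t| ^ a ≤ |g s - g t|) :
    pointwiseExponent g t ≤ H := by
  refine EReal.le_of_forall_lt_iff_le.1 fun a ha => ?_
  have haH : H < a := by exact_mod_cast ha
  have hdist : ∀ᶠ s : I in 𝓝[≠] t, |(s : ℝ) - t| < 1 := by
    have h1 : Continuous fun s : I => |(s : ℝ) - t| := by fun_prop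
    have h2 := h1.tendsto t
    rw [sub_self, abs_zero] at h2
    exact (h2.mono_left nhdsWithin_le_nhds).eventually_lt_const one_pos
  refine liminf_le_of_frequently_le' ?_
  refine ((h a haH).and_eventually (hdist.and self_mem_nhdsWithin)).mono ?_
  rintro s ⟨h1, h2, hst⟩
  have hd : 0 < |(s : ℝ) - t| := abs_pos.2 (sub_ne_zero.2 fun h => hst (Subtype.ext h))
  have hlog : Real.log |(s : ℝ) - t| < 0 := Real.log_neg hd h2
  have hpos : 0 < |g s - g t| := (Real.rpow_pos_of_pos hd a).trans_le h1
  rw [ENNReal.log_ofReal, if_neg (not_le.2 hpos), ← EReal.coe_div, EReal.coe_le_coe_iff,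
    div_le_iff_of_neg hlog, ← Real.log_rpow hd]
  exact Real.log_le_log (Real.rpow_pos_of_pos hd a) h1

/-! ### Box dimensions, Hausdorff dimension and graphs -/

theorem exists_isCover_encard_le {X : Type*} [PseudoMetricSpace X] {A : Set X} {δ : ℝ≥0}
    (h : Metric.externalCoveringNumber δ A ≠ ⊤) :
    ∃ C : Set X, Metric.IsCover δ A C ∧ C.encard ≤ Metric.externalCoveringNumber δ A := by
  have h1 : Metric.externalCoveringNumber δ A < Metric.externalCoveringNumber δ A + 1 :=
    ENat.lt_add_one_iff h |>.2 le_rfl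
  rw [Metric.externalCoveringNumber, iInf_lt_iff] at h1
  obtain ⟨C, hC⟩ := h1
  rw [iInf_lt_iff] at hC
  obtain ⟨hcov, hlt⟩ := hC
  exact ⟨C, hcov, (ENat.lt_add_one_iff h).1 hlt⟩

/-- At a scale `δ < 1`, comparing `boxRatio` with `a` amounts to comparing the covering number with
`δ ^ (-a)`. -/
theorem boxRatio_le_iff {X : Type*} [PseudoMetricSpace X] {A : Set X} {δ : ℝ≥0} (h0 : 0 < δ)
    (h1 : δ < 1) (a : ℝ) :
    boxRatio A δ ≤ a ↔
      (Metric.externalCoveringNumber δ A : ℝ≥0∞) ≤ ENNReal.ofReal ((δ : ℝ) ^ (-a)) := by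
  have h0' : (0 : ℝ) < δ := h0
  have hlog : 0 < -Real.log δ := neg_pos.2 (Real.log_neg h0 h1)
  have hpos : (0 : ℝ) < (δ : ℝ) ^ (-a) := Real.rpow_pos_of_pos h0' _
  have h2 : ENNReal.log (ENNReal.ofReal ((δ : ℝ) ^ (-a))) = ((-Real.log δ : ℝ) : EReal) * a := by
    rw [ENNReal.log_ofReal, if_neg (not_le.2 hpos), Real.log_rpow h0', ← EReal.coe_mul]
    congr 1
    ring
  rw [boxRatio, EReal.div_le_iff_le_mul (by exact_mod_cast hlog) (EReal.coe_ne_top _), ← h2,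
    ENNReal.log_le_log_iff]

/-- The Hausdorff dimension is at most the lower box dimension. -/
theorem dimH_le_of_lowerBoxDim_lt {X : Type*} [MetricSpace X] {A : Set X} {s : ℝ≥0}
    (h : lowerBoxDim A < ((s : ℝ) : EReal)) : dimH A ≤ s := by
  borelize X
  have h1 : ∃ᶠ δ : ℝ≥0 in 𝓝[>] 0, boxRatio A δ < ((s : ℝ) : EReal) :=
    frequently_lt_of_liminf_lt (by isBoundedDefault) h
  have h2 : ∃ᶠ δ : ℝ≥0 in 𝓝[>] 0, ∃ C : Set X, Metric.IsCover δ A C ∧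
      (C.encard : ℝ≥0∞) ≤ ENNReal.ofReal ((δ : ℝ) ^ (-(s : ℝ))) ∧ 0 < δ := by
    have h3 : ∀ᶠ δ : ℝ≥0 in 𝓝[>] 0, δ < 1 :=
      nhdsWithin_le_nhds (Iio_mem_nhds one_pos)
    refine (h1.and_eventually (h3.and self_mem_nhdsWithin)).mono ?_
    rintro δ ⟨h4, h5, h6⟩
    have h7 := (boxRatio_le_iff h6 h5 _).1 h4.le
    have h8 : Metric.externalCoveringNumber δ A ≠ ⊤ := by
      intro hc
      rw [hc] at h7
      exact ENNReal.ofReal_ne_top (top_le_iff.1 h7)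
    obtain ⟨C, hC, hcard⟩ := exists_isCover_encard_le h8
    exact ⟨C, hC, (by exact_mod_cast hcard : (C.encard : ℝ≥0∞) ≤ _).trans h7, h6⟩
  obtain ⟨δ, hδ, hC⟩ := exists_seq_forall_of_frequently h2
  choose C hcov hcard hpos using hC
  have hcount : ∀ n, Countable (C n) := fun n => by
    have h3 : C n |>.Finite := by
      rw [← Set.encard_lt_top_iff]
      have h4 := (hcard n).trans_lt ENNReal.ofReal_lt_top
      exact_mod_cast h4
    exact h3.countable.to_subtype
  have hδ0 : Tendsto (fun n => 2 * (δ n : ℝ≥0∞)) atTop (𝓝 0) := by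
    have h3 : Tendsto (fun n => (δ n : ℝ≥0∞)) atTop (𝓝 0) := by
      exact ENNReal.tendsto_coe.2 (hδ.mono_right nhdsWithin_le_nhds)
    simpa using ENNReal.Tendsto.const_mul h3 (Or.inr ENNReal.ofNat_ne_top)
  have hdiam : ∀ n (x : X), Metric.ediam (Metric.closedEBall x (δ n : ℝ≥0∞)) ≤ 2 * (δ n : ℝ≥0∞) :=
    fun n x => Metric.ediam_closedEBall_le
  have hH := Measure.hausdorffMeasure_le_liminf_tsum (s : ℝ) A (l := atTop)
    (fun n => 2 * (δ n : ℝ≥0∞)) hδ0 (fun n (x : C n) => Metric.closedEBall (x : X) (δ n : ℝ≥0∞))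
    (Eventually.of_forall fun n x => hdiam n x)
    (Eventually.of_forall fun n x hx => by
      obtain ⟨c, hc, hxc⟩ := hcov n hx
      exact Set.mem_iUnion.2 ⟨⟨c, hc⟩, hxc⟩)
  refine dimH_le_of_hausdorffMeasure_ne_top (ne_top_of_le_ne_top ?_ (hH.trans
    (liminf_le_of_frequently_le' (x := (2 : ℝ≥0∞) ^ (s : ℝ))
      (Eventually.of_forall fun n => ?_).frequently)))
  · exact ENNReal.rpow_ne_top_of_nonneg s.2 ENNReal.ofNat_ne_top
  · have hδn : (0 : ℝ) < δ n := hpos n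
    calc ∑' x : C n, Metric.ediam (Metric.closedEBall (x : X) (δ n : ℝ≥0∞)) ^ (s : ℝ)
        ≤ ∑' _ : C n, (2 * (δ n : ℝ≥0∞)) ^ (s : ℝ) :=
          ENNReal.tsum_le_tsum fun x => ENNReal.rpow_le_rpow (hdiam n x) s.2
      _ = (C n).encard * (2 * (δ n : ℝ≥0∞)) ^ (s : ℝ) := by
          rw [ENNReal.tsum_const]
          rfl
      _ ≤ ENNReal.ofReal ((δ n : ℝ) ^ (-(s : ℝ))) * (2 * (δ n : ℝ≥0∞)) ^ (s : ℝ) := by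
          gcongr
          exact hcard n
      _ = (2 : ℝ≥0∞) ^ (s : ℝ) := by
          rw [ENNReal.mul_rpow_of_nonneg _ _ s.coe_nonneg, mul_left_comm, ← ENNReal.ofReal_coe_nnreal,
            ENNReal.ofReal_rpow_of_pos hδn, ← ENNReal.ofReal_mul (by positivity),
            ← Real.rpow_add hδn, neg_add_cancel, Real.rpow_zero, ENNReal.ofReal_one, mul_one]

theorem lowerBoxDim_le_upperBoxDim {X : Type*} [PseudoMetricSpace X] (A : Set X) :
    lowerBoxDim A ≤ upperBoxDim A :=
  liminf_le_limsup

theorem dist_le_abs_add_abs (x y : EuclideanSpace ℝ (Fin 2)) :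
    dist x y ≤ |x 0 - y 0| + |x 1 - y 1| := by
  rw [EuclideanSpace.dist_eq, Fin.sum_univ_two, Real.dist_eq, Real.dist_eq]
  refine Real.sqrt_le_iff.2 ⟨by positivity, ?_⟩
  nlinarith [abs_nonneg (x 0 - y 0), abs_nonneg (x 1 - y 1)]

/-- The number of balls needed to cover the graph of a Hölder continuous function: over each of
about `1 / η` intervals of length `η`, a column of about `η ^ (α - 1)` squares of side `η` is
enough. -/
theorem externalCoveringNumber_graph_le {g : C(I, ℝ)} {C α : ℝ≥0} (hα : (α : ℝ) ≤ 1)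
    (hg : HolderWith C α g) {η : ℝ≥0} (h0 : 0 < η) (h1 : η ≤ 1) :
    (Metric.externalCoveringNumber (2 * η) (graph g) : ℝ≥0∞) ≤
      ENNReal.ofReal (3 * (2 * C + 3) * (η : ℝ) ^ ((α : ℝ) - 2)) := by
  have h0' : (0 : ℝ) < η := h0
  have h1' : (η : ℝ) ≤ 1 := h1
  set m : ℕ := ⌈1 / (η : ℝ)⌉₊ with hm
  have hm1 : 1 / (η : ℝ) ≤ m := Nat.le_ceil _
  have hm2 : (m : ℝ) < 1 / η + 1 := Nat.ceil_lt_add_one (by positivity)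
  have hm0 : (0 : ℝ) < m := lt_of_lt_of_le (by positivity) hm1
  have hmη : 1 / (m : ℝ) ≤ η := by
    rw [div_le_comm₀ hm0 h0']
    exact hm1
  set x : ℝ := C * (η : ℝ) ^ ((α : ℝ) - 1) with hx
  have hx0 : 0 ≤ x := by positivity
  set J : ℕ := ⌈x⌉₊ with hJ
  have hJ1 : x ≤ J := Nat.le_ceil _
  have hJ2 : (J : ℝ) < x + 1 := Nat.ceil_lt_add_one hx0
  set center : ℕ × ℤ → EuclideanSpace ℝ (Fin 2) := fun k =>
    !₂[(k.1 : ℝ) / m, g (Set.projIcc 0 1 zero_le_one ((k.1 : ℝ) / m)) + k.2 * η] with hcenter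
  set S : Finset (ℕ × ℤ) := Finset.range (m + 1) ×ˢ Finset.Icc (-(J : ℤ)) J with hS
  have hcov : Metric.IsCover (2 * η) (graph g) (center '' S) := by
    rintro _ ⟨t, rfl⟩
    have ht0 : 0 ≤ (t : ℝ) * m := mul_nonneg t.2.1 hm0.le
    set k := ⌊(t : ℝ) * m⌋₊ with hk
    have hk1 : (k : ℝ) ≤ t * m := Nat.floor_le ht0
    have hk2 : (t : ℝ) * m < k + 1 := Nat.lt_floor_add_one _
    have hkm : (k : ℝ) ≤ m := hk1.trans (mul_le_of_le_one_left hm0.le t.2.2)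
    have hmem : (k : ℝ) / m ∈ I := ⟨by positivity, (div_le_one hm0).2 hkm⟩
    have hdist : |(t : ℝ) - k / m| ≤ η := by
      have h3 : (t : ℝ) - k / m = (t * m - k) / m := by field_simp
      rw [h3, abs_of_nonneg (div_nonneg (by linarith) hm0.le)]
      refine le_trans ?_ hmη
      gcongr
      linarith
    set u : I := ⟨(k : ℝ) / m, hmem⟩ with hu
    have hproj : Set.projIcc 0 1 zero_le_one ((k : ℝ) / m) = u := Set.projIcc_of_mem _ hmem
    have hosc : |g t - g u| ≤ x * η := by
      refine (holderWith_abs_sub_le hg t u).trans ?_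
      have h3 : x * (η : ℝ) = C * (η : ℝ) ^ (α : ℝ) := by
        rw [hx, mul_assoc, ← Real.rpow_add_one h0'.ne', sub_add_cancel]
      rw [h3]
      gcongr
    set j : ℤ := ⌊(g t - g u) / η⌋ with hj
    have hj1 : (j : ℝ) ≤ (g t - g u) / η := Int.floor_le _
    have hj2 : (g t - g u) / η < j + 1 := Int.lt_floor_add_one _
    have hq : |(g t - g u) / η| ≤ x := by
      rwa [abs_div, abs_of_pos h0', div_le_iff₀ h0']
    have hq' := abs_le.1 hq
    have hjJ : j ∈ Finset.Icc (-(J : ℤ)) J := by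
      rw [Finset.mem_Icc]
      constructor
      · rw [hj, Int.le_floor]
        push_cast
        linarith
      · have : (j : ℝ) ≤ (J : ℤ) := by push_cast; linarith
        exact_mod_cast this
    refine ⟨center (k, j), ⟨(k, j), ?_, rfl⟩, ?_⟩
    · have : k < m + 1 := Nat.lt_succ_of_le (by exact_mod_cast hkm)
      exact Finset.mem_coe.2 (Finset.mem_product.2 ⟨Finset.mem_range.2 this, hjJ⟩)
    · have h3 : |g t - (g u + j * η)| ≤ η := by
        have h4 : g t - (g u + j * η) = ((g t - g u) / η - j) * η := by field_simp; ring
        rw [h4, abs_mul, abs_of_pos h0', abs_of_nonneg (by linarith)]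
        nlinarith
      have h5 : dist (!₂[(t : ℝ), g t] : EuclideanSpace ℝ (Fin 2)) (center (k, j)) ≤ 2 * η := by
        refine (dist_le_abs_add_abs _ _).trans ?_
        simp only [hcenter, hproj, PiLp.toLp_apply, Matrix.cons_val_zero, Matrix.cons_val_one]
        linarith
      change edist _ _ ≤ _
      rw [edist_dist, ENNReal.ofReal_le_iff_le_toReal ENNReal.coe_ne_top]
      simpa using h5
  have hcard : ((center '' S).encard : ℝ≥0∞) ≤ ENNReal.ofReal (((m : ℝ) + 1) * (2 * J + 1)) := by
    have h3 : (center '' (S : Set (ℕ × ℤ))).encard ≤ ((m + 1) * (2 * J + 1) : ℕ) := by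
      refine (Set.encard_image_le _ _).trans ?_
      rw [Set.encard_coe_eq_coe_finsetCard, hS, Finset.card_product, Finset.card_range,
        Int.card_Icc]
      have : ((J : ℤ) + 1 - -(J : ℤ)).toNat = 2 * J + 1 := by omega
      rw [this]
    calc ((center '' S).encard : ℝ≥0∞) ≤ (((m + 1) * (2 * J + 1) : ℕ) : ℝ≥0∞) := by
          exact_mod_cast h3
      _ = ENNReal.ofReal (((m + 1) * (2 * J + 1) : ℕ) : ℝ) := (ENNReal.ofReal_natCast _).symm
      _ = _ := by push_cast; rfl
  calc (Metric.externalCoveringNumber (2 * η) (graph g) : ℝ≥0∞)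
      ≤ ((center '' S).encard : ℝ≥0∞) := by exact_mod_cast hcov.externalCoveringNumber_le_encard
    _ ≤ ENNReal.ofReal (((m : ℝ) + 1) * (2 * J + 1)) := hcard
    _ ≤ _ := by
      refine ENNReal.ofReal_le_ofReal ?_
      have hη1 : 1 ≤ 1 / (η : ℝ) := by rwa [le_div_iff₀ h0', one_mul]
      have hη2 : 1 ≤ (η : ℝ) ^ ((α : ℝ) - 1) :=
        Real.one_le_rpow_of_pos_of_le_one_of_nonpos h0' h1' (by linarith)
      have h3 : (m : ℝ) + 1 ≤ 3 * (1 / η) := by linarith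
      have h4 : 2 * (J : ℝ) + 1 ≤ (2 * C + 3) * (η : ℝ) ^ ((α : ℝ) - 1) := by
        rw [add_mul, mul_assoc, ← hx]
        linarith
      calc ((m : ℝ) + 1) * (2 * J + 1)
          ≤ 3 * (1 / η) * ((2 * C + 3) * (η : ℝ) ^ ((α : ℝ) - 1)) := by gcongr
        _ = 3 * (2 * C + 3) * ((η : ℝ) ^ ((α : ℝ) - 1) * (η : ℝ) ^ (-1 : ℝ)) := by
          rw [Real.rpow_neg_one]
          ring
        _ = _ := by
          rw [← Real.rpow_add h0']
          congr 2
          ring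

theorem upperBoxDim_graph_le {g : C(I, ℝ)} {C α : ℝ≥0} (hα : (α : ℝ) ≤ 1)
    (hg : HolderWith C α g) : upperBoxDim (graph g) ≤ ((2 - α : ℝ) : EReal) := by
  refine EReal.le_of_forall_lt_iff_le.1 fun a ha => ?_
  have ha' : 2 - (α : ℝ) < a := by exact_mod_cast ha
  set K : ℝ := 3 * (2 * C + 3) * (1 / 2) ^ ((α : ℝ) - 2) with hK
  have hid : Tendsto (fun δ : ℝ≥0 => (δ : ℝ)) (𝓝[>] 0) (𝓝 0) :=
    (NNReal.continuous_coe.tendsto 0).mono_left nhdsWithin_le_nhds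
  have hsmall : Tendsto (fun δ : ℝ≥0 => K * (δ : ℝ) ^ (a - (2 - α))) (𝓝[>] 0) (𝓝 0) := by
    have h1 := (hid.rpow_const (p := a - (2 - α)) (Or.inr (by linarith))).const_mul K
    rwa [Real.zero_rpow (by linarith), mul_zero] at h1
  refine limsup_le_of_le (h := ?_)
  filter_upwards [hid.eventually_lt_const one_pos, hsmall.eventually_le_const one_pos,
    self_mem_nhdsWithin] with δ h1 h2 h3
  have h3' : (0 : ℝ) < δ := h3
  rw [boxRatio_le_iff h3 h1]
  have h4 := externalCoveringNumber_graph_le hα hg (η := δ / 2) (half_pos h3)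
    (NNReal.coe_le_coe.1 (by push_cast; linarith))
  rw [mul_div_cancel₀ δ two_ne_zero] at h4
  refine h4.trans (ENNReal.ofReal_le_ofReal ?_)
  calc 3 * (2 * (C : ℝ) + 3) * ((δ / 2 : ℝ≥0) : ℝ) ^ ((α : ℝ) - 2)
      = K * (δ : ℝ) ^ (a - (2 - α)) * (δ : ℝ) ^ (-a) := by
        have h5 : ((δ / 2 : ℝ≥0) : ℝ) ^ ((α : ℝ) - 2) =
            (1 / 2) ^ ((α : ℝ) - 2) * (δ : ℝ) ^ ((α : ℝ) - 2) := by
          rw [← Real.mul_rpow (by norm_num) h3'.le]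
          push_cast
          congr 1
          ring
        have h6 : (δ : ℝ) ^ ((α : ℝ) - 2) = (δ : ℝ) ^ (a - (2 - α)) * (δ : ℝ) ^ (-a) := by
          rw [← Real.rpow_add h3']
          congr 1
          ring
        rw [h5, h6, hK]
        ring
    _ ≤ 1 * (δ : ℝ) ^ (-a) := by gcongr
    _ = _ := one_mul _

theorem abs_sub_le_of_edist_graph_le (g : C(I, ℝ)) {s t : I} {r : ℝ} (hr : 0 ≤ r)
    (h : edist (!₂[(s : ℝ), g s] : EuclideanSpace ℝ (Fin 2)) !₂[(t : ℝ), g t] ≤ ENNReal.ofReal r) :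
    |(s : ℝ) - t| ≤ r ∧ |g s - g t| ≤ r := by
  rw [edist_dist, ENNReal.ofReal_le_ofReal_iff hr, dist_eq_norm] at h
  constructor
  · exact (PiLp.norm_apply_le (!₂[(s : ℝ), g s] - !₂[(t : ℝ), g t]) 0).trans h
  · exact (PiLp.norm_apply_le (!₂[(s : ℝ), g s] - !₂[(t : ℝ), g t]) 1).trans h

theorem continuous_graphMap (g : C(I, ℝ)) :
    Continuous fun t : I => (!₂[(t : ℝ), g t] : EuclideanSpace ℝ (Fin 2)) := by
  refine (PiLp.continuous_toLp 2 _).comp (continuous_pi fun i => ?_)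
  fin_cases i
  · exact continuous_subtype_val
  · exact g.continuous

/-- The mass distribution principle for graphs: the image on the graph of the restriction of
Lebesgue measure to a set of positive measure gives mass at most a multiple of `r ^ γ` to the sets of
diameter `r`. -/
theorem le_dimH_graph_of_volume_le {g : C(I, ℝ)} {γ : ℝ≥0} {T : Set I} (hT : volume T ≠ 0)
    {M : ℝ≥0∞} (hM : M ≠ ⊤)
    (h : ∀ t ∈ T, ∀ r : ℝ≥0∞, r ≤ 1 →
      volume {s : I | edist (!₂[(s : ℝ), g s] : EuclideanSpace ℝ (Fin 2)) !₂[(t : ℝ), g t] ≤ r} ≤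
        M * r ^ (γ : ℝ)) : (γ : ℝ≥0∞) ≤ dimH (graph g) := by
  set G : I → EuclideanSpace ℝ (Fin 2) := fun t => !₂[(t : ℝ), g t] with hG
  have hGm : Measurable G := (continuous_graphMap g).measurable
  set μ : Measure (EuclideanSpace ℝ (Fin 2)) := (volume.restrict T).map G with hμ
  have hμS : ∀ S : Set (EuclideanSpace ℝ (Fin 2)), Metric.ediam S ≤ 1 →
      μ S ≤ (M + 1) * Metric.ediam S ^ (γ : ℝ) := by
    intro S hS
    have hcl : MeasurableSet (closure S) := isClosed_closure.measurableSet
    refine (measure_mono subset_closure).trans ?_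
    rw [hμ, Measure.map_apply hGm hcl, Measure.restrict_apply (hGm hcl)]
    rcases Set.eq_empty_or_nonempty (G ⁻¹' closure S ∩ T) with he | ⟨t, ht, htT⟩
    · rw [he, measure_empty]
      exact zero_le
    · calc volume (G ⁻¹' closure S ∩ T)
          ≤ volume {s : I | edist (G s) (G t) ≤ Metric.ediam S} := by
            refine measure_mono fun s hs => ?_
            rw [← Metric.ediam_closure]
            exact Metric.edist_le_ediam_of_mem hs.1 ht
        _ ≤ M * Metric.ediam S ^ (γ : ℝ) := h t htT _ hS
        _ ≤ _ := by gcongr; exact le_self_add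
  have hM1 : M + 1 ≠ ⊤ := ENNReal.add_ne_top.2 ⟨hM, ENNReal.one_ne_top⟩
  have hM0 : M + 1 ≠ 0 := by simp
  have hle : (M + 1)⁻¹ • μ ≤ Measure.hausdorffMeasure (γ : ℝ) := by
    refine Measure.le_hausdorffMeasure _ _ 1 one_pos fun S hS => ?_
    rw [Measure.smul_apply, smul_eq_mul, mul_comm, ← div_eq_mul_inv]
    exact ENNReal.div_le_of_le_mul' (hμS S hS)
  refine le_dimH_of_hausdorffMeasure_ne_zero fun hc => ?_
  have h1 := (hle (graph g)).trans_eq hc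
  rw [Measure.smul_apply, smul_eq_mul, nonpos_iff_eq_zero, mul_eq_zero] at h1
  rcases h1 with h1 | h1
  · exact ENNReal.inv_ne_zero.2 hM1 h1
  · have hcpt : IsCompact (graph g) := isCompact_range (continuous_graphMap g)
    have h2 : G ⁻¹' graph g = Set.univ := Set.preimage_range G
    rw [hμ, Measure.map_apply hGm hcpt.measurableSet, h2, Measure.restrict_apply_univ] at h1
    exact hT h1

/-- A dyadic energy criterion: if, for almost every `t`, the measures of the parts of the graph within
`2 ^ (-p)` of the point above `t` are summable against `2 ^ (γ p)`, then the graph has dimension at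
least `γ`. -/
theorem le_dimH_graph_of_ae_tsum_ne_top {g : C(I, ℝ)} {γ : ℝ≥0}
    (h : ∀ᵐ t : I, ∑' p : ℕ, ENNReal.ofReal (((2 : ℝ) ^ p) ^ (γ : ℝ)) *
      volume {s : I | |(s : ℝ) - t| ≤ (2 : ℝ)⁻¹ ^ p ∧ |g s - g t| ≤ (2 : ℝ)⁻¹ ^ p} ≠ ⊤) :
    (γ : ℝ≥0∞) ≤ dimH (graph g) := by
  set φ : I → ℝ≥0∞ := fun t => ∑' p : ℕ, ENNReal.ofReal (((2 : ℝ) ^ p) ^ (γ : ℝ)) *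
      volume {s : I | |(s : ℝ) - t| ≤ (2 : ℝ)⁻¹ ^ p ∧ |g s - g t| ≤ (2 : ℝ)⁻¹ ^ p} with hφ
  -- the sum is bounded by a constant on a set of positive measure
  obtain ⟨M, hM⟩ : ∃ M : ℕ, volume {t : I | φ t ≤ M} ≠ 0 := by
    by_contra! hc
    have h1 : volume (⋃ M : ℕ, {t : I | φ t ≤ M}) = 0 := measure_iUnion_null hc
    have h2 : (volume : Measure I) Set.univ ≤ volume (⋃ M : ℕ, {t : I | φ t ≤ M}) := by
      refine measure_mono_ae ?_
      filter_upwards [h] with t ht _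
      obtain ⟨M, hM⟩ := ENNReal.exists_nat_gt ht
      exact Set.mem_iUnion.2 ⟨M, hM.le⟩
    rw [h1, measure_univ] at h2
    exact one_ne_zero (nonpos_iff_eq_zero.1 h2)
  refine le_dimH_graph_of_volume_le hM (M := M * ENNReal.ofReal (2 ^ (γ : ℝ)))
    (ENNReal.mul_ne_top (ENNReal.natCast_ne_top M) ENNReal.ofReal_ne_top) fun t ht r hr => ?_
  rcases eq_or_ne r 0 with rfl | hr0
  · have hsub : {s : I | edist (!₂[(s : ℝ), g s] : EuclideanSpace ℝ (Fin 2)) !₂[(t : ℝ), g t] ≤ 0} ⊆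
        {t} := fun s hs => by
      have h1 := (abs_sub_le_of_edist_graph_le g le_rfl (by rwa [ENNReal.ofReal_zero])).1
      exact Subtype.ext (sub_eq_zero.1 (abs_nonpos_iff.1 h1))
    refine (measure_mono hsub).trans ?_
    rw [measure_singleton]
    exact zero_le
  · lift r to ℝ≥0 using ne_top_of_le_ne_top ENNReal.one_ne_top hr
    have hr0' : (0 : ℝ) < r := NNReal.coe_pos.2 (pos_iff_ne_zero.2 (by exact_mod_cast hr0))
    have hr1 : (r : ℝ) ≤ 1 := by exact_mod_cast hr
    obtain ⟨p, h1, h2⟩ := exists_nat_pow_near_of_lt_one hr0' hr1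
      (show (0 : ℝ) < 2⁻¹ by norm_num) (by norm_num)
    set V := volume {s : I | |(s : ℝ) - t| ≤ (2 : ℝ)⁻¹ ^ p ∧ |g s - g t| ≤ (2 : ℝ)⁻¹ ^ p} with hV
    have h3 : ENNReal.ofReal (((2 : ℝ) ^ p) ^ (γ : ℝ)) * V ≤ M := (ENNReal.le_tsum p).trans ht
    have h4 : 1 ≤ ((2 : ℝ) ^ (γ : ℝ) * (r : ℝ) ^ (γ : ℝ)) * ((2 : ℝ) ^ p) ^ (γ : ℝ) := by
      rw [← Real.mul_rpow two_pos.le hr0'.le, ← Real.mul_rpow (by positivity) (by positivity)]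
      refine Real.one_le_rpow ?_ γ.2
      rw [pow_succ, inv_pow, ← mul_inv, inv_lt_iff_one_lt_mul₀ (by positivity)] at h1
      linarith
    calc volume {s : I | edist (!₂[(s : ℝ), g s] : EuclideanSpace ℝ (Fin 2)) !₂[(t : ℝ), g t] ≤ r}
        ≤ V := by
          refine measure_mono fun s hs => ?_
          have h5 := abs_sub_le_of_edist_graph_le g r.coe_nonneg (s := s) (t := t)
            (by rwa [ENNReal.ofReal_coe_nnreal])
          exact ⟨h5.1.trans h2, h5.2.trans h2⟩
      _ ≤ ENNReal.ofReal (((2 : ℝ) ^ (γ : ℝ) * (r : ℝ) ^ (γ : ℝ)) * ((2 : ℝ) ^ p) ^ (γ : ℝ)) * V :=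
          le_mul_of_one_le_left zero_le (ENNReal.one_le_ofReal.2 h4)
      _ = (ENNReal.ofReal (((2 : ℝ) ^ p) ^ (γ : ℝ)) * V) *
          (ENNReal.ofReal (2 ^ (γ : ℝ)) * ENNReal.ofReal ((r : ℝ) ^ (γ : ℝ))) := by
          rw [ENNReal.ofReal_mul (by positivity), ENNReal.ofReal_mul (by positivity)]
          ring
      _ ≤ M * (ENNReal.ofReal (2 ^ (γ : ℝ)) * ENNReal.ofReal ((r : ℝ) ^ (γ : ℝ))) := by gcongr
      _ = _ := by
          rw [← mul_assoc, ← ENNReal.ofReal_rpow_of_pos hr0', ENNReal.ofReal_coe_nnreal]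

/-- The three dimensions of a graph coincide with `2 - H` as soon as the function is Hölder
continuous with every exponent less than `H` and the Hausdorff dimension of the graph is at least
`2 - H`. -/
theorem graph_dimensions {g : C(I, ℝ)} {H : ℝ} (hH0 : 0 < H) (hH1 : H ≤ 1)
    (hhol : ∀ α : ℝ≥0, 0 < α → (α : ℝ) < H → ∃ C : ℝ≥0, HolderWith C α g)
    (hdim : ∀ γ : ℝ≥0, (γ : ℝ) < 2 - H → (γ : ℝ≥0∞) ≤ dimH (graph g)) :
    dimH (graph g) = ENNReal.ofReal (2 - H) ∧
      lowerBoxDim (graph g) = ((2 - H : ℝ) : EReal) ∧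
      upperBoxDim (graph g) = ((2 - H : ℝ) : EReal) := by
  have hup : upperBoxDim (graph g) ≤ ((2 - H : ℝ) : EReal) := by
    refine EReal.le_of_forall_lt_iff_le.1 fun a ha => ?_
    have ha' : 2 - H < a := by exact_mod_cast ha
    obtain ⟨α, h1, h2⟩ := exists_between (max_lt (show 2 - a < H by linarith) hH0)
    have hα0 : 0 < α := (le_max_right _ _).trans_lt h1
    lift α to ℝ≥0 using hα0.le
    obtain ⟨C, hC⟩ := hhol α (NNReal.coe_pos.1 hα0) h2
    refine (upperBoxDim_graph_le (by linarith) hC).trans ?_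
    have h3 : 2 - (α : ℝ) ≤ a := by linarith [le_max_left (2 - a) 0]
    exact_mod_cast h3
  have hlow : ((2 - H : ℝ) : EReal) ≤ lowerBoxDim (graph g) := by
    by_contra! hc
    obtain ⟨a, h1, h2⟩ := EReal.lt_iff_exists_real_btwn.1 hc
    have h2' : a < 2 - H := by exact_mod_cast h2
    obtain ⟨s, h3, h4⟩ := exists_between (max_lt h2' (show 0 < 2 - H by linarith))
    obtain ⟨γ, h5, h6⟩ := exists_between h4
    have hs0 : 0 < s := (le_max_right _ _).trans_lt h3
    have hγ0 : 0 < γ := hs0.trans h5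
    lift s to ℝ≥0 using hs0.le
    lift γ to ℝ≥0 using hγ0.le
    have h7 : dimH (graph g) ≤ s :=
      dimH_le_of_lowerBoxDim_lt (h1.trans (by exact_mod_cast (le_max_left a 0).trans_lt h3))
    have h8 : γ ≤ s := by exact_mod_cast (hdim γ h6).trans h7
    exact absurd h5 (not_lt.2 h8)
  have hlu := lowerBoxDim_le_upperBoxDim (graph g)
  refine ⟨le_antisymm ?_ ?_, le_antisymm (hlu.trans hup) hlow, le_antisymm hup (hlow.trans hlu)⟩
  · refine le_of_forall_gt fun c hc => ?_
    obtain ⟨s, h1, h2⟩ := ENNReal.lt_iff_exists_nnreal_btwn.1 hc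
    refine lt_of_le_of_lt (dimH_le_of_lowerBoxDim_lt ((hlu.trans hup).trans_lt ?_)) h2
    have h3 : 2 - H < (s : ℝ) := by
      rw [← ENNReal.ofReal_coe_nnreal] at h1
      exact (ENNReal.ofReal_lt_ofReal_iff_of_nonneg (by linarith)).1 h1
    exact_mod_cast h3
  · refine le_of_forall_lt fun c hc => ?_
    obtain ⟨s, h1, h2⟩ := ENNReal.lt_iff_exists_nnreal_btwn.1 hc
    refine h1.trans_le (hdim s ?_)
    rw [← ENNReal.ofReal_coe_nnreal] at h2
    exact (ENNReal.ofReal_lt_ofReal_iff_of_nonneg s.2).1 h2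

/-! ### The expected energy of the graph -/

theorem lintegral_abs_rpow_neg_le {H r : ℝ} (hH1 : H < 1) (hr : 0 ≤ r) :
    ∫⁻ u in Set.Icc (-r) r, ENNReal.ofReal (|u| ^ (-H)) ≤
      ENNReal.ofReal (2 * (r ^ (1 - H) / (1 - H))) := by
  have hm : Measurable fun u : ℝ => ENNReal.ofReal (|u| ^ (-H)) := by fun_prop
  have h1 : ∫⁻ u in Set.Icc 0 r, ENNReal.ofReal (|u| ^ (-H)) =
      ENNReal.ofReal (r ^ (1 - H) / (1 - H)) := by
    have hint : IntervalIntegrable (fun u : ℝ => u ^ (-H)) volume 0 r :=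
      intervalIntegral.intervalIntegrable_rpow' (by linarith)
    have h2 : ∫ u in (0 : ℝ)..r, u ^ (-H) = r ^ (1 - H) / (1 - H) := by
      rw [integral_rpow (Or.inl (by linarith)), neg_add_eq_sub, Real.zero_rpow (by linarith),
        sub_zero]
    rw [← h2, intervalIntegral.integral_of_le hr, ofReal_integral_eq_lintegral_ofReal hint.1
      (by filter_upwards [ae_restrict_mem measurableSet_Ioc] with u hu
          exact Real.rpow_nonneg hu.1.le _),
      setLIntegral_congr (Ioc_ae_eq_Icc (a := (0 : ℝ)) (b := r)).symm]
    refine setLIntegral_congr_fun measurableSet_Ioc fun u hu => ?_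
    simp only [abs_of_pos hu.1]
  have h3 : ∫⁻ u in Set.Icc (-r) 0, ENNReal.ofReal (|u| ^ (-H)) =
      ENNReal.ofReal (r ^ (1 - H) / (1 - H)) := by
    have h4 := (Measure.measurePreserving_neg (volume : Measure ℝ)).setLIntegral_comp_preimage
      (s := Set.Icc 0 r) measurableSet_Icc hm
    have h5 : Neg.neg ⁻¹' Set.Icc 0 r = Set.Icc (-r) 0 := by
      ext u
      simp only [Set.mem_preimage, Set.mem_Icc]
      constructor <;> rintro ⟨h6, h7⟩ <;> constructor <;> linarith
    simp only [abs_neg, h5] at h4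
    rw [h4, h1]
  calc ∫⁻ u in Set.Icc (-r) r, ENNReal.ofReal (|u| ^ (-H))
      = ∫⁻ u in Set.Icc (-r) 0 ∪ Set.Icc 0 r, ENNReal.ofReal (|u| ^ (-H)) := by
        rw [Set.Icc_union_Icc_eq_Icc (by linarith) hr]
    _ ≤ _ := lintegral_union_le _ _ _
    _ = _ := by
        have : 0 ≤ r ^ (1 - H) / (1 - H) := div_nonneg (by positivity) (by linarith)
        rw [h1, h3, ← ENNReal.ofReal_add this this, two_mul]

/-- Integrating over `s` in `[0, 1]` a function of `s - t`. -/
theorem lintegral_unitInterval_sub_le (t : I) {φ : ℝ → ℝ≥0∞} :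
    ∫⁻ s : I, φ (s - t) ≤ ∫⁻ u, φ u := by
  have h1 : ∫⁻ s : I, φ (s - t) = ∫⁻ s in I, φ (s - t) :=
    lintegral_subtype_comap measurableSet_Icc fun s : ℝ => φ (s - t)
  rw [h1, ← lintegral_sub_right_eq_self φ (t : ℝ)]
  exact setLIntegral_le_lintegral _ _

theorem volume_abs_sub_le (t : I) (r : ℝ) :
    volume {s : I | |(s : ℝ) - t| ≤ r} ≤ ENNReal.ofReal (2 * r) := by
  have hm : MeasurableSet {s : I | |(s : ℝ) - t| ≤ r} :=
    measurableSet_le (by fun_prop) measurable_const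
  have h1 := lintegral_unitInterval_sub_le t (φ := (Set.Icc (-r) r).indicator 1)
  rw [lintegral_indicator_one measurableSet_Icc, Real.volume_Icc] at h1
  rw [← lintegral_indicator_one hm]
  refine (lintegral_mono ?_).trans (h1.trans (by rw [two_mul, sub_neg_eq_add]))
  refine Set.indicator_le fun s hs => ?_
  rw [Set.indicator_of_mem (show (s : ℝ) - t ∈ Set.Icc (-r) r from abs_le.1 hs)]
  rfl

/-- The pairs of points of the graph, of abscissas `t` and `s`, whose coordinates differ by at most
`r`, as a set of triples `((ω, t), s)`. -/
def nearSet {Ω : Type*} (B : Ω → C(I, ℝ)) (r : ℝ) : Set ((Ω × I) × I) :=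
  {q | |(q.2 : ℝ) - q.1.2| ≤ r ∧ |B q.1.1 q.2 - B q.1.1 q.1.2| ≤ r}

theorem measurableSet_nearSet {Ω : Type*} {mΩ : MeasurableSpace Ω} {B : Ω → C(I, ℝ)}
    (hB : StronglyMeasurable B) (r : ℝ) : MeasurableSet (nearSet B r) := by
  have heval : StronglyMeasurable fun q : Ω × I => B q.1 q.2 := by
    have h1 : StronglyMeasurable fun q : Ω × I => (B q.1, q.2) :=
      (hB.comp_measurable measurable_fst).prodMk measurable_snd.stronglyMeasurable
    exact (continuous_eval (F := C(I, ℝ))).comp_stronglyMeasurable h1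
  have h2 : Measurable fun q : (Ω × I) × I => B q.1.1 q.2 :=
    heval.measurable.comp ((measurable_fst.comp measurable_fst).prodMk measurable_snd)
  have h3 : Measurable fun q : (Ω × I) × I => B q.1.1 q.1.2 :=
    heval.measurable.comp measurable_fst
  have h4 : Measurable fun q : (Ω × I) × I => |(q.2 : ℝ) - q.1.2| := by fun_prop
  exact (measurableSet_le h4 measurable_const).inter
    (measurableSet_le (h2.sub h3).abs measurable_const)

namespace IsSignField

variable {Ω : Type*} {mΩ : MeasurableSpace Ω} {P : Measure Ω} {H : ℝ} {ε : List Bool → Ω → ℝ}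
  [IsProbabilityMeasure P]

/-- The expected measure of the points of the graph that are within `r` of a given one. -/
theorem exists_lintegral_nearSet_le (h : IsSignField P H ε) (hH : 1 / 2 < H) (hH1 : H ≤ 1)
    {B : Ω → C(I, ℝ)} (hBm : StronglyMeasurable B)
    (hB : ∀ᵐ ω ∂P, Tendsto (fun n => randCascade H ε n ω) atTop (𝓝 (B ω))) :
    ∃ K : ℝ, ∀ r : ℝ, 0 < r → ∀ t : I,
      ∫⁻ ω, volume (Prod.mk (ω, t) ⁻¹' nearSet B r) ∂P ≤ ENNReal.ofReal (K * r ^ (2 - H)) := by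
  rcases eq_or_lt_of_le hH1 with rfl | hH1'
  · refine ⟨2, fun r hr t => ?_⟩
    have h1 : (2 : ℝ) - 1 = 1 := by norm_num
    rw [h1, Real.rpow_one]
    calc ∫⁻ ω, volume (Prod.mk (ω, t) ⁻¹' nearSet B r) ∂P ≤ ∫⁻ _ω, ENNReal.ofReal (2 * r) ∂P :=
          lintegral_mono fun ω => (measure_mono fun s hs => hs.1).trans (volume_abs_sub_le t r)
      _ = _ := by simp
  · obtain ⟨C, hC0, hC⟩ := exists_prob_abs_sub_le P hH hH1'
    refine ⟨C * (2 / (1 - H)), fun r hr t => ?_⟩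
    set S : Set (Ω × I) := (fun q : Ω × I => ((q.1, t), q.2)) ⁻¹' nearSet B r with hS
    have hSm : MeasurableSet S := measurableSet_nearSet hBm r |>.preimage (by fun_prop)
    have h1 : ∫⁻ ω, volume (Prod.mk (ω, t) ⁻¹' nearSet B r) ∂P =
        ∫⁻ s : I, P ((fun ω => (ω, s)) ⁻¹' S) := by
      rw [← Measure.prod_apply_symm hSm, Measure.prod_apply hSm]
      rfl
    set φ : ℝ → ℝ≥0∞ := (Set.Icc (-r) r).indicator fun u =>
      ENNReal.ofReal (C * r) * ENNReal.ofReal (|u| ^ (-H)) with hφ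
    have h2 : ∀ᵐ s : I, P ((fun ω => (ω, s)) ⁻¹' S) ≤ φ (s - t) := by
      filter_upwards [Measure.ae_ne volume t] with s hs
      by_cases hst : ((s : ℝ) - t) ∈ Set.Icc (-r) r
      · rw [hφ, Set.indicator_of_mem hst, ← ENNReal.ofReal_mul (by positivity)]
        rcases lt_or_gt_of_ne hs with hlt | hlt
        · refine (measure_mono fun ω hω => ?_).trans ((hC ε h B hB s t hlt r hr).trans_eq ?_)
          · have h3 : |B ω s - B ω t| ≤ r := hω.2
            rwa [abs_sub_comm] at h3
          · rw [abs_sub_comm, abs_of_pos (sub_pos.2 (Subtype.coe_lt_coe.2 hlt))]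
        · refine (measure_mono fun ω hω => ?_).trans ((hC ε h B hB t s hlt r hr).trans_eq ?_)
          · exact hω.2
          · rw [abs_of_pos (sub_pos.2 (Subtype.coe_lt_coe.2 hlt))]
      · have h3 : (fun ω => (ω, s)) ⁻¹' S = ∅ := by
          refine Set.eq_empty_of_forall_notMem fun ω hω => hst ?_
          exact abs_le.1 hω.1
        rw [h3, measure_empty]
        exact zero_le
    calc ∫⁻ ω, volume (Prod.mk (ω, t) ⁻¹' nearSet B r) ∂P
        ≤ ∫⁻ s : I, φ (s - t) := h1.trans_le (lintegral_mono_ae h2)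
      _ ≤ ∫⁻ u, φ u := lintegral_unitInterval_sub_le t
      _ = ENNReal.ofReal (C * r) * ∫⁻ u in Set.Icc (-r) r, ENNReal.ofReal (|u| ^ (-H)) := by
          rw [hφ, lintegral_indicator measurableSet_Icc, lintegral_const_mul _ (by fun_prop)]
      _ ≤ ENNReal.ofReal (C * r) * ENNReal.ofReal (2 * (r ^ (1 - H) / (1 - H))) := by
          gcongr
          exact lintegral_abs_rpow_neg_le hH1' hr.le
      _ = _ := by
          rw [← ENNReal.ofReal_mul (by positivity)]
          congr 1
          have h3 : r ^ (2 - H) = r * r ^ (1 - H) := by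
            rw [← Real.rpow_one_add' hr.le (by linarith)]
            congr 1
            ring
          rw [h3]
          ring

theorem ae_le_dimH_graph_of_lt (h : IsSignField P H ε) (hH : 1 / 2 < H) (hH1 : H ≤ 1)
    {B : Ω → C(I, ℝ)} (hBm : StronglyMeasurable B)
    (hB : ∀ᵐ ω ∂P, Tendsto (fun n => randCascade H ε n ω) atTop (𝓝 (B ω)))
    {γ : ℝ≥0} (hγ : (γ : ℝ) < 2 - H) : ∀ᵐ ω ∂P, (γ : ℝ≥0∞) ≤ dimH (graph (B ω)) := by
  obtain ⟨K, hK⟩ := h.exists_lintegral_nearSet_le hH hH1 hBm hB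
  set F : ℕ → Ω × I → ℝ≥0∞ := fun p q => ENNReal.ofReal (((2 : ℝ) ^ p) ^ (γ : ℝ)) *
    volume (Prod.mk q ⁻¹' nearSet B ((2 : ℝ)⁻¹ ^ p)) with hF
  have hFm : ∀ p, Measurable (F p) := fun p =>
    (measurable_measure_prodMk_left (measurableSet_nearSet hBm _)).const_mul _
  have hθ : (2 : ℝ) ^ ((γ : ℝ) - (2 - H)) < 1 :=
    Real.rpow_lt_one_of_one_lt_of_neg one_lt_two (by linarith)
  have hbound : ∀ p, ∫⁻ q, F p q ∂(P.prod volume) ≤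
      ENNReal.ofReal (K * ((2 : ℝ) ^ ((γ : ℝ) - (2 - H))) ^ p) := by
    intro p
    rw [lintegral_prod_symm _ (hFm p).aemeasurable]
    calc ∫⁻ t : I, ∫⁻ ω, F p (ω, t) ∂P
        ≤ ∫⁻ _t : I, ENNReal.ofReal (K * ((2 : ℝ) ^ ((γ : ℝ) - (2 - H))) ^ p) := by
          refine lintegral_mono fun t => ?_
          have hm : Measurable fun ω => volume (Prod.mk (ω, t) ⁻¹' nearSet B ((2 : ℝ)⁻¹ ^ p)) :=
            (measurable_measure_prodMk_left (measurableSet_nearSet hBm _)).comp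
              measurable_prodMk_right
          rw [lintegral_const_mul _ hm]
          calc _ ≤ ENNReal.ofReal (((2 : ℝ) ^ p) ^ (γ : ℝ)) *
                ENNReal.ofReal (K * ((2 : ℝ)⁻¹ ^ p) ^ (2 - H)) := by
                gcongr
                exact hK _ (by positivity) t
            _ = _ := by
                rw [← ENNReal.ofReal_mul (by positivity)]
                congr 1
                have h1 : ((2 : ℝ) ^ p) ^ (γ : ℝ) * ((2 : ℝ)⁻¹ ^ p) ^ (2 - H) =
                    ((2 : ℝ) ^ ((γ : ℝ) - (2 - H))) ^ p := by
                  rw [inv_pow, Real.inv_rpow (by positivity), ← Real.rpow_neg (by positivity),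
                    ← Real.rpow_add (by positivity), ← Real.rpow_natCast, ← Real.rpow_natCast,
                    ← Real.rpow_mul two_pos.le, ← Real.rpow_mul two_pos.le]
                  congr 1
                  ring
                rw [← h1]
                ring
      _ = _ := by simp
  have hsum : ∫⁻ q, ∑' p, F p q ∂(P.prod volume) ≠ ⊤ := by
    rw [lintegral_tsum fun p => (hFm p).aemeasurable]
    refine ne_top_of_le_ne_top ?_ (ENNReal.tsum_le_tsum hbound)
    exact ((summable_geometric_of_lt_one (by positivity) hθ).mul_left K).tsum_ofReal_ne_top
  have hae := Measure.ae_ae_of_ae_prod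
    (ae_lt_top (Measurable.tsum hFm) hsum)
  filter_upwards [hae] with ω hω
  refine le_dimH_graph_of_ae_tsum_ne_top ?_
  filter_upwards [hω] with t ht
  exact ht.ne

/-- Almost surely, the Hausdorff dimension of the graph of the limit is at least `2 - H`. -/
theorem ae_le_dimH_graph (h : IsSignField P H ε) (hH : 1 / 2 < H) (hH1 : H ≤ 1)
    {B : Ω → C(I, ℝ)} (hBm : StronglyMeasurable B)
    (hB : ∀ᵐ ω ∂P, Tendsto (fun n => randCascade H ε n ω) atTop (𝓝 (B ω))) :
    ∀ᵐ ω ∂P, ∀ γ : ℝ≥0, (γ : ℝ) < 2 - H → (γ : ℝ≥0∞) ≤ dimH (graph (B ω)) := by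
  have h1 : ∀ᵐ ω ∂P, ∀ n : ℕ,
      ((2 - H - 1 / ((n : ℝ) + 1)).toNNReal : ℝ≥0∞) ≤ dimH (graph (B ω)) := by
    refine ae_all_iff.2 fun n => h.ae_le_dimH_graph_of_lt hH hH1 hBm hB ?_
    have h2 : (0 : ℝ) < 1 / ((n : ℝ) + 1) := by positivity
    rw [Real.coe_toNNReal']
    exact max_lt (by linarith) (by linarith)
  filter_upwards [h1] with ω hω γ hγ
  obtain ⟨n, hn⟩ := exists_nat_one_div_lt (sub_pos.2 hγ)
  refine le_trans ?_ (hω n)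
  rw [ENNReal.coe_le_coe]
  exact NNReal.le_toNNReal_of_coe_le (by linarith)

end IsSignField

end SignedCascade

theorem theorem1 {Ω : Type*} [MeasurableSpace Ω] (P : Measure Ω) [IsProbabilityMeasure P]
    (H : ℝ) (hH : 1 / 2 < H) (hH1 : H ≤ 1)
    (ε : List Bool → Ω → ℝ) (hε : ∀ w, Measurable (ε w)) (hind : iIndepFun ε P)
    (hpos : ∀ w, P {ω | ε w ω = 1} = ENNReal.ofReal ((1 + (2 : ℝ) ^ (H - 1)) / 2))
    (hneg : ∀ w, P {ω | ε w ω = -1} = ENNReal.ofReal ((1 - (2 : ℝ) ^ (H - 1)) / 2)) :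
    Martingale (fun n ω => SignedCascade.cascade H (fun v => ε v ω) n)
      (SignedCascade.signFiltration ε hε) P ∧
    ∃ B : List Bool → Ω → C(I, ℝ),
      (∀ᵐ ω ∂P, ∀ w, Tendsto
        (fun n => SignedCascade.cascade H (SignedCascade.shift (fun v => ε v ω) w) n)
        atTop (𝓝 (B w ω))) ∧
      (∀ q : ℝ≥0∞, 1 ≤ q → q ≠ ⊤ → MemLp (B []) q P ∧
        Tendsto (fun n => eLpNorm
          (fun ω => SignedCascade.cascade H (fun v => ε v ω) n - B [] ω) q P) atTop (𝓝 0)) ∧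
      (Integrable (B []) P ∧ ∫ ω, B [] ω ∂P = SignedCascade.idFun) ∧
      ∀ᵐ ω ∂P,
        (∀ w : List Bool, 1 ≤ w.length → ∀ (t : I) (ht : (t : ℝ) ∈ SignedCascade.dyadicInterval w),
          B [] ω t - B [] ω ⟨SignedCascade.leftEnd w, SignedCascade.leftEnd_mem w⟩
            = SignedCascade.signProd (fun v => ε v ω) w * (2 : ℝ) ^ (-((w.length : ℝ) * H)) *
              B w ω ⟨SignedCascade.rescale w t, SignedCascade.rescale_mem ht⟩) ∧
        (∀ α : ℝ≥0, 0 < α → (α : ℝ) < H → ∃ C : ℝ≥0, HolderWith C α (B [] ω)) ∧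
        (∀ t : I, SignedCascade.pointwiseExponent (B [] ω) t = (H : EReal)) ∧
        dimH (SignedCascade.graph (B [] ω)) = ENNReal.ofReal (2 - H) ∧
        SignedCascade.lowerBoxDim (SignedCascade.graph (B [] ω)) = ((2 - H : ℝ) : EReal) ∧
        SignedCascade.upperBoxDim (SignedCascade.graph (B [] ω)) = ((2 - H : ℝ) : EReal) := by
  have h : SignedCascade.IsSignField P H ε := ⟨hε, hind, hpos, hneg⟩
  choose B hBm hB using fun w => exists_stronglyMeasurable_limit_of_tendsto_ae
    (fun n => ((h.below w).stronglyMeasurable_randCascade n).aestronglyMeasurable)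
    ((h.below w).ae_exists_tendsto hH hH1)
  have hB0 : ∀ᵐ ω ∂P, Tendsto (fun n => SignedCascade.randCascade H ε n ω) atTop (𝓝 (B [] ω)) :=
    hB []
  refine ⟨h.martingale hH1, B, ae_all_iff.2 hB, fun q _ hq =>
    h.memLp_and_tendsto_eLpNorm hH hH1 (hBm []) hB0 hq, h.integral_limit hH hH1 (hBm []) hB0, ?_⟩
  have hgrowth : ∀ᵐ ω ∂P, ∀ n : ℕ, ∀ᶠ p : ℕ in atTop, ∀ w : List Bool, w.length = p →
      ‖B w ω‖ ≤ (2 : ℝ) ^ ((1 / ((n : ℝ) + 1)) * p) :=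
    ae_all_iff.2 fun n => h.ae_eventually_norm_le hH hH1 hBm hB (by positivity)
  filter_upwards [ae_all_iff.2 hB, h.ae_abs_eq_one hH1, hgrowth,
    h.ae_le_dimH_graph hH hH1 (hBm []) hB0, h.ae_eventually_osc hH hH1 hB] with ω hlim hsign hnorm hdim hosc
  have hhol : ∀ α : ℝ≥0, 0 < α → (α : ℝ) < H → ∃ C : ℝ≥0, HolderWith C α (B [] ω) := by
    intro α _ hα
    obtain ⟨n, hn⟩ := exists_nat_one_div_lt (sub_pos.2 hα)
    exact SignedCascade.exists_holderWith_limit (e := fun v => ε v ω) (f := fun w => B w ω) hsign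
      hlim (hnorm n) (by linarith)
  refine ⟨fun w _ t ht => SignedCascade.limit_sub_leftEnd (e := fun v => ε v ω)
    (f := fun w => B w ω) hlim w t ht, hhol, fun t => le_antisymm ?_ ?_,
    SignedCascade.graph_dimensions (by linarith) hH1 hhol hdim⟩
  · exact SignedCascade.pointwiseExponent_le fun a ha =>
      SignedCascade.frequently_rpow_le_abs_sub (e := fun v => ε v ω) (f := fun w => B w ω) hsign
        hlim hosc (by linarith) ha t
  · exact SignedCascade.le_pointwiseExponent (by linarith) hhol t
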